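/- **Notation.** Let $\tau\in\mathbb H$, $q^a=e^{2\pi i a\tau}$ and $y_z^a=e^{2\pi i a z}$. Let $\eta(\tau)=q^{1/24}\prod_{n\ge1}(1-q^n)$, $E_2(\tau)=1-24\sum_{n\ge1}\sigma_1(n)q^n$, $$\theta_{11}(\tau;z)=\sum_{n\in\mathbb Z}q^{(n+1/2)^2/2}e^{2\pi i(z+1/2)(n+1/2)},\qquad \vartheta_{k,r}(\tau;z)=\sum_{n\equiv r\,(2k)}q^{n^2/4k}y_z^n,\qquad \widehat\vartheta_{k,r}=\vartheta_{k,r}-\vartheta_{k,-r}.$$ For $m\ge 0$ and $0\le l\le m$ let $\chi^{(m)}_l(\tau;z)=\widehat\vartheta_{m+2,l+1}(\tau;z/2)/\widehat\vartheta_{2,1}(\tau;z/2)$. For $m\ge1$ the string functions $c^{(m)}_{l,r}(\tau)$ (with $r\in\mathbb Z$, of period $2m$ in $r$) are defined by $\chi^{(m)}_l(\tau;z)=\sum_{r\in\mathbb Z_{2m}}c^{(m)}_{l,r}(\tau)\,\vartheta_{m,r}(\tau;z/2)$ for all $z$. For $k\ge3$, $0\le l\le k-2$ and $r,s\in\mathbb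 Z$ put $$\chi^{l,s,k}_r(\tau;z)=\sum_{n\in\mathbb Z_{k-2}}c^{(k-2)}_{l,r-s+4n}(\tau)\,\vartheta_{2k(k-2),\,2r+k(4n-s)}(\tau;z/2k),$$ and for $k=2$ (where $l=0$) put $\chi^{0,s,2}_r=1$ if $r\equiv s\pmod 4$ and $0$ otherwise. Let $C^{l,k}_r(\tau;z)=i\big(\chi^{l,1,k}_r(\tau;z)-\chi^{l,3,k}_r(\tau;z)\big)$. For $k\ge2$, $1\le j,j'\le k-1$ and $u,v\notin\mathbb Z\tau+\mathbb Z$ define the Appell–Lerch sum $$\mu^{k,j,j'}(\tau;v,u,w)=\frac{y_v^{j'/k}}{\theta_{11}(\tau;u)}\sum_{n\in\mathbb Z}\frac{q^{n^2/k+j'n/k}}{1-y_vq^n}\;y_u^{n}\,y_w^{(1-2/k)n}\,y_v^{-(1-2/k)n}\;C^{j-1,k}_{2n+j'}(\tau;w-v).$$ For $d\mid k$ let $\Omega^{(k,d)}_{r,r'}=1$ if $r+r'\equiv0\pmod{2d}$ and $r-r'\equiv0\pmod{2k/d}$, and $0$ otherwise. Let $$F_2^{(k,d)}(\tau)=\Big(d\sum_{\substack{r,s\in\mathbb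 Z\\ kr>d^2s>0}}-\frac kd\sum_{\substack{r,s\in\mathbb Z\\ d^2r>ks>0}}\Big)\,s\,q^{rs}.$$ Let $Y$ be one of the root systems $A_n$ $(n\ge1)$, $D_n$ $(n\ge4)$, $E_6,E_7,E_8$, let $\mathrm{rk}(Y)$ be its rank, $k$ its Coxeter number ($n+1$, $2n-2$, $12$, $18$, $30$ respectively), and let $\mathcal D_Y=\{1\}$, $\{1,n-1\}$, $\{1,4,6\}$, $\{1,6,9\}$, $\{1,6,10,15\}$ respectively. Put $\Omega^Y=\sum_{d\in\mathcal D_Y}\Omega^{(k,d)}$, $\widehat\Omega^Y_{r,r'}=\Omega^Y_{r,r'}-\Omega^Y_{r,-r'}$, $F_2^Y=\sum_{d\in\mathcal D_Y}F_2^{(k,d)}$ and $\mu^Y=\sum_{j,j'=1}^{k-1}\widehat\Omega^Y_{j,j'}\,\mu^{k,j,j'}$. Let $\Pi_2=\{\tfrac12,\tfrac\tau2,\tfrac{\tau+1}2\}$. **Theorem.** For every such $Y$ and every $\tau\in\mathbb H$, the string functions $c^{(k-2)}_{l,r}(\tau)$, $0\le l\le k-2$, exist and are unique (when $k>2$); the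 series defining $\mu^{k,j,j'}(\tau;w,w,0)$ for $w\in\Pi_2$, $1\le j,j'\le k-1$, and those defining $F_2^{(k,d)}(\tau)$ for $d\in\mathcal D_Y$, converge absolutely; and $$4\,\eta(\tau)^3\sum_{w\in\Pi_2}\mu^Y(\tau;w,w,0)\;=\;\mathrm{rk}(Y)\,E_2(\tau)-24\,F_2^Y(\tau).$$ -/

import Mathlib

open UpperHalfPlane

namespace HelicitySupertrace

/-- `e(x) = exp(2πix)`; thus `q^a = e(aτ)` and `y_z^a = e(az)`, with no choice of branch. -/
noncomputable def ex (x : ℂ) : ℂ := Complex.exp (2 * Real.pi * Complex.I * x)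

/-- The Jacobi theta function `θ_{ab}(τ;z) = ∑_{n ∈ ℤ} q^{(n+a/2)²/2} e^{2πi(z+b/2)(n+a/2)}`. -/
noncomputable def thetaChar (a b : ℤ) (τ : ℍ) (z : ℂ) : ℂ :=
  ∑' n : ℤ, ex (((n : ℂ) + a / 2) ^ 2 / 2 * τ) * ex ((z + b / 2) * ((n : ℂ) + a / 2))

/-- The level `k` theta function `ϑ_{k,r}(τ;z) = ∑_{n ≡ r mod 2k} q^{n²/4k} yⁿ`, where the
summation index is written as `2kn + r` with `n ∈ ℤ`. -/
noncomputable def thetaLevel (k : ℕ) (r : ℤ) (τ : ℍ) (z : ℂ) : ℂ :=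
  ∑' n : ℤ, ex ((2 * k * n + r : ℂ) ^ 2 / (4 * k) * τ) * ex ((2 * k * n + r : ℂ) * z)

/-- `ϑ̂_{k,r} = ϑ_{k,r} - ϑ_{k,-r}`. -/
noncomputable def thetaHat (k : ℕ) (r : ℤ) (τ : ℍ) (z : ℂ) : ℂ :=
  thetaLevel k r τ z - thetaLevel k (-r) τ z

/-- The character `χ_l^{(m)}(τ;z)` of affine `SU(2)` at level `m` and spin label `l` (`0 ≤ l ≤ m`),
off the zeros of the denominator, where it has removable singularities. -/
noncomputable def su2Char (m l : ℕ) (τ : ℍ) (z : ℂ) : ℂ :=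
  thetaHat (m + 2) (l + 1) τ (z / 2) / thetaHat 2 1 τ (z / 2)

/-- `c` is the family `r ↦ c_{l,r}^{(m)}(τ)` (`r ∈ ℤ`, of period `2m`) of string functions:
`χ_l^{(m)}(τ;z) = ∑_{r mod 2m} c_{l,r}^{(m)}(τ) ϑ_{m,r}(τ;z/2)` as functions of `z`. -/
def IsStringFunction (m l : ℕ) (τ : ℍ) (c : ℤ → ℂ) : Prop :=
  (∀ r : ℤ, c (r + 2 * m) = c r) ∧
  ∀ z : ℂ, thetaHat 2 1 τ (z / 2) ≠ 0 →
    su2Char m l τ z = ∑ r ∈ Finset.range (2 * m), c r * thetaLevel m r τ (z / 2)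

/-- The string functions `c_{l,r}^{(m)}(τ)`, for `m ≥ 1` and `0 ≤ l ≤ m`. -/
noncomputable def stringFunction (m l : ℕ) (τ : ℍ) : ℤ → ℂ :=
  Classical.epsilon (IsStringFunction m l τ)

/-- The `N = 2` minimal model (supersymmetric `SU(2)_k/U(1)`) characters `χ_r^{l,s,k}(τ;z)`,
for `k ≥ 2` and `0 ≤ l ≤ k - 2`. At `k = 2`, where the coset is trivial, the character is
`δ_{r,s mod 4}`. -/
noncomputable def minimalChar (k l : ℕ) (s r : ℤ) (τ : ℍ) (z : ℂ) : ℂ :=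
  if k = 2 then (if (4 : ℤ) ∣ r - s then 1 else 0)
  else ∑ n ∈ Finset.range (k - 2),
    stringFunction (k - 2) l τ (r - s + 4 * n) *
      thetaLevel (2 * k * (k - 2)) (2 * r + k * (4 * n - s)) τ (z / (2 * k))

/-- `C_r^{l,k}[a;b](τ;z) = e^{πiab/2} (χ_r^{l,a,k}(τ;z) + (-1)^b χ_r^{l,a+2,k}(τ;z))`. -/
noncomputable def cosetChar (k l : ℕ) (a b : ℕ) (r : ℤ) (τ : ℍ) (z : ℂ) : ℂ :=
  ex (a * b / 4) * (minimalChar k l a r τ z + (-1) ^ b * minimalChar k l (a + 2) r τ z)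

/-- The `n`-th term of the series in `μ^{k,j,j'}(τ;v,u,w)`:
`q^{n²/k} q^{j'n/k} / (1 - y_v qⁿ) · (y_u y_w^{1-2/k} / y_v^{1-2/k})ⁿ C_{2n+j'}^{j-1,k}[1;1](τ;w-v)`. -/
noncomputable def muTerm (k j j' : ℕ) (τ : ℍ) (v u w : ℂ) (n : ℤ) : ℂ :=
  ex ((n ^ 2 / k + j' * n / k : ℂ) * τ) / (1 - ex v * ex (n * τ)) *
    ex (n * (u + (1 - 2 / k) * w - (1 - 2 / k) * v)) *
    cosetChar k (j - 1) 1 1 (2 * n + j') τ (w - v)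

/-- The multi-variable Appell–Lerch sum `μ^{k,j,j'}(τ;v,u,w)`, for `k ≥ 2`, `1 ≤ j, j' ≤ k - 1` and
`v, u ∉ ℤτ + ℤ`. -/
noncomputable def mu (k j j' : ℕ) (τ : ℍ) (v u w : ℂ) : ℂ :=
  ex (j' / k * v) / thetaChar 1 1 τ u * ∑' n : ℤ, muTerm k j j' τ v u w n

/-- The ADE root systems. -/
inductive ADE : Type
  | A (n : ℕ) (hn : 1 ≤ n)
  | D (n : ℕ) (hn : 4 ≤ n)
  | E6
  | E7
  | E8

/-- The rank `rk(Y)`. -/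
def ADE.rank : ADE → ℕ
  | .A n _ => n
  | .D n _ => n
  | .E6 => 6
  | .E7 => 7
  | .E8 => 8

/-- The Coxeter number of `Y`. -/
def ADE.coxeter : ADE → ℕ
  | .A n _ => n + 1
  | .D n _ => 2 * (n - 1)
  | .E6 => 12
  | .E7 => 18
  | .E8 => 30

/-- The divisors `d` of the Coxeter number `k` of `Y` for which `Ω^{(k,d)}` is a summand
of `Ω^Y`. -/
def ADE.divisors : ADE → Finset ℕ
  | .A _ _ => {1}
  | .D n _ => {1, n - 1}
  | .E6 => {1, 4, 6}
  | .E7 => {1, 6, 9}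
  | .E8 => {1, 6, 10, 15}

/-- The entries of `Ω^{(k,d)}`, for `d ∣ k`; rows and columns are indexed modulo `2k`. -/
def Omega (k d : ℕ) (r r' : ℤ) : ℂ :=
  if (2 * d : ℤ) ∣ r + r' ∧ (2 * (k / d : ℕ) : ℤ) ∣ r - r' then 1 else 0

/-- `Ω^Y = ∑_d Ω^{(k,d)}`, with `k` the Coxeter number of `Y`. -/
noncomputable def OmegaADE (Y : ADE) (r r' : ℤ) : ℂ :=
  ∑ d ∈ Y.divisors, Omega Y.coxeter d r r'

/-- `Ω̂^Y_{r,r'} = Ω^Y_{r,r'} - Ω^Y_{r,-r'}`. -/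
noncomputable def OmegaHatADE (Y : ADE) (r r' : ℤ) : ℂ :=
  OmegaADE Y r r' - OmegaADE Y r (-r')

/-- `μ^Y(τ;v,u,w) = ∑_{j,j'=1}^{k-1} Ω̂^Y_{j,j'} μ^{k,j,j'}(τ;v,u,w)`, with `k` the Coxeter number
of `Y`. -/
noncomputable def muADE (Y : ADE) (τ : ℍ) (v u w : ℂ) : ℂ :=
  ∑ j ∈ Finset.Icc 1 (Y.coxeter - 1), ∑ j' ∈ Finset.Icc 1 (Y.coxeter - 1),
    OmegaHatADE Y j j' * mu Y.coxeter j j' τ v u w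

/-- The nonzero 2-torsion points `Π₂ = {1/2, τ/2, (τ+1)/2}`. -/
noncomputable def twoTorsion (τ : ℍ) : Finset ℂ :=
  {1 / 2, (τ : ℂ) / 2, ((τ : ℂ) + 1) / 2}

/-- The pairs of integers `(r, s)` with `a r > b s > 0`. -/
def cone (a b : ℕ) : Set (ℤ × ℤ) := {p | (b : ℤ) * p.2 < a * p.1 ∧ 0 < (b : ℤ) * p.2}

/-- The term `s q^{rs}`. -/
noncomputable def divTerm (τ : ℍ) (p : ℤ × ℤ) : ℂ := p.2 * ex (p.1 * p.2 * τ)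

/-- `F_2^{(k,d)}(τ) = (d ∑_{kr > d²s > 0} - (k/d) ∑_{d²r > ks > 0}) s q^{rs}`, for `d ∣ k`. -/
noncomputable def F2 (k d : ℕ) (τ : ℍ) : ℂ :=
  (d : ℂ) * ∑' p : cone k (d ^ 2), divTerm τ p -
    (k / d : ℂ) * ∑' p : cone (d ^ 2) k, divTerm τ p

/-- `F_2^Y = ∑_d F_2^{(k,d)}`, over the same `d` as in `Ω^Y`. -/
noncomputable def F2ADE (Y : ADE) (τ : ℍ) : ℂ :=
  ∑ d ∈ Y.divisors, F2 Y.coxeter d τ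

end HelicitySupertrace

/-! Write y = e(w), and let θ be `thSeries`, which up to elementary factors is both θ₁₁ and
ϑ̂_{2,1}. No modularity is used: the Appell–Lerch sum is turned into an explicit double sum with
weights 1/(1 − y qⁿ), and that sum is evaluated.

Generating function. An orthogonal change of variables in the exponents of the coset characters
gives ∑_r q^{r²/4k} e(r(x + w/k)) C_r(−w) = i ϑ̂_{k,j}(x) ϑ̂_{2,1}(x + w/2) / ϑ̂_{2,1}(x)
(`cosetChar_generating`). The string functions survive only through their defining product.
Kronecker's identity `thSeries_mul_lerch` expands θ(2x + w)/θ(2x) with coefficients proportional to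
1/(1 − y q^m) in the strip 0 < Im 2x < Im τ. Comparing Laurent coefficients (`laurent_unique`)
writes each C_r as a single sum (`appell_mul_cosetChar`). The proportionality factor `appell`
satisfies appell · θ = −∏(1 − qⁿ)³, by `appell_mul_thSeries` and Jacobi's identity
`tsum_int_mul_thCoeff`; this is where η³ comes from.

Evaluation. Hence η³ μ(w,w,0) = −q^{−j'²/4k} ∑_n ∑_t a_n a_{n+t} H_t, where a_n = 1/(1 − y qⁿ) and
H_t is the coefficient of ϑ̂_{k,j} at j' − 2t. Since ϑ̂ is odd, ∑_t H_t = 0, so the divergent sums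
∑_n a_n a_{n+t} may be regularized by a subtraction independent of t. Partial fractions then leave
−(δ_{j'≡j} − δ_{j'≡−j}) ℘(w), with congruences modulo 2k and ℘ standing for `wpSeries`, plus a Lerch
sum with weights t q^t/(1 − q^t) that does not depend on w (`eta_cube_mul_mu_eq`). Over the three
torsion points ℘ sums to −E₂/4 (`sum_wpSeries_twoTorsion`).

Contraction. As a function of its first index, Ω̂^{(k,d)} is odd of period 2k, so summing against
the signs of ϑ̂_{k,j} reproduces it (`sum_mul_hatSign`). With k = de, the E₂ part becomes the trace
e − d (`trace_OmegaHat`), and these traces add up to the rank. In the Lerch part, expanding q^t/(1 −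
q^t) geometrically unfolds the residues j' into sums of s q^{rs} over cones; the boundary rays
cancel and −2 F₂ remains (`sum_lerchTerm_sub`). -/

namespace HelicitySupertrace

/-! ### The exponential e(x). -/

section Exponential

lemma ex_add (x y : ℂ) : ex (x + y) = ex x * ex y := by
  simp only [ex, ← Complex.exp_add]; congr 1; ring

@[simp] lemma ex_zero : ex 0 = 1 := by simp [ex]

@[simp] lemma ex_ne_zero (x : ℂ) : ex x ≠ 0 := Complex.exp_ne_zero _

lemma ex_neg (x : ℂ) : ex (-x) = (ex x)⁻¹ := by
  simp only [ex, ← Complex.exp_neg]; congr 1; ring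

@[simp] lemma ex_intCast (n : ℤ) : ex n = 1 := by
  rw [ex, show 2 * (Real.pi : ℂ) * Complex.I * n = n * (2 * Real.pi * Complex.I) by ring]
  exact Complex.exp_int_mul_two_pi_mul_I n

lemma ex_int_mul (n : ℤ) (x : ℂ) : ex (n * x) = ex x ^ n := by
  simp only [ex, ← Complex.exp_int_mul]; congr 1; ring

lemma ex_nat_mul (n : ℕ) (x : ℂ) : ex (n * x) = ex x ^ n := by
  simpa using ex_int_mul n x

lemma ex_half : ex (1 / 2) = -1 := by
  rw [ex, show 2 * (Real.pi : ℂ) * Complex.I * (1 / 2) = Real.pi * Complex.I by ring,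
    Complex.exp_pi_mul_I]

lemma ex_quarter : ex (1 / 4) = Complex.I := by
  rw [ex, show 2 * (Real.pi : ℂ) * Complex.I * (1 / 4) = Real.pi / 2 * Complex.I by ring,
    Complex.exp_pi_div_two_mul_I]

lemma norm_ex (x : ℂ) : ‖ex x‖ = Real.exp (-2 * Real.pi * x.im) := by
  rw [ex, Complex.norm_exp]; congr 1; simp

/-- `ex x = ex y` whenever `x` and `y` differ by an integer. -/
lemma ex_congr {x y : ℂ} (n : ℤ) (h : x = y + n) : ex x = ex y := by
  rw [h, ex_add, ex_intCast, mul_one]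

lemma ex_half_int_add_one (x : ℂ) : ex (x + 1 / 2) = -ex x := by
  rw [ex_add, ex_half]; ring

lemma norm_ex_lt_one {x : ℂ} (h : 0 < x.im) : ‖ex x‖ < 1 := by
  rw [norm_ex, Real.exp_lt_one_iff]
  have := mul_pos Real.pi_pos h
  linarith

lemma norm_ex_ofReal (t : ℝ) : ‖ex t‖ = 1 := by simp [norm_ex]

lemma summable_ex_quadratic {a : ℂ} (ha : 0 < a.im) (b c : ℂ) :
    Summable fun n : ℤ => ex (a * n ^ 2 + b * n + c) := by
  have h := (summable_jacobiTheta₂_term_iff b (2 * a)).2 (by simpa using ha)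
  refine (h.mul_right (ex c)).congr fun n => ?_
  simp only [jacobiTheta₂_term, ex, ← Complex.exp_add]
  congr 1; ring

end Exponential

/-! ### Products and uniqueness of Laurent series in e(x). -/

section Laurent

/-- Reindexing of double series along `(s, n) ↦ (s, n + c s)`. -/
def shearEquiv (c : ℤ) : ℤ × ℤ ≃ ℤ × ℤ where
  toFun p := (p.2, p.1 - c * p.2)
  invFun p := (p.2 + c * p.1, p.1)
  left_inv p := by simp
  right_inv p := by simp

lemma hasSum_convolution {f g : ℤ → ℂ} (c : ℤ) (hf : Summable f) (hg : Summable g) :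
    HasSum (fun p : ℤ × ℤ => f p.2 * g (p.1 - c * p.2)) ((∑' n, f n) * ∑' n, g n) := by
  have h := (summable_mul_of_summable_norm hf.norm hg.norm).hasSum
  rw [← tsum_mul_tsum_of_summable_norm hf.norm hg.norm] at h
  exact (shearEquiv c).hasSum_iff.2 h

lemma summable_convolution {f g : ℤ → ℂ} (c : ℤ) (hf : Summable f) (hg : Summable g) :
    Summable fun n => ∑' s, f s * g (n - c * s) :=
  (hasSum_convolution c hf hg).summable.prod

lemma tsum_convolution {f g : ℤ → ℂ} (c : ℤ) (hf : Summable f) (hg : Summable g) :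
    ∑' n, ∑' s, f s * g (n - c * s) = (∑' n, f n) * ∑' n, g n := by
  rw [← (hasSum_convolution c hf hg).tsum_eq]
  exact ((hasSum_convolution c hf hg).summable.tsum_prod).symm

/-- Multiplication of Laurent series in `ex x`, the first one being a series in `ex (c x)`. -/
lemma laurent_mul {a b : ℤ → ℂ} (c : ℤ) (x : ℂ) (ha : Summable fun n => a n * ex (n * (c * x)))
    (hb : Summable fun n => b n * ex (n * x)) :
    Summable (fun n : ℤ => (∑' s, a s * b (n - c * s)) * ex (n * x)) ∧
    ∑' n : ℤ, (∑' s, a s * b (n - c * s)) * ex (n * x) =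
      (∑' n, a n * ex (n * (c * x))) * ∑' n, b n * ex (n * x) := by
  have key : (fun n : ℤ => (∑' s, a s * b (n - c * s)) * ex (n * x)) =
      fun n => ∑' s : ℤ, (a s * ex (s * (c * x))) * (b (n - c * s) * ex ((n - c * s : ℤ) * x)) := by
    funext n
    rw [← tsum_mul_right]
    refine tsum_congr fun s => ?_
    rw [show (n : ℂ) * x = s * (c * x) + (n - c * s : ℤ) * x by push_cast; ring, ex_add]
    ring
  have h₁ := summable_convolution c ha hb
  have h₂ := tsum_convolution c ha hb
  rw [← key] at h₁
  rw [← key] at h₂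
  exact ⟨h₁, h₂⟩

lemma integral_ex_int (n : ℤ) : ∫ t in (0 : ℝ)..1, ex (n * t) = if n = 0 then 1 else 0 := by
  split_ifs with h
  · simp [h]
  · have hc : 2 * (Real.pi : ℂ) * Complex.I * n ≠ 0 := by
      simp [Real.pi_ne_zero, h]
    have := integral_exp_mul_complex (a := 0) (b := 1) hc
    simp only [ex]
    simp_rw [← mul_assoc]
    rw [this]
    have h1 := ex_intCast n
    simp only [ex] at h1
    simp [h1]

/-- Uniqueness of the coefficients of a Laurent series. -/
lemma laurent_unique {a : ℤ → ℂ} (x₀ : ℂ) (hs : Summable fun n => a n * ex (n * x₀))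
    (h : ∀ t : ℝ, ∑' n : ℤ, a n * ex (n * (x₀ + t)) = 0) (k : ℤ) : a k = 0 := by
  -- The k-th coefficient is extracted by integrating against e(−kt) over a period; absolute
  -- convergence at x₀ bounds the terms uniformly in t.
  let f : ℤ → C(ℝ, ℂ) := fun n => ⟨fun t => a n * ex (n * (x₀ + t)) * ex (-k * t), by
    unfold ex; fun_prop⟩
  have hn : ∀ n (t : ℝ), ‖f n t‖ = ‖a n * ex (n * x₀)‖ := by
    intro n t
    have h1 : ‖ex (n * t)‖ = 1 := by simpa using norm_ex_ofReal (n * t)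
    have h2 : ‖ex (-k * t)‖ = 1 := by simpa using norm_ex_ofReal (-k * t)
    change ‖a n * ex (n * (x₀ + t)) * ex (-k * t)‖ = _
    rw [mul_add, ex_add]
    simp only [norm_mul, h1, h2, mul_one]
  have hsum : Summable fun n : ℤ => ‖(f n).restrict
      (⟨Set.uIcc 0 1, isCompact_uIcc⟩ : TopologicalSpace.Compacts ℝ)‖ := by
    refine Summable.of_nonneg_of_le (fun _ => norm_nonneg _) (fun n => ?_) hs.norm
    rw [ContinuousMap.norm_le _ (norm_nonneg _)]
    intro t
    exact (hn n t).le
  have hI := intervalIntegral.hasSum_intervalIntegral_of_summable_norm (a := 0) (b := 1) hsum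
  have hz : ∀ t : ℝ, ∑' n, f n t = 0 := by
    intro t
    change ∑' n : ℤ, a n * ex (n * (x₀ + t)) * ex (-k * t) = 0
    rw [tsum_mul_right, h, zero_mul]
  simp only [hz, intervalIntegral.integral_zero] at hI
  have hint : ∀ n : ℤ, ∫ t in (0 : ℝ)..1, f n t = if n = k then a k * ex (k * x₀) else 0 := by
    intro n
    have : ∀ t : ℝ, f n t = a n * ex (n * x₀) * ex ((n - k : ℤ) * t) := by
      intro t
      change a n * ex (n * (x₀ + t)) * ex (-k * t) = _
      rw [mul_add, ex_add, show ((n - k : ℤ) : ℂ) * t = n * t + -k * t by push_cast; ring, ex_add]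
      ring
    simp only [this, intervalIntegral.integral_const_mul, integral_ex_int, sub_eq_zero]
    split_ifs with hk
    · rw [hk, mul_one]
    · simp
  simp only [hint] at hI
  have := hI.unique (hasSum_ite_eq k (a k * ex (k * x₀)))
  simpa using this.symm

end Laurent

/-! ### Splitting a sum over ℤ into residue classes. -/

section Residues

/-- Summation over `ℤ` by residue classes modulo `m`. -/
lemma tsum_residues {m : ℕ} (hm : 0 < m) {F : ℤ → ℂ} (hF : Summable F) :
    ∑ r ∈ Finset.range m, ∑' n : ℤ, F (m * n + r) = ∑' N, F N := by
  have : NeZero m := ⟨hm.ne'⟩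
  have hs : Summable fun p : ℤ × Fin m => F (p.1 * m + (p.2 : ℕ)) :=
    (Int.divModEquiv m).symm.summable_iff.2 hF
  have h₁ : ∑' N, F N = ∑' p : ℤ × Fin m, F (p.1 * m + (p.2 : ℕ)) :=
    ((Int.divModEquiv m).symm.tsum_eq F).symm
  rw [h₁, hs.tsum_prod, Finset.sum_range fun r : ℕ => ∑' n : ℤ, F (m * n + r)]
  rw [← Summable.tsum_finsetSum fun r _ => ?_]
  · simp only [tsum_fintype, mul_comm]
  · refine hF.comp_injective fun a b h => ?_
    simpa [hm.ne'] using h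

end Residues

end HelicitySupertrace

namespace HelicitySupertrace

variable (τ : ℍ)

/-! ### The odd theta function and its zeros. -/

section Theta

/-- The coefficients `(-1)ⁿ q^{n(n+1)/2}`. -/
noncomputable def thCoeff (n : ℤ) : ℂ := ex ((n * (n + 1) / 2 : ℂ) * τ + n / 2)

/-- The odd theta function `∑ (-1)ⁿ q^{n(n+1)/2} yⁿ`. -/
noncomputable def thSeries (u : ℂ) : ℂ := ∑' n : ℤ, thCoeff τ n * ex (n * u)

lemma thCoeff_ne_zero (n : ℤ) : thCoeff τ n ≠ 0 := ex_ne_zero _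

@[simp] lemma thCoeff_zero : thCoeff τ 0 = 1 := by simp [thCoeff]

lemma thCoeff_add (n m : ℤ) :
    thCoeff τ (n + m) = thCoeff τ n * thCoeff τ m * ex ((n * m : ℂ) * τ) := by
  simp only [thCoeff, ← ex_add]
  congr 1; push_cast; ring

lemma thCoeff_reflect (n : ℤ) : thCoeff τ (-1 - n) = -thCoeff τ n := by
  rw [thCoeff, thCoeff, ← ex_half_int_add_one]
  refine ex_congr (-n - 1) ?_
  push_cast; ring

lemma thCoeff_neg_mul (n : ℤ) : thCoeff τ (-n) * thCoeff τ n = ex ((n ^ 2 : ℂ) * τ) := by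
  simp only [thCoeff, ← ex_add]
  congr 1; push_cast; ring

lemma thCoeff_add_one (n : ℤ) : thCoeff τ (n + 1) = -ex (((n : ℂ) + 1) * τ) * thCoeff τ n := by
  rw [neg_mul, thCoeff, thCoeff, ← ex_add, ← ex_half_int_add_one]
  congr 1; push_cast; ring

lemma summable_thCoeff_mul (u : ℂ) : Summable fun n : ℤ => thCoeff τ n * ex (n * u) := by
  refine (summable_ex_quadratic (a := (τ : ℂ) / 2) (by simpa using τ.im_pos)
    (τ / 2 + 1 / 2 + u) 0).congr fun n => ?_
  rw [thCoeff, ← ex_add]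
  congr 1; ring

lemma summable_thCoeff : Summable (thCoeff τ) := by
  simpa using summable_thCoeff_mul τ 0

lemma tsum_thCoeff : ∑' n, thCoeff τ n = 0 := by
  have h : ∑' n, thCoeff τ n = -∑' n, thCoeff τ n := by
    -- The reflection n ↦ −1 − n reverses the sign of every coefficient.
    conv_lhs => rw [← (Equiv.subLeft (-1 : ℤ)).tsum_eq (thCoeff τ)]
    rw [← tsum_neg]
    exact tsum_congr fun n => thCoeff_reflect τ n
  exact self_eq_neg.1 h

lemma thCoeff_mul_ex (n m : ℤ) :
    thCoeff τ n * ex ((n * m : ℂ) * τ) = thCoeff τ (n + m) / thCoeff τ m := by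
  rw [eq_div_iff (thCoeff_ne_zero τ m), thCoeff_add]; ring

/-- `θ` vanishes at the lattice points. -/
lemma thSeries_lattice (m : ℤ) : thSeries τ (m * τ) = 0 := by
  have : ∀ n : ℤ, thCoeff τ n * ex (n * (m * τ)) = thCoeff τ (n + m) / thCoeff τ m := by
    intro n; rw [← thCoeff_mul_ex, mul_assoc]
  rw [thSeries, tsum_congr this, tsum_div_const]
  have h := (Equiv.addRight m).tsum_eq (thCoeff τ)
  simp only [Equiv.coe_addRight] at h
  rw [h, tsum_thCoeff, zero_div]

lemma thSeries_add_int_mul (z : ℂ) (m : ℤ) :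
    thSeries τ (z + m * τ) * (thCoeff τ m * ex (m * z)) = thSeries τ z := by
  rw [thSeries, ← tsum_mul_right]
  have h := (Equiv.addRight m).tsum_eq fun n : ℤ => thCoeff τ n * ex (n * z)
  simp only [Equiv.coe_addRight] at h
  rw [thSeries, ← h]
  refine tsum_congr fun n => ?_
  rw [thCoeff_add, show (n : ℂ) * (z + m * τ) = n * z + n * m * τ by ring,
    show ((n + m : ℤ) : ℂ) * z = n * z + m * z by push_cast; ring, ex_add, ex_add]
  ring

end Theta

/-! ### Points off the lattice and bounds for 1/(1 − y qᵐ). -/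

section OffLattice

/-- `z ∉ ℤτ + ℤ`. -/
def OffLattice (z : ℂ) : Prop := ∀ m : ℤ, ex z * ex (m * τ) ≠ 1

variable {τ} {z : ℂ}

lemma OffLattice.sub_ne_zero (hz : OffLattice τ z) (m : ℤ) : 1 - ex z * ex (m * τ) ≠ 0 :=
  fun h => hz m (by linear_combination -h)

lemma offLattice_of_im (h₀ : 0 < z.im) (h₁ : z.im < τ.im) : OffLattice τ z := by
  intro m h
  rw [← ex_add] at h
  have h2 := norm_ex (z + m * τ)
  rw [h, norm_one] at h2
  have h3 : -2 * Real.pi * (z + m * τ).im = 0 := by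
    rw [← Real.exp_eq_one_iff]; exact h2.symm
  have h4 : (z + m * τ).im = 0 := by
    have := Real.pi_pos.ne'
    simpa [this] using h3
  have h5 : z.im + m * τ.im = 0 := by simpa using h4
  have hτ := τ.im_pos
  rcases le_or_gt 0 m with hm | hm
  · have : (0 : ℝ) ≤ m := by exact_mod_cast hm
    nlinarith
  · have : (m : ℝ) ≤ -1 := by exact_mod_cast Int.le_sub_one_of_lt hm
    nlinarith

variable (τ) in
lemma norm_ex_tau_lt_one : ‖ex (τ : ℂ)‖ < 1 := norm_ex_lt_one (by simpa using τ.im_pos)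

variable (τ z) in
lemma tendsto_ex_mul_atTop :
    Filter.Tendsto (fun n : ℕ => ex z * ex ((n : ℤ) * τ)) Filter.atTop (nhds 0) := by
  have h := (tendsto_pow_atTop_nhds_zero_of_norm_lt_one (norm_ex_tau_lt_one τ)).const_mul (ex z)
  rw [mul_zero] at h
  refine h.congr fun n => ?_
  rw [ex_int_mul, zpow_natCast]

/-- The factors `1/(1 - y qᵐ)` are bounded. -/
lemma OffLattice.exists_bound (hz : OffLattice τ z) :
    ∃ K : ℝ, 0 ≤ K ∧ ∀ m : ℤ, ‖1 / (1 - ex z * ex (m * τ))‖ ≤ K := by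
  have h₁ : Filter.Tendsto (fun n : ℕ => 1 / (1 - ex z * ex ((n : ℤ) * τ))) Filter.atTop
      (nhds (1 / (1 - 0))) :=
    tendsto_const_nhds.div ((tendsto_ex_mul_atTop τ z).const_sub 1) (by simp)
  -- Towards −∞ the quantity x = y qᵐ is unbounded, so 1/(1 − x) is rewritten as x⁻¹/(x⁻¹ − 1),
  -- which tends to 0.
  have h₂ : Filter.Tendsto (fun n : ℕ => 1 / (1 - ex z * ex ((-n : ℤ) * τ))) Filter.atTop
      (nhds (0 / (0 - 1))) := by
    have h := tendsto_ex_mul_atTop τ (-z)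
    refine (h.div (h.sub_const 1) (by simp)).congr fun n => ?_
    have e : ex (-z) * ex ((n : ℤ) * τ) = (ex z * ex ((-n : ℤ) * τ))⁻¹ := by
      rw [← ex_add, ← ex_add, ← ex_neg]; congr 1; push_cast; ring
    have hne : ex z * ex ((-n : ℤ) * τ) ≠ 0 := mul_ne_zero (ex_ne_zero _) (ex_ne_zero _)
    rw [Pi.div_apply, e]
    have := hz.sub_ne_zero (-n)
    field_simp
  obtain ⟨K₁, hK₁⟩ := (Metric.isBounded_range_of_tendsto _ h₁).exists_norm_le
  obtain ⟨K₂, hK₂⟩ := (Metric.isBounded_range_of_tendsto _ h₂).exists_norm_le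
  refine ⟨max K₁ K₂, (norm_nonneg _).trans ((hK₁ _ ⟨0, rfl⟩).trans (le_max_left _ _)), fun m => ?_⟩
  obtain ⟨n, rfl | rfl⟩ := m.eq_nat_or_neg
  · exact (hK₁ _ ⟨n, rfl⟩).trans (le_max_left _ _)
  · exact (hK₂ _ ⟨n, rfl⟩).trans (le_max_right _ _)

lemma OffLattice.summable_mul_inv (hz : OffLattice τ z) {f : ℤ → ℂ} (hf : Summable f) :
    Summable fun m : ℤ => f m / (1 - ex z * ex (m * τ)) := by
  obtain ⟨K, -, hK⟩ := hz.exists_bound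
  refine Summable.of_norm_bounded (hf.norm.mul_right K) fun m => ?_
  rw [div_eq_mul_one_div, norm_mul]
  exact mul_le_mul_of_nonneg_left (hK m) (norm_nonneg _)

end OffLattice

/-! ### The Appell sum and Kronecker's identity. -/

section AppellSum

variable (z : ℂ)

/-- The Appell sum `∑ (-1)ᵐ q^{m(m-1)/2} / (1 - y qᵐ)`, a multiple of `1 / θ`. -/
noncomputable def appell : ℂ := ∑' m : ℤ, thCoeff τ (-m) / (1 - ex z * ex (m * τ))

variable {τ z}

lemma summable_thCoeff_sub (N : ℤ) : Summable fun m : ℤ => thCoeff τ (N - m) :=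
  (Equiv.subLeft N).summable_iff.2 (summable_thCoeff τ)

lemma tsum_thCoeff_sub (N : ℤ) : ∑' m : ℤ, thCoeff τ (N - m) = 0 := by
  have h := (Equiv.subLeft N).tsum_eq (thCoeff τ)
  rw [tsum_thCoeff] at h
  exact h

/-- The difference of the two sides has numerators divisible by 1 − y qᵐ; what remains is ∑ₘ
`thCoeff` (N + 1 − m) = 0. -/
lemma appell_shift_succ (hz : OffLattice τ z) (N : ℤ) :
    ∑' m : ℤ, thCoeff τ (N + 1 - m) / (1 - ex z * ex (m * τ)) =
      -ex ((N + 1) * τ) * ex z * ∑' m : ℤ, thCoeff τ (N - m) / (1 - ex z * ex (m * τ)) := by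
  have h₁ := hz.summable_mul_inv (summable_thCoeff_sub (τ := τ) (N + 1))
  have h₂ := (hz.summable_mul_inv (summable_thCoeff_sub (τ := τ) N)).mul_left
    (-ex ((N + 1) * τ) * ex z)
  rw [← tsum_mul_left, ← sub_eq_zero, ← h₁.tsum_sub h₂, ← tsum_thCoeff_sub (τ := τ) (N + 1)]
  refine tsum_congr fun m => ?_
  have hne := hz.sub_ne_zero m
  have e : thCoeff τ (N + 1 - m) = -ex ((N - m + 1) * τ) * thCoeff τ (N - m) := by
    have := thCoeff_add_one τ (N - m)
    rw [show N + 1 - m = N - m + 1 by ring, this]; push_cast; rfl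
  have e2 : ex (((N : ℂ) + 1) * τ) = ex ((N - m + 1) * τ) * ex (m * τ) := by
    rw [← ex_add]; congr 1; ring
  rw [e, e2]
  field_simp
  ring

lemma appell_shift (hz : OffLattice τ z) (N : ℤ) :
    ∑' m : ℤ, thCoeff τ (N - m) / (1 - ex z * ex (m * τ)) =
      thCoeff τ N * ex (N * z) * appell τ z := by
  induction N using Int.induction_on with
  | zero => simp [appell]
  | succ n ih =>
    rw [appell_shift_succ hz, ih, thCoeff_add_one,
      show ((n + 1 : ℤ) : ℂ) * z = (n : ℤ) * z + z by push_cast; ring, ex_add]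
    ring
  | pred n ih =>
    have h := appell_shift_succ hz (-n - 1)
    have h2 := thCoeff_add_one τ (-n - 1)
    rw [sub_add_cancel] at h h2
    rw [ih, h2, show ((-n : ℤ) : ℂ) * z = (-n - 1 : ℤ) * z + z by push_cast; ring, ex_add] at h
    have h3 : -ex ((((-n - 1 : ℤ) : ℂ) + 1) * τ) * ex z ≠ 0 :=
      mul_ne_zero (neg_ne_zero.2 (ex_ne_zero _)) (ex_ne_zero _)
    refine mul_left_cancel₀ h3 ?_
    rw [← h]; ring

/-- The Lerch-type sum `∑ y_uᵐ / (1 - y_z qᵐ)`. -/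
noncomputable def lerch (τ : ℍ) (z u : ℂ) : ℂ := ∑' m : ℤ, ex (m * u) / (1 - ex z * ex (m * τ))

lemma summable_int_of_geometric {f : ℤ → ℂ} {r : ℝ} (hr₀ : 0 ≤ r) (hr : r < 1) (C : ℝ)
    (h₁ : ∀ n : ℕ, ‖f n‖ ≤ C * r ^ n) (h₂ : ∀ n : ℕ, ‖f (-n)‖ ≤ C * r ^ n) : Summable f := by
  have hg := (summable_geometric_of_lt_one hr₀ hr).mul_left C
  exact Summable.of_nat_of_neg (Summable.of_norm_bounded hg h₁) (Summable.of_norm_bounded hg h₂)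

/-- Extracts the factor (y qᵐ)⁻¹, which gives geometric decay as m → −∞. -/
lemma OffLattice.neg_term (hz : OffLattice τ z) (m : ℤ) :
    1 / (1 - ex z * ex (m * τ)) =
      ex (-z) * ex (-m * τ) * (1 / (1 - ex z * ex (m * τ)) - 1) := by
  have h := hz.sub_ne_zero m
  have e : ex (-z) * ex (-m * τ) = (ex z * ex (m * τ))⁻¹ := by
    rw [neg_mul, ex_neg, ex_neg, mul_inv]
  have : ex z ≠ 0 := ex_ne_zero _
  have : ex (m * τ) ≠ 0 := ex_ne_zero _
  rw [e]
  field_simp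
  ring

/-- The terms decay like e(u)ⁿ at +∞ and like e(τ − u)ⁿ at −∞, whence the strip. -/
lemma summable_lerch (hz : OffLattice τ z) {u : ℂ} (h₀ : 0 < u.im) (h₁ : u.im < τ.im) :
    Summable fun m : ℤ => ex (m * u) / (1 - ex z * ex (m * τ)) := by
  obtain ⟨K, hK0, hK⟩ := hz.exists_bound
  have hr₁ := norm_ex_lt_one h₀
  have hr₂ : ‖ex ((τ : ℂ) - u)‖ < 1 := norm_ex_lt_one (by simpa using h₁)
  refine summable_int_of_geometric (r := max ‖ex u‖ ‖ex ((τ : ℂ) - u)‖)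
    (C := K + ‖ex (-z)‖ * (K + 1)) ?_ (max_lt hr₁ hr₂) ?_ ?_
  · exact (norm_nonneg _).trans (le_max_left _ _)
  · intro n
    rw [div_eq_mul_one_div, norm_mul, mul_comm]
    refine mul_le_mul ((hK _).trans ?_) ?_ (norm_nonneg _) (by positivity)
    · have : 0 ≤ ‖ex (-z)‖ * (K + 1) := by positivity
      linarith
    · rw [Int.cast_natCast, ex_nat_mul, norm_pow]
      exact pow_le_pow_left₀ (norm_nonneg _) (le_max_left _ _) n
  · intro n
    rw [div_eq_mul_one_div, hz.neg_term]
    have e : ex ((-n : ℤ) * u) * (ex (-z) * ex (-(-n : ℤ) * τ) *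
        (1 / (1 - ex z * ex ((-n : ℤ) * τ)) - 1)) =
        (ex (-z) * (1 / (1 - ex z * ex ((-n : ℤ) * τ)) - 1)) * ex (τ - u) ^ n := by
      rw [← ex_nat_mul, show (n : ℂ) * (τ - u) = (-n : ℤ) * u + -(-n : ℤ) * τ by push_cast; ring,
        ex_add]
      push_cast; ring
    push_cast at e ⊢
    rw [e, norm_mul, norm_mul, norm_pow]
    refine mul_le_mul ?_ (pow_le_pow_left₀ (norm_nonneg _) (le_max_right _ _) n)
      (by positivity) (by positivity)
    have h3 := norm_sub_le (1 / (1 - ex z * ex ((-n : ℤ) * τ))) 1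
    have h4 := hK (-n)
    rw [norm_one] at h3
    push_cast at h3 h4
    calc _ ≤ ‖ex (-z)‖ * (K + 1) := mul_le_mul_of_nonneg_left (by linarith) (norm_nonneg _)
      _ ≤ _ := by linarith

/-- The Kronecker identity. -/
lemma thSeries_mul_lerch (hz : OffLattice τ z) {u : ℂ} (h₀ : 0 < u.im) (h₁ : u.im < τ.im) :
    thSeries τ u * lerch τ z u = appell τ z * thSeries τ (u + z) := by
  have hs := summable_lerch hz h₀ h₁
  have hs' : Summable fun m : ℤ => (1 / (1 - ex z * ex (m * τ))) * ex (m * ((1 : ℤ) * u)) := by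
    refine hs.congr fun m => ?_
    rw [Int.cast_one, one_mul]; ring
  have h := (laurent_mul 1 u hs' (summable_thCoeff_mul τ u)).2
  have e : ∑' m : ℤ, (1 / (1 - ex z * ex (m * τ))) * ex (m * ((1 : ℤ) * u)) = lerch τ z u := by
    refine tsum_congr fun m => ?_
    rw [Int.cast_one, one_mul]; ring
  rw [e] at h
  rw [mul_comm, thSeries, ← h, thSeries, ← tsum_mul_left]
  refine tsum_congr fun n => ?_
  -- The coefficient of e(nu) in the product θ(u) · lerch is a shifted Appell sum, evaluated by
  -- `appell_shift`; the factor e(nz) turns θ(u) into θ(u + z).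
  have e2 : ∑' s : ℤ, 1 / (1 - ex z * ex (s * τ)) * thCoeff τ (n - 1 * s) =
      thCoeff τ n * ex (n * z) * appell τ z := by
    rw [← appell_shift hz]
    exact tsum_congr fun s => by rw [one_mul]; ring
  rw [e2, mul_add, ex_add]
  ring

end AppellSum

end HelicitySupertrace

namespace HelicitySupertrace

variable (τ : ℍ)

/-! ### The quotient θ/(1 − y) and the constancy of appell · θ. -/

section PartialSums

/-- The partial sums `∑_{n ≤ N} (-1)ⁿ q^{n(n+1)/2}`. -/
noncomputable def thPartial (N : ℤ) : ℂ := ∑' i : ℕ, thCoeff τ (N - i)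

lemma norm_thCoeff_succ (n : ℤ) :
    ‖thCoeff τ (n + 1)‖ = ‖ex (τ : ℂ)‖ ^ (n + 1) * ‖thCoeff τ n‖ := by
  rw [thCoeff_add_one, norm_mul, norm_neg, ← norm_zpow, ← ex_int_mul]
  push_cast; rfl

lemma norm_ex_tau_pos : 0 < ‖ex (τ : ℂ)‖ := norm_pos_iff.2 (ex_ne_zero _)

lemma norm_thCoeff_add_nat {N : ℤ} (hN : 0 ≤ N) (i : ℕ) :
    ‖thCoeff τ (N + i)‖ ≤ ‖ex (τ : ℂ)‖ ^ i * ‖thCoeff τ N‖ := by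
  induction i with
  | zero => simp
  | succ i ih =>
    have h := norm_thCoeff_succ τ (N + i)
    push_cast
    rw [← add_assoc, h, pow_succ', mul_assoc]
    refine mul_le_mul ?_ ih (norm_nonneg _) (norm_nonneg _)
    have := zpow_le_zpow_right_of_le_one₀ (norm_ex_tau_pos τ) (norm_ex_tau_lt_one τ).le
      (show (1 : ℤ) ≤ N + i + 1 by omega)
    simpa using this

lemma thCoeff_reflect' (n : ℤ) : ‖thCoeff τ n‖ = ‖thCoeff τ (-1 - n)‖ := by
  rw [thCoeff_reflect, norm_neg]

lemma norm_thCoeff_sub_nat {N : ℤ} (hN : N < 0) (i : ℕ) :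
    ‖thCoeff τ (N - i)‖ ≤ ‖ex (τ : ℂ)‖ ^ i * ‖thCoeff τ N‖ := by
  have := norm_thCoeff_add_nat τ (show 0 ≤ -1 - N by omega) i
  rw [thCoeff_reflect' τ (N - i), thCoeff_reflect' τ N]
  rwa [show -1 - (N - (i : ℤ)) = -1 - N + i by ring]

lemma summable_thCoeff_sub_nat (N : ℤ) : Summable fun i : ℕ => thCoeff τ (N - i) :=
  (summable_thCoeff τ).comp_injective fun a b h => by simpa using h

/-- The total sum vanishes, so a partial sum is minus its complementary tail; this yields decay at
+∞. -/
lemma thPartial_eq_neg (N : ℤ) : thPartial τ N = -∑' i : ℕ, thCoeff τ (N + 1 + i) := by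
  have h := tsum_thCoeff_sub (τ := τ) N
  rw [tsum_of_nat_of_neg_add_one (f := fun m : ℤ => thCoeff τ (N - m))
    (summable_thCoeff_sub_nat τ N)] at h
  · rw [eq_neg_iff_add_eq_zero, thPartial, ← h]
    congr 1
    exact tsum_congr fun i => by congr 1; ring
  · refine (summable_thCoeff τ).comp_injective (i := fun n : ℕ => N - -((n : ℤ) + 1)) fun a b h => ?_
    simpa using h

lemma thPartial_sub (N : ℤ) : thPartial τ N - thPartial τ (N - 1) = thCoeff τ N := by
  rw [thPartial, (summable_thCoeff_sub_nat τ N).tsum_eq_zero_add, thPartial]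
  have : ∀ i : ℕ, thCoeff τ (N - (i + 1 : ℕ)) = thCoeff τ (N - 1 - i) := by
    intro i; congr 1; push_cast; ring
  rw [tsum_congr this, Nat.cast_zero, sub_zero, add_sub_cancel_right]

lemma norm_thPartial_le (N : ℤ) :
    ‖thPartial τ N‖ ≤ (1 - ‖ex (τ : ℂ)‖)⁻¹ * ‖thCoeff τ N‖ := by
  have hg := (hasSum_geometric_of_lt_one (norm_nonneg _) (norm_ex_tau_lt_one τ)).mul_right
    ‖thCoeff τ N‖
  rcases lt_or_ge N 0 with hN | hN
  · exact tsum_of_norm_bounded hg (norm_thCoeff_sub_nat τ hN)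
  · rw [thPartial_eq_neg, norm_neg]
    refine tsum_of_norm_bounded hg fun i => ?_
    have := norm_thCoeff_add_nat τ hN (i + 1)
    rw [show N + ((i + 1 : ℕ) : ℤ) = N + 1 + i by push_cast; ring] at this
    refine this.trans (mul_le_mul_of_nonneg_right ?_ (norm_nonneg _))
    exact pow_le_pow_of_le_one (norm_nonneg _) (norm_ex_tau_lt_one τ).le (Nat.le_succ i)

lemma summable_of_norm_le_thCoeff {f : ℤ → ℂ} {C : ℝ} (hf : ∀ n, ‖f n‖ ≤ C * ‖thCoeff τ n‖)
    (u : ℂ) : Summable fun n : ℤ => f n * ex (n * u) := by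
  refine Summable.of_norm_bounded ((summable_thCoeff_mul τ u).norm.mul_left C) fun n => ?_
  rw [norm_mul, norm_mul, ← mul_assoc]
  exact mul_le_mul_of_nonneg_right (hf n) (norm_nonneg _)

/-- The quotient `θ / (1 - y)`. -/
noncomputable def thQuot (u : ℂ) : ℂ := ∑' n : ℤ, thPartial τ n * ex (n * u)

lemma summable_thQuot (u : ℂ) : Summable fun n : ℤ => thPartial τ n * ex (n * u) :=
  summable_of_norm_le_thCoeff τ (norm_thPartial_le τ) u

lemma thQuot_mul (u : ℂ) : thQuot τ u * (1 - ex u) = thSeries τ u := by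
  have h := summable_thQuot τ u
  have h' : Summable fun n : ℤ => thPartial τ (n - 1) * ex (n * u) := by
    have := (Equiv.subRight (1 : ℤ)).summable_iff.2 (h.mul_right (ex u))
    refine this.congr fun n => ?_
    simp only [Function.comp_apply, Equiv.subRight_apply]
    rw [mul_assoc, ← ex_add]
    congr 2; push_cast; ring
  have e : thQuot τ u * ex u = ∑' n : ℤ, thPartial τ (n - 1) * ex (n * u) := by
    rw [thQuot, ← tsum_mul_right, ← (Equiv.subRight (1 : ℤ)).tsum_eq]
    refine tsum_congr fun n => ?_
    simp only [Equiv.subRight_apply]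
    rw [mul_assoc, ← ex_add]
    congr 2; push_cast; ring
  rw [mul_sub, mul_one, e, thQuot, ← h.tsum_sub h', thSeries]
  refine tsum_congr fun n => ?_
  rw [← sub_mul, thPartial_sub]

/-- θ vanishes at mτ, while the divided factor 1 − e(mτ) does not when m ≠ 0. -/
lemma thQuot_lattice {m : ℤ} (hm : m ≠ 0) : thQuot τ (m * τ) = 0 := by
  have h := thQuot_mul τ (m * τ)
  rw [thSeries_lattice] at h
  refine (mul_eq_zero.1 h).resolve_right fun h0 => ?_
  have h1 : ‖ex (m * (τ : ℂ))‖ = 1 := by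
    rw [show ex (m * (τ : ℂ)) = 1 by linear_combination -h0, norm_one]
  rw [norm_ex, Real.exp_eq_one_iff] at h1
  have : (m : ℝ) ≠ 0 := by exact_mod_cast hm
  simp [Real.pi_ne_zero, this, τ.im_pos.ne'] at h1

lemma thQuot_zero : thQuot τ 0 = ∑' n : ℤ, thPartial τ n := by simp [thQuot]

variable {τ}

/-- Translating by mτ moves the zero of 1 − y qᵐ to that of 1 − y, so θ(z)/(1 − y qᵐ) is a multiple
of `thQuot` at z + mτ and has an explicit expansion in y. -/
lemma appell_term_mul_thSeries {z : ℂ} (hz : OffLattice τ z) (m : ℤ) :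
    thCoeff τ (-m) / (1 - ex z * ex (m * τ)) * thSeries τ z =
      ∑' L : ℤ, ex (m * L * τ) * thPartial τ (L - m) * ex (L * z) := by
  have hq := thQuot_mul τ (z + m * τ)
  have hs := thSeries_add_int_mul τ z m
  have hne := hz.sub_ne_zero m
  have e : thCoeff τ (-m) / (1 - ex z * ex (m * τ)) * thSeries τ z =
      ex (m ^ 2 * τ) * ex (m * z) * thQuot τ (z + m * τ) := by
    rw [← hs, ← hq, ← thCoeff_neg_mul, ex_add z]
    field_simp
  have h := (Equiv.subRight m).tsum_eq fun n : ℤ =>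
    ex (m ^ 2 * τ) * ex (m * z) * (thPartial τ n * ex (n * (z + m * τ)))
  simp only [Equiv.subRight_apply] at h
  rw [e, thQuot, ← tsum_mul_left, ← h]
  refine tsum_congr fun L => ?_
  have e2 : ex (m ^ 2 * τ) * ex (m * z) * ex ((L - m : ℤ) * (z + m * τ)) =
      ex (m * L * τ) * ex (L * z) := by
    rw [← ex_add, ← ex_add, ← ex_add]; congr 1; push_cast; ring
  linear_combination thPartial τ (L - m) * e2

-- The cross term q^{mL} cancels that of `thCoeff` (L − m), so the double series below is dominated
-- by a product of two convergent ones.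
variable (τ) in
lemma norm_ex_mul_thCoeff_sub (m L : ℤ) :
    ‖ex (m * L * τ)‖ * ‖thCoeff τ (L - m)‖ = ‖thCoeff τ (0 - m)‖ * ‖thCoeff τ L‖ := by
  rw [← norm_mul, ← norm_mul]
  congr 1
  rw [sub_eq_add_neg, thCoeff_add, zero_sub]
  have : ex (m * L * τ) * ex (L * (-m : ℤ) * τ) = 1 := by
    rw [← ex_add, ← ex_zero]; congr 1; push_cast; ring
  linear_combination thCoeff τ L * thCoeff τ (-m) * this

variable (τ) in
lemma summable_appell_double (z : ℂ) : Summable fun p : ℤ × ℤ =>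
    ex (p.1 * p.2 * τ) * thPartial τ (p.2 - p.1) * ex (p.2 * z) := by
  have hb := ((summable_thCoeff_sub (τ := τ) 0).norm.mul_of_nonneg
    (summable_thCoeff_mul τ z).norm (fun _ => norm_nonneg _) (fun _ => norm_nonneg _)).mul_left
    (1 - ‖ex (τ : ℂ)‖)⁻¹
  refine Summable.of_norm_bounded hb fun p => ?_
  have h := mul_le_mul_of_nonneg_left (norm_thPartial_le τ (p.2 - p.1))
    (norm_nonneg (ex (p.1 * p.2 * τ)))
  rw [norm_mul, norm_mul, norm_mul]
  calc _ ≤ (1 - ‖ex (τ : ℂ)‖)⁻¹ * (‖ex (p.1 * p.2 * τ)‖ * ‖thCoeff τ (p.2 - p.1)‖) *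
        ‖ex (p.2 * z)‖ := mul_le_mul_of_nonneg_right (by linarith) (norm_nonneg _)
    _ = _ := by rw [norm_ex_mul_thCoeff_sub]; ring

-- The coefficient of y^L is a multiple of `thQuot` at −Lτ, hence only L = 0 survives.
variable (τ) in
lemma tsum_appell_double (z : ℂ) (L : ℤ) :
    ∑' m : ℤ, ex (m * L * τ) * thPartial τ (L - m) * ex (L * z) =
      if L = 0 then thQuot τ 0 else 0 := by
  have e : ∑' m : ℤ, ex (m * L * τ) * thPartial τ (L - m) * ex (L * z) =
      thQuot τ ((-L : ℤ) * τ) * (ex (L ^ 2 * τ) * ex (L * z)) := by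
    have h := (Equiv.subLeft L).tsum_eq fun n : ℤ =>
      thPartial τ n * ex (n * ((-L : ℤ) * τ)) * (ex (L ^ 2 * τ) * ex (L * z))
    simp only [Equiv.subLeft_apply] at h
    rw [thQuot, ← tsum_mul_right, ← h]
    refine tsum_congr fun n => ?_
    have e2 : ex ((L - n : ℤ) * ((-L : ℤ) * τ)) * ex (L ^ 2 * τ) = ex (n * L * τ) := by
      rw [← ex_add]; congr 1; push_cast; ring
    rw [← e2]; ring
  rw [e]
  split_ifs with h
  · simp [h]
  · rw [thQuot_lattice τ (by simpa using h), zero_mul]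

/-- The product of `θ` with the Appell sum `∑ (-1)ᵐ q^{m(m-1)/2} / (1 - y qᵐ)` is constant. -/
lemma appell_mul_thSeries {z : ℂ} (hz : OffLattice τ z) :
    appell τ z * thSeries τ z = thQuot τ 0 := by
  rw [appell, ← tsum_mul_right, tsum_congr (appell_term_mul_thSeries hz)]
  have h := (summable_appell_double τ z).tsum_comm
    (f := fun m L : ℤ => ex (m * L * τ) * thPartial τ (L - m) * ex (L * z))
  rw [← h, tsum_congr (tsum_appell_double τ z), tsum_ite_eq]

end PartialSums

end HelicitySupertrace

namespace HelicitySupertrace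

variable (τ : ℍ)

/-! ### Jacobi's identity for η³. -/

section EtaCube

/-- `∏_{i=1}^n (1 - qⁱ)`. -/
noncomputable def qPoch (n : ℕ) : ℂ := ∏ i ∈ Finset.range n, (1 - ex τ ^ (i + 1))

/-- The reciprocal of `∏_{i=1}^n (1 - qⁱ)`, extended by zero to negative `n`. -/
noncomputable def qPochInv (n : ℤ) : ℂ := if n < 0 then 0 else (qPoch τ n.toNat)⁻¹

lemma one_sub_pow_ne_zero (i : ℕ) : 1 - ex τ ^ (i + 1) ≠ 0 := by
  intro h
  have h1 : ‖ex (τ : ℂ) ^ (i + 1)‖ < 1 := by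
    rw [norm_pow]
    exact pow_lt_one₀ (norm_nonneg _) (norm_ex_tau_lt_one τ) i.succ_ne_zero
  rw [← sub_eq_zero.1 h, norm_one] at h1
  exact lt_irrefl _ h1

lemma qPoch_ne_zero (n : ℕ) : qPoch τ n ≠ 0 :=
  Finset.prod_ne_zero_iff.2 fun i _ => one_sub_pow_ne_zero τ i

lemma qPoch_succ (n : ℕ) : qPoch τ (n + 1) = qPoch τ n * (1 - ex τ ^ (n + 1)) :=
  Finset.prod_range_succ _ _

/-- Thanks to the extension by zero this holds for all n; at n = 0 the factor 1 − q⁰ vanishes. -/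
lemma qPochInv_sub_one (n : ℤ) : qPochInv τ (n - 1) = (1 - ex τ ^ n) * qPochInv τ n := by
  rcases lt_trichotomy n 0 with h | rfl | h
  · simp [qPochInv, h, show n - 1 < 0 by omega]
  · simp [qPochInv]
  · obtain ⟨m, rfl⟩ : ∃ m : ℕ, n = m + 1 := ⟨(n - 1).toNat, by omega⟩
    have h1 : ¬ ((m : ℤ) + 1 < 0) := by omega
    have h2 : ¬ ((m : ℤ) < 0) := by omega
    have h3 : ((m : ℤ) + 1).toNat = m + 1 := by omega
    have h4 := qPoch_ne_zero τ m
    have h5 := one_sub_pow_ne_zero τ m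
    rw [add_sub_cancel_right, qPochInv, qPochInv, if_neg h1, if_neg h2, h3, Int.toNat_natCast,
      qPoch_succ, show ex (τ : ℂ) ^ ((m : ℤ) + 1) = ex τ ^ (m + 1) by norm_cast]
    field_simp

/-- The coefficients of the finite form of Jacobi's triple product. -/
noncomputable def jacobiCoeff (N : ℕ) (n : ℤ) : ℂ :=
  qPoch τ (2 * N) * qPochInv τ (N + n) * qPochInv τ (N - n)

lemma jacobiCoeff_eq_zero {N : ℕ} {n : ℤ} (h : n ∉ Finset.Icc (-N : ℤ) N) :
    jacobiCoeff τ N n = 0 := by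
  rw [Finset.mem_Icc, not_and_or, not_le, not_le] at h
  rcases h with h | h
  · simp [jacobiCoeff, qPochInv, show (N : ℤ) + n < 0 by omega]
  · simp [jacobiCoeff, qPochInv, show (N : ℤ) - n < 0 by omega]

/-- A twofold q-Pascal rule: every reciprocal is expressed through those at N + 1 ± n, and the rest
is polynomial in powers of q. -/
lemma jacobiCoeff_succ (N : ℕ) (n : ℤ) :
    jacobiCoeff τ (N + 1) n = (1 + ex τ ^ (2 * N + 1)) * jacobiCoeff τ N n +
      ex τ ^ (N + n + 1) * jacobiCoeff τ N (n + 1) +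
      ex τ ^ (N + 1 - n) * jacobiCoeff τ N (n - 1) := by
  have hq : ex (τ : ℂ) ≠ 0 := ex_ne_zero _
  have a₁ := qPochInv_sub_one τ (N + 1 + n)
  have a₂ := qPochInv_sub_one τ (N + n)
  have b₁ := qPochInv_sub_one τ (N + 1 - n)
  have b₂ := qPochInv_sub_one τ (N - n)
  rw [show (N : ℤ) + 1 + n - 1 = N + n by ring] at a₁
  rw [show (N : ℤ) + 1 - n - 1 = N - n by ring] at b₁
  rw [a₁] at a₂
  rw [b₁] at b₂
  simp only [jacobiCoeff]
  rw [show (N : ℤ) + (n + 1) = N + 1 + n by ring, show (N : ℤ) - (n + 1) = N - n - 1 by ring,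
    show (N : ℤ) + (n - 1) = N + n - 1 by ring, show (N : ℤ) - (n - 1) = N + 1 - n by ring,
    a₂, b₂, a₁, b₁, show 2 * (N + 1) = 2 * N + 1 + 1 by ring, qPoch_succ, qPoch_succ]
  push_cast
  have e₁ : ex (τ : ℂ) ^ (N + n + 1 : ℤ) = ex τ ^ (N + n : ℤ) * ex τ := zpow_add_one₀ hq _
  have e₂ : ex (τ : ℂ) ^ (N + 1 + n : ℤ) = ex τ ^ (N + n : ℤ) * ex τ := by
    rw [← zpow_add_one₀ hq]; congr 1; ring
  have e₃ : ex (τ : ℂ) ^ (N + 1 - n : ℤ) = ex τ ^ (N - n : ℤ) * ex τ := by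
    rw [← zpow_add_one₀ hq]; congr 1; ring
  have e₄ : ex (τ : ℂ) ^ (2 * N) = ex τ ^ (N + n : ℤ) * ex τ ^ (N - n : ℤ) := by
    rw [← zpow_add₀ hq, ← zpow_natCast]; congr 1; push_cast; ring
  rw [e₁, e₂, e₃, pow_succ _ (2 * N + 1), pow_succ _ (2 * N), e₄]
  ring

lemma summable_jacobi (N : ℕ) (f : ℤ → ℂ) : Summable fun n => jacobiCoeff τ N n * f n :=
  summable_of_ne_finset_zero (s := Finset.Icc (-N : ℤ) N) fun n hn => by
    rw [jacobiCoeff_eq_zero τ hn, zero_mul]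

lemma tsum_jacobi (N : ℕ) (f : ℤ → ℂ) :
    ∑' n, jacobiCoeff τ N n * f n = ∑ n ∈ Finset.Icc (-N : ℤ) N, jacobiCoeff τ N n * f n :=
  tsum_eq_sum fun n hn => by rw [jacobiCoeff_eq_zero τ hn, zero_mul]

/-- The finite form of Jacobi's triple product. -/
lemma finite_jacobi (N : ℕ) (u : ℂ) :
    ∏ i ∈ Finset.range N, ((1 - ex (-u) * ex τ ^ i) * (1 - ex u * ex τ ^ (i + 1))) =
      ∑' n : ℤ, jacobiCoeff τ N n * (thCoeff τ n * ex (n * u)) := by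
  induction N with
  | zero =>
    rw [tsum_jacobi]
    simp [jacobiCoeff, qPochInv, qPoch]
  | succ N ih =>
    set F : ℤ → ℂ := fun n => thCoeff τ n * ex (n * u) with hF
    have hq : ex (τ : ℂ) ≠ 0 := ex_ne_zero _
    have hy : ex u * ex (-u) = 1 := by rw [ex_neg, mul_inv_cancel₀ (ex_ne_zero u)]
    -- The powers e(∓u) in the two new factors of the product become shifts of the index n, which
    -- match the shifted terms of `jacobiCoeff_succ`.
    have hF1 : ∀ n : ℤ, F (n + 1) * (ex (-u) * ex τ ^ N) = -ex τ ^ (N + n + 1 : ℤ) * F n := by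
      intro n
      simp only [hF]
      have e : ex (((n : ℂ) + 1) * τ) = ex τ ^ (n + 1) := by rw [← ex_int_mul]; push_cast; rfl
      rw [thCoeff_add_one, e, show ((n + 1 : ℤ) : ℂ) * u = n * u + u by push_cast; ring, ex_add,
        show (N + n + 1 : ℤ) = (n + 1) + N by ring, zpow_add₀ hq (n + 1) N, zpow_natCast]
      linear_combination (-ex (τ : ℂ) ^ (n + 1) * thCoeff τ n * ex (n * u) * ex τ ^ N) * hy
    have hF2 : ∀ n : ℤ, F (n - 1) * (ex u * ex τ ^ (N + 1)) = -ex τ ^ (N + 1 - n : ℤ) * F n := by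
      intro n
      simp only [hF]
      have h := thCoeff_add_one τ (n - 1)
      have e : ex ((((n - 1 : ℤ) : ℂ) + 1) * τ) = ex τ ^ n := by
        rw [← ex_int_mul]; push_cast; congr 1; ring
      rw [sub_add_cancel, e] at h
      rw [h, show (n : ℂ) * u = (n - 1 : ℤ) * u + u by push_cast; ring, ex_add,
        show (N + 1 - n : ℤ) = (N + 1 : ℕ) + -n by push_cast; ring, zpow_add₀ hq, zpow_natCast,
        zpow_neg]
      have : ex (τ : ℂ) ^ n ≠ 0 := zpow_ne_zero _ hq
      field_simp
    have hsp := (Equiv.addRight (1 : ℤ)).tsum_eq fun n => jacobiCoeff τ N n * F n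
    have hsm := (Equiv.subRight (1 : ℤ)).tsum_eq fun n => jacobiCoeff τ N n * F n
    simp only [Equiv.coe_addRight, Equiv.subRight_apply] at hsp hsm
    have s₀ := (summable_jacobi τ N F).mul_left (1 + ex τ ^ (2 * N + 1))
    have s₁ := ((Equiv.addRight (1 : ℤ)).summable_iff.2 (summable_jacobi τ N F)).mul_right
      (ex (-u) * ex τ ^ N)
    have s₂ := ((Equiv.subRight (1 : ℤ)).summable_iff.2 (summable_jacobi τ N F)).mul_right
      (ex u * ex τ ^ (N + 1))
    simp only [Function.comp_apply, Equiv.coe_addRight, Equiv.subRight_apply] at s₁ s₂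
    have key : ∀ n, jacobiCoeff τ (N + 1) n * F n =
        (1 + ex τ ^ (2 * N + 1)) * (jacobiCoeff τ N n * F n) -
        jacobiCoeff τ N (n + 1) * F (n + 1) * (ex (-u) * ex τ ^ N) -
        jacobiCoeff τ N (n - 1) * F (n - 1) * (ex u * ex τ ^ (N + 1)) := by
      intro n
      rw [jacobiCoeff_succ]
      linear_combination jacobiCoeff τ N (n + 1) * hF1 n + jacobiCoeff τ N (n - 1) * hF2 n
    rw [tsum_congr key, (s₀.sub s₁).tsum_sub s₂, s₀.tsum_sub s₁, tsum_mul_left, tsum_mul_right,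
      tsum_mul_right, hsp, hsm, Finset.prod_range_succ, ih]
    linear_combination (∑' n, jacobiCoeff τ N n * F n) * ex τ ^ (2 * N + 1) * hy

/-- Both sides of `finite_jacobi` are differentiated at u = 0, where the factor 1 − e(−u) vanishes,
so only its derivative contributes. -/
lemma finite_jacobi_deriv (N : ℕ) :
    ∑' n : ℤ, jacobiCoeff τ (N + 1) n * (n * thCoeff τ n) = qPoch τ N * qPoch τ (N + 1) := by
  have h₁ : HasDerivAt (fun u => ∑' n : ℤ, jacobiCoeff τ (N + 1) n * (thCoeff τ n * ex (n * u)))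
      (2 * Real.pi * Complex.I *
        ∑' n : ℤ, jacobiCoeff τ (N + 1) n * (n * thCoeff τ n)) 0 := by
    simp only [tsum_jacobi]
    rw [Finset.mul_sum]
    refine HasDerivAt.fun_sum fun n _ => ?_
    have hd : HasDerivAt (fun u : ℂ => ex (n * u)) (2 * Real.pi * Complex.I * n) 0 := by
      have := (((hasDerivAt_id (0 : ℂ)).const_mul (n : ℂ)).const_mul
        (2 * Real.pi * Complex.I)).cexp
      simpa [ex] using this
    exact ((hd.const_mul (thCoeff τ n)).const_mul (jacobiCoeff τ (N + 1) n)).congr_deriv (by ring)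
  have h₂ : HasDerivAt (fun u => ∏ i ∈ Finset.range (N + 1),
      ((1 - ex (-u) * ex τ ^ i) * (1 - ex u * ex τ ^ (i + 1))))
      (2 * Real.pi * Complex.I * (qPoch τ N * qPoch τ (N + 1))) 0 := by
    have e : ∀ u : ℂ, ∏ i ∈ Finset.range (N + 1),
        ((1 - ex (-u) * ex τ ^ i) * (1 - ex u * ex τ ^ (i + 1))) = (1 - ex (-u)) *
        ((∏ i ∈ Finset.range N, (1 - ex (-u) * ex τ ^ (i + 1))) *
          ∏ i ∈ Finset.range (N + 1), (1 - ex u * ex τ ^ (i + 1))) := by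
      intro u
      rw [Finset.prod_mul_distrib, Finset.prod_range_succ']
      simp only [pow_zero, mul_one]
      ring
    simp only [e]
    have hd : HasDerivAt (fun u : ℂ => 1 - ex (-u)) (2 * Real.pi * Complex.I) 0 := by
      have := (((hasDerivAt_neg (0 : ℂ))).const_mul (2 * Real.pi * Complex.I)).cexp.const_sub 1
      simpa [ex] using this
    have hg : DifferentiableAt ℂ (fun u : ℂ =>
        (∏ i ∈ Finset.range N, (1 - ex (-u) * ex τ ^ (i + 1))) *
          ∏ i ∈ Finset.range (N + 1), (1 - ex u * ex τ ^ (i + 1))) 0 := by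
      unfold ex; fun_prop
    refine (hd.mul hg.hasDerivAt).congr_deriv ?_
    simp [qPoch]
  have h := h₁.congr_of_eventuallyEq (Filter.Eventually.of_forall fun u => finite_jacobi τ (N + 1) u)
  have := h.unique h₂
  have hpi : 2 * (Real.pi : ℂ) * Complex.I ≠ 0 := Complex.two_pi_I_ne_zero
  exact mul_left_cancel₀ hpi this

lemma tendsto_qPoch :
    Filter.Tendsto (qPoch τ) Filter.atTop (nhds (∏' n : ℕ, (1 - ex τ ^ (n + 1)))) :=
  (ModularForm.multipliable_one_sub_pow (norm_ex_tau_lt_one τ)).hasProd.tendsto_prod_nat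

lemma ex_eq_qParam (z : ℂ) : ex z = Function.Periodic.qParam 1 z := by
  simp [ex, Function.Periodic.qParam]

lemma tprod_qPoch_ne_zero : ∏' n : ℕ, (1 - ex τ ^ (n + 1)) ≠ 0 := by
  simpa [ModularForm.eta_q, ex_eq_qParam] using ModularForm.eta_tprod_ne_zero τ.im_pos

/-- Evaluating at u = ∓i/2π makes |e(nu)| equal to e^{±n}, and |n| ≤ eⁿ + e^{−n}. -/
lemma summable_int_mul {f : ℤ → ℂ} (hf : ∀ u : ℂ, Summable fun n : ℤ => f n * ex (n * u)) :
    Summable fun n : ℤ => (n : ℂ) * f n := by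
  have h₁ := (hf (-Complex.I / (2 * Real.pi))).norm
  have h₂ := (hf (Complex.I / (2 * Real.pi))).norm
  have e : ∀ (n : ℤ) (s : ℝ), ‖ex (n * ((s : ℂ) * Complex.I / (2 * Real.pi)))‖ =
      Real.exp (-(n * s)) := by
    intro n s
    rw [norm_ex]
    congr 1
    have : (n * ((s : ℂ) * Complex.I / (2 * Real.pi))) =
        ((n * s / (2 * Real.pi) : ℝ) : ℂ) * Complex.I := by push_cast; ring
    rw [this, Complex.im_ofReal_mul, Complex.I_im]
    have := Real.pi_pos.ne'
    field_simp
  refine Summable.of_norm_bounded (h₁.add h₂) fun n => ?_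
  have e₁ := e n (-1)
  have e₂ := e n 1
  push_cast at e₁ e₂
  rw [neg_mul, one_mul] at e₁
  rw [one_mul] at e₂
  rw [norm_mul, norm_mul, norm_mul, e₁, e₂, ← mul_add, mul_comm]
  refine mul_le_mul_of_nonneg_left ?_ (norm_nonneg _)
  rw [Complex.norm_intCast]
  have p₁ := Real.add_one_le_exp (-(n * -1 : ℝ))
  have p₂ := Real.add_one_le_exp (-(n * 1 : ℝ))
  have p₃ := Real.exp_pos (-(n * -1 : ℝ))
  have p₄ := Real.exp_pos (-(n * 1 : ℝ))
  rw [abs_le]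
  constructor <;> linarith

lemma summable_int_mul_thCoeff : Summable fun n : ℤ => (n : ℂ) * thCoeff τ n :=
  summable_int_mul (summable_thCoeff_mul τ)

/-- Jacobi's identity for the cube of the Euler product. -/
lemma tsum_int_mul_thCoeff :
    ∑' n : ℤ, (n : ℂ) * thCoeff τ n = (∏' n : ℕ, (1 - ex τ ^ (n + 1))) ^ 3 := by
  set P := ∏' n : ℕ, (1 - ex (τ : ℂ) ^ (n + 1)) with hP
  have hP0 : P ≠ 0 := tprod_qPoch_ne_zero τ
  have ht := tendsto_qPoch τ
  obtain ⟨A, hA⟩ := (Metric.isBounded_range_of_tendsto _ ht).exists_norm_le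
  obtain ⟨B, hB⟩ := (Metric.isBounded_range_of_tendsto _ (ht.inv₀ hP0)).exists_norm_le
  have hB0 : 0 ≤ B := (norm_nonneg _).trans (hB _ ⟨0, rfl⟩)
  have hA0 : 0 ≤ A := (norm_nonneg _).trans (hA _ ⟨0, rfl⟩)
  have hinv : ∀ n, ‖qPochInv τ n‖ ≤ B := by
    intro n
    rw [qPochInv]
    split_ifs
    · simpa using hB0
    · exact hB _ ⟨_, rfl⟩
  have hlim : ∀ s : ℤ, ∀ f : ℕ → ℤ, (∀ N : ℕ, f N = N + s) →
      Filter.Tendsto (fun N => qPochInv τ (f N)) Filter.atTop (nhds P⁻¹) := by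
    intro s f hf
    have h1 : Filter.Tendsto (fun N : ℕ => (f N).toNat) Filter.atTop Filter.atTop := by
      refine Filter.tendsto_atTop.2 fun b => ?_
      filter_upwards [Filter.eventually_ge_atTop (b + s.natAbs)] with N hN
      have := hf N
      omega
    refine ((ht.inv₀ hP0).comp h1).congr' ?_
    filter_upwards [Filter.eventually_ge_atTop s.natAbs] with N hN
    have := hf N
    rw [qPochInv, if_neg (by omega)]; rfl
  -- Each coefficient tends to P · P⁻¹ · P⁻¹ = P⁻¹ with a uniform bound, while the finite
  -- evaluations tend to P².
  have hL : Filter.Tendsto (fun N : ℕ => ∑' n : ℤ, jacobiCoeff τ (N + 1) n * (n * thCoeff τ n))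
      Filter.atTop (nhds (∑' n : ℤ, P⁻¹ * (n * thCoeff τ n))) := by
    refine tendsto_tsum_of_dominated_convergence (bound := fun n : ℤ =>
      A * B * B * ‖(n : ℂ) * thCoeff τ n‖)
      ((summable_int_mul_thCoeff τ).norm.mul_left _) (fun n => ?_) (Filter.Eventually.of_forall
        fun N n => ?_)
    · refine Filter.Tendsto.mul_const _ ?_
      have h2 : Filter.Tendsto (fun N : ℕ => 2 * (N + 1)) Filter.atTop Filter.atTop :=
        Filter.tendsto_atTop.2 fun b => by
          filter_upwards [Filter.eventually_ge_atTop b] with N hN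
          omega
      have := ((ht.comp h2).mul (hlim (1 + n) (fun N => (N + 1 : ℕ) + n) fun N => by
        push_cast; ring)).mul (hlim (1 - n) (fun N => (N + 1 : ℕ) - n) fun N => by push_cast; ring)
      rw [mul_inv_cancel₀ hP0, one_mul] at this
      exact this
    · rw [norm_mul, jacobiCoeff, norm_mul, norm_mul]
      refine mul_le_mul_of_nonneg_right ?_ (norm_nonneg _)
      exact mul_le_mul (mul_le_mul (hA _ ⟨_, rfl⟩) (hinv _) (norm_nonneg _) hA0) (hinv _)
        (norm_nonneg _) (by positivity)
  simp only [finite_jacobi_deriv] at hL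
  have hR := ht.mul (ht.comp (Filter.tendsto_add_atTop_nat 1))
  have := tendsto_nhds_unique hL hR
  rw [tsum_mul_left] at this
  rw [← hP] at this
  field_simp at this
  rw [this]

/-- Summation by parts: the coefficients of θ are the differences of its partial sums. -/
lemma thQuot_zero_eq : thQuot τ 0 = -(∏' n : ℕ, (1 - ex τ ^ (n + 1))) ^ 3 := by
  rw [← tsum_int_mul_thCoeff, thQuot_zero]
  have hs : Summable fun n : ℤ => (n : ℂ) * thPartial τ n := by
    refine Summable.of_norm_bounded ((summable_int_mul_thCoeff τ).norm.mul_left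
      (1 - ‖ex (τ : ℂ)‖)⁻¹) fun n => ?_
    rw [norm_mul, norm_mul]
    have := mul_le_mul_of_nonneg_left (norm_thPartial_le τ n) (norm_nonneg (n : ℂ))
    linarith
  have hs₀ : Summable fun n : ℤ => thPartial τ n := by simpa using summable_thQuot τ 0
  have hs₁ : Summable fun n : ℤ => (n : ℂ) * thPartial τ (n - 1) := by
    refine ((Equiv.subRight (1 : ℤ)).summable_iff.2 (hs.add hs₀)).congr fun n => ?_
    simp only [Function.comp_apply, Equiv.subRight_apply]
    push_cast; ring
  have e : ∑' n : ℤ, (n : ℂ) * thPartial τ (n - 1) =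
      ∑' n : ℤ, ((n : ℂ) * thPartial τ n + thPartial τ n) := by
    rw [← (Equiv.subRight (1 : ℤ)).tsum_eq fun n : ℤ => (n : ℂ) * thPartial τ n + thPartial τ n]
    refine tsum_congr fun n => ?_
    simp only [Equiv.subRight_apply]
    push_cast; ring
  have h2 : ∑' n : ℤ, (n : ℂ) * thCoeff τ n =
      ∑' n : ℤ, (n : ℂ) * thPartial τ n - ∑' n : ℤ, (n : ℂ) * thPartial τ (n - 1) := by
    rw [← hs.tsum_sub hs₁]
    refine tsum_congr fun n => ?_
    rw [← thPartial_sub]; ring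
  rw [h2, e, hs.tsum_add hs₀]
  ring

lemma thQuot_zero_ne_zero : thQuot τ 0 ≠ 0 := by
  rw [thQuot_zero_eq]
  exact neg_ne_zero.2 (pow_ne_zero _ (tprod_qPoch_ne_zero τ))

lemma eta_cube : ModularForm.eta (τ : ℂ) ^ 3 = -ex (τ / 8) * thQuot τ 0 := by
  have h1 : ModularForm.eta (τ : ℂ) = ex (τ / 24) * ∏' n : ℕ, (1 - ex τ ^ (n + 1)) := by
    simp only [ModularForm.eta, ModularForm.eta_q, ex_eq_qParam]
    congr 1
    simp [Function.Periodic.qParam]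
    ring_nf
  have h2 : ex ((τ : ℂ) / 8) = ex (τ / 24) ^ 3 := by
    rw [← ex_nat_mul]; congr 1; push_cast; ring
  rw [h1, h2, thQuot_zero_eq]; ring

variable {τ}

/-- The product with `appell` is a nonzero constant, so θ has no zeros off the lattice. -/
lemma OffLattice.thSeries_ne_zero {z : ℂ} (hz : OffLattice τ z) : thSeries τ z ≠ 0 := by
  intro h
  have := appell_mul_thSeries hz
  rw [h, mul_zero] at this
  exact thQuot_zero_ne_zero τ this.symm

end EtaCube

end HelicitySupertrace

namespace HelicitySupertrace

/-! ### Level k theta functions as series over ℤ with periodic coefficients. -/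

section LevelTheta

/-- The indicator of the residue class `r` modulo `2k`. -/
def residueInd (k : ℕ) (r N : ℤ) : ℂ := if (2 * k : ℤ) ∣ N - r then 1 else 0

/-- The signs `δ_{N ≡ j} - δ_{N ≡ -j}` modulo `2k`. -/
def hatSign (k : ℕ) (j N : ℤ) : ℂ := residueInd k j N - residueInd k (-j) N

lemma norm_residueInd_le (k : ℕ) (r N : ℤ) : ‖residueInd k r N‖ ≤ 1 := by
  unfold residueInd; split_ifs <;> simp

lemma residueInd_add_mul (k : ℕ) (r N i : ℤ) : residueInd k r (N + 2 * k * i) = residueInd k r N := by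
  unfold residueInd
  congr 1
  rw [show N + 2 * k * i - r = N - r + 2 * k * i by ring, eq_iff_iff]
  exact dvd_add_left ⟨i, rfl⟩

lemma residueInd_congr {k : ℕ} {r r' : ℤ} (h : (2 * k : ℤ) ∣ r - r') (N : ℤ) :
    residueInd k r N = residueInd k r' N := by
  unfold residueInd
  congr 1
  rw [show N - r' = N - r + (r - r') by ring, eq_iff_iff]
  exact (dvd_add_left h).symm

lemma residueInd_neg (k : ℕ) (r N : ℤ) : residueInd k (-r) (-N) = residueInd k r N := by
  unfold residueInd
  congr 1
  rw [show -N - -r = -(N - r) by ring, dvd_neg]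

lemma hatSign_neg (k : ℕ) (j N : ℤ) : hatSign k j (-N) = -hatSign k j N := by
  have h1 := residueInd_neg k j N
  have h2 := residueInd_neg k (-j) N
  rw [neg_neg] at h2
  rw [hatSign, hatSign, h1, h2]; ring

lemma hatSign_add_mul (k : ℕ) (j N i : ℤ) : hatSign k j (N + 2 * k * i) = hatSign k j N := by
  simp only [hatSign, residueInd_add_mul]

lemma norm_hatSign_le (k : ℕ) (j N : ℤ) : ‖hatSign k j N‖ ≤ 2 :=
  (norm_sub_le _ _).trans (by
    linarith [norm_residueInd_le k j N, norm_residueInd_le k (-j) N])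

variable (τ : ℍ)

/-- The power `q^{N²/4k}`. -/
noncomputable def gaussian (k : ℕ) (N : ℤ) : ℂ := ex ((N : ℂ) ^ 2 / (4 * k) * τ)

lemma gaussian_ne_zero (k : ℕ) (N : ℤ) : gaussian τ k N ≠ 0 := ex_ne_zero _

lemma gaussian_add_mul {k : ℕ} (hk : 0 < k) (N i : ℤ) :
    gaussian τ k (N + 2 * k * i) = gaussian τ k N * ex (((N * i + k * i ^ 2 : ℤ) : ℂ) * τ) := by
  have : (k : ℂ) ≠ 0 := by exact_mod_cast hk.ne'
  rw [gaussian, gaussian, ← ex_add]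
  congr 1
  push_cast
  field_simp
  ring

lemma gaussian_neg (k : ℕ) (N : ℤ) : gaussian τ k (-N) = gaussian τ k N := by
  simp [gaussian]

lemma summable_gaussian {k : ℕ} (hk : 0 < k) (x : ℂ) :
    Summable fun N : ℤ => gaussian τ k N * ex (N * x) := by
  have ha : 0 < ((τ : ℂ) / (4 * k)).im := by
    have : (0 : ℝ) < 4 * k := by positivity
    rw [show (4 * k : ℂ) = ((4 * k : ℝ) : ℂ) by push_cast; rfl, Complex.div_ofReal_im]
    exact div_pos τ.im_pos this
  refine (summable_ex_quadratic ha x 0).congr fun N => ?_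
  rw [gaussian, ← ex_add]
  congr 1; ring

lemma summable_bounded_gaussian {k : ℕ} (hk : 0 < k) {c : ℤ → ℂ} {B : ℝ} (hc : ∀ N, ‖c N‖ ≤ B)
    (x : ℂ) : Summable fun N : ℤ => c N * gaussian τ k N * ex (N * x) := by
  refine Summable.of_norm_bounded ((summable_gaussian τ hk x).norm.mul_left B) fun N => ?_
  rw [mul_assoc, norm_mul]
  exact mul_le_mul_of_nonneg_right (hc N) (norm_nonneg _)

lemma thetaLevel_term (k : ℕ) (r n : ℤ) (x : ℂ) :
    ex ((2 * k * n + r : ℂ) ^ 2 / (4 * k) * τ) * ex ((2 * k * n + r : ℂ) * x) =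
      gaussian τ k (2 * k * n + r) * ex ((2 * k * n + r : ℤ) * x) := by
  rw [gaussian]; push_cast; rfl

lemma tsum_residueInd {k : ℕ} (hk : 0 < k) (r : ℤ) (F : ℤ → ℂ) :
    ∑' n : ℤ, F (2 * k * n + r) = ∑' N : ℤ, residueInd k r N * F N := by
  have hk' : (2 * k : ℤ) ≠ 0 := by positivity
  have hinj : Function.Injective fun n : ℤ => 2 * k * n + r := fun a b h => by
    simpa [hk.ne'] using h
  rw [← hinj.tsum_eq (f := fun N => residueInd k r N * F N)]
  · refine tsum_congr fun n => ?_
    simp [residueInd]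
  · intro N hN
    have h1 : residueInd k r N ≠ 0 := left_ne_zero_of_mul hN
    have h2 : (2 * k : ℤ) ∣ N - r := by
      by_contra h
      exact h1 (if_neg h)
    obtain ⟨n, hn⟩ := h2
    exact ⟨n, by simp only; linarith⟩

lemma thetaLevel_eq {k : ℕ} (hk : 0 < k) (r : ℤ) (x : ℂ) :
    thetaLevel k r τ x = ∑' N : ℤ, residueInd k r N * gaussian τ k N * ex (N * x) := by
  simp only [thetaLevel, thetaLevel_term, mul_assoc (residueInd _ _ _)]
  exact tsum_residueInd hk r fun N => gaussian τ k N * ex (N * x)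

/-- The coefficients of `ϑ̂_{k,j}`. -/
noncomputable def hatCoeff (k : ℕ) (j N : ℤ) : ℂ := hatSign k j N * gaussian τ k N

lemma summable_hatCoeff {k : ℕ} (hk : 0 < k) (j : ℤ) (x : ℂ) :
    Summable fun N : ℤ => hatCoeff τ k j N * ex (N * x) :=
  summable_bounded_gaussian τ hk (norm_hatSign_le k j) x

lemma thetaHat_eq {k : ℕ} (hk : 0 < k) (j : ℤ) (x : ℂ) :
    thetaHat k j τ x = ∑' N : ℤ, hatCoeff τ k j N * ex (N * x) := by
  rw [thetaHat, thetaLevel_eq τ hk, thetaLevel_eq τ hk, ← Summable.tsum_sub]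
  · refine tsum_congr fun N => ?_
    rw [hatCoeff, hatSign]; ring
  · exact summable_bounded_gaussian τ hk (norm_residueInd_le k j) x
  · exact summable_bounded_gaussian τ hk (norm_residueInd_le k (-j)) x

lemma hatCoeff_add_mul {k : ℕ} (hk : 0 < k) (j N i : ℤ) :
    hatCoeff τ k j (N + 2 * k * i) =
      hatCoeff τ k j N * ex (((N * i + k * i ^ 2 : ℤ) : ℂ) * τ) := by
  rw [hatCoeff, hatCoeff, hatSign_add_mul, gaussian_add_mul τ hk]; ring

lemma hatCoeff_neg (k : ℕ) (j N : ℤ) : hatCoeff τ k j (-N) = -hatCoeff τ k j N := by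
  rw [hatCoeff, hatCoeff, hatSign_neg, gaussian_neg]; ring

/-- Convergence for every v supplies the decay hypothesis of `weight_double_sum`. -/
lemma summable_hatCoeff_sub {k : ℕ} (hk : 0 < k) (j P : ℤ) (v : ℂ) :
    Summable fun s : ℤ => hatCoeff τ k j (P - 2 * s) * ex (s * v) := by
  have h := ((summable_hatCoeff τ hk j (-v / 2)).comp_injective
    (i := fun s : ℤ => P - 2 * s) fun a b h => by simpa using h).mul_right (ex (P * v / 2))
  refine h.congr fun s => ?_
  rw [Function.comp_apply, mul_assoc, ← ex_add]
  congr 2; push_cast; ring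

/-- `ϑ̂_{k,j}` vanishes at the lattice points, also after restriction to one parity. -/
lemma tsum_hatCoeff_lattice {k : ℕ} (hk : 0 < k) (j P i : ℤ) :
    ∑' s : ℤ, hatCoeff τ k j (P - 2 * s) * ex (s * ((-i : ℤ) * τ)) = 0 := by
  set F : ℤ → ℂ := fun s => hatCoeff τ k j (P - 2 * s) * ex (s * ((-i : ℤ) * τ)) with hF
  have h : ∑' s, F s = -∑' s, F s := by
    -- The reflection s ↦ P + ik − s takes the index P − 2s to −(P − 2s) − 2ki, so oddness and
    -- quasi-periodicity together reverse the sign of the sum.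
    conv_lhs => rw [← (Equiv.subLeft (P + i * k)).tsum_eq F]
    rw [← tsum_neg]
    refine tsum_congr fun s => ?_
    simp only [Equiv.subLeft_apply, hF]
    rw [show P - 2 * (P + i * k - s) = -(P - 2 * s) + 2 * k * (-i) by ring, hatCoeff_add_mul τ hk,
      hatCoeff_neg, mul_assoc, ← ex_add, neg_mul]
    congr 3; push_cast; ring
  exact self_eq_neg.1 h

lemma tsum_hatCoeff_parity {k : ℕ} (hk : 0 < k) (j P : ℤ) :
    ∑' s : ℤ, hatCoeff τ k j (P - 2 * s) = 0 := by
  simpa using tsum_hatCoeff_lattice τ hk j P 0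

lemma hatSign_two_one (n : ℤ) : hatSign 2 1 (2 * n + 1) = ex (n / 2) ∧ hatSign 2 1 (2 * n) = 0 := by
  have h4 : ((2 : ℤ) * ((2 : ℕ) : ℤ)) = 4 := by norm_num
  constructor
  · obtain ⟨m, rfl | rfl⟩ := n.even_or_odd'
    · have e : ex (((2 * m : ℤ) : ℂ) / 2) = 1 := by
        rw [← ex_intCast m]; congr 1; push_cast; ring
      rw [e, hatSign, residueInd, residueInd, h4, if_pos (by omega), if_neg (by omega)]
      ring
    · have e : ex (((2 * m + 1 : ℤ) : ℂ) / 2) = -1 := by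
        rw [← ex_half]; refine ex_congr m ?_; push_cast; ring
      rw [e, hatSign, residueInd, residueInd, h4, if_neg (by omega), if_pos (by omega)]
      ring
  · rw [hatSign, residueInd, residueInd, h4, if_neg (by omega), if_neg (by omega)]
    ring

lemma thetaHat_two_one (x : ℂ) : thetaHat 2 1 τ x = ex (τ / 8 + x) * thSeries τ (2 * x) := by
  rw [thetaHat_eq τ two_pos, ← tsum_residues (m := 2) (by norm_num) (summable_hatCoeff τ two_pos 1 x)]
  simp only [Finset.sum_range_succ, Finset.sum_range_zero, zero_add]
  have h0 : ∀ n : ℤ, hatCoeff τ 2 1 ((2 : ℕ) * n + (0 : ℕ)) *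
      ex (((2 : ℕ) * n + (0 : ℕ) : ℤ) * x) = 0 := by
    intro n
    have := (hatSign_two_one n).2
    rw [hatCoeff]; push_cast; rw [add_zero, this]; ring
  rw [tsum_congr h0, tsum_zero, zero_add, thSeries, ← tsum_mul_left]
  refine tsum_congr fun n => ?_
  have := (hatSign_two_one n).1
  rw [hatCoeff]; push_cast; rw [this, gaussian, thCoeff, ← ex_add, ← ex_add, ← ex_add, ← ex_add]
  congr 1; push_cast; ring

lemma thetaChar_one_one (u : ℂ) :
    thetaChar 1 1 τ u = Complex.I * ex (τ / 8 + u / 2) * thSeries τ u := by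
  rw [thetaChar, thSeries, ← tsum_mul_left]
  refine tsum_congr fun n => ?_
  rw [← ex_quarter, thCoeff, ← ex_add, ← ex_add, ← ex_add, ← ex_add]
  congr 1; push_cast; ring

lemma thetaHat_two_one_ne_zero {x : ℂ} (hx : OffLattice τ (2 * x)) : thetaHat 2 1 τ x ≠ 0 := by
  rw [thetaHat_two_one]
  exact mul_ne_zero (ex_ne_zero _) hx.thSeries_ne_zero

lemma norm_le_of_periodic {c : ℤ → ℂ} {m : ℕ} (hm : 0 < m) (hc : ∀ r : ℤ, c (r + m) = c r)
    (N : ℤ) : ‖c N‖ ≤ ∑ r ∈ Finset.range m, ‖c r‖ := by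
  have hp : Function.Periodic c (m : ℤ) := hc
  have h1 : c N = c (N % m) := by
    conv_lhs => rw [← Int.emod_add_mul_ediv N m, mul_comm]
    have := hp.int_mul (N / m) (N % m)
    simpa using this
  have h2 : (0 : ℤ) ≤ N % m := Int.emod_nonneg _ (by omega)
  have h3 : N % m < m := Int.emod_lt_of_pos _ (by omega)
  obtain ⟨r, hr⟩ := Int.eq_ofNat_of_zero_le h2
  rw [h1, hr]
  exact Finset.single_le_sum (f := fun r : ℕ => ‖c r‖) (fun _ _ => norm_nonneg _)
    (Finset.mem_range.2 (by omega))

lemma summable_periodic_gaussian {k : ℕ} (hk : 0 < k) {c : ℤ → ℂ} (hc : ∀ r : ℤ, c (r + 2 * k) = c r)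
    (x : ℂ) : Summable fun N : ℤ => c N * gaussian τ k N * ex (N * x) :=
  summable_bounded_gaussian τ hk
    (norm_le_of_periodic (m := 2 * k) (by omega) fun r => by push_cast; exact hc r) x

lemma sum_periodic_mul_thetaLevel {k : ℕ} (hk : 0 < k) {c : ℤ → ℂ}
    (hc : ∀ r : ℤ, c (r + 2 * k) = c r) (x : ℂ) :
    ∑ r ∈ Finset.range (2 * k), c r * thetaLevel k r τ x =
      ∑' N : ℤ, c N * gaussian τ k N * ex (N * x) := by
  rw [← tsum_residues (m := 2 * k) (by omega) (summable_periodic_gaussian τ hk hc x)]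
  refine Finset.sum_congr rfl fun r _ => ?_
  rw [thetaLevel, ← tsum_mul_left]
  refine tsum_congr fun n => ?_
  have hp : Function.Periodic c (2 * k : ℤ) := hc
  have h1 : c ((2 * k : ℕ) * n + r) = c r := by
    have := hp.int_mul n r
    rw [← this]; congr 1; push_cast; ring
  rw [h1, mul_assoc (c _)]
  congr 1
  have := thetaLevel_term τ k r n x
  push_cast at this ⊢
  exact this

end LevelTheta

end HelicitySupertrace

namespace HelicitySupertrace

variable (τ : ℍ)

/-! ### The Laurent expansion of 1/θ in the strip. -/

section InverseTheta

/-- The Laurent coefficients of `1/θ` in the strip `0 < Im u < Im τ`, up to normalization. -/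
noncomputable def invCoeff (s : ℤ) : ℂ := ∑' m : ℕ, thCoeff τ (-m) * ex (m * (s * τ))

lemma summable_thCoeff_neg_nat (v : ℂ) : Summable fun m : ℕ => thCoeff τ (-m) * ex (m * v) := by
  refine ((summable_thCoeff_mul τ (-v)).comp_injective (i := fun m : ℕ => -(m : ℤ))
    fun a b h => by simpa using h).congr fun m => ?_
  simp only [Function.comp_apply]
  congr 2; push_cast; ring

lemma summable_thCoeff_succ_nat (v : ℂ) :
    Summable fun m : ℕ => thCoeff τ (-(-(m + 1))) * ex (-(m + 1) * v) := by
  refine ((summable_thCoeff_mul τ (-v)).comp_injective (i := fun m : ℕ => (m : ℤ) + 1)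
    fun a b h => by simpa using h).congr fun m => ?_
  simp only [Function.comp_apply]
  rw [neg_neg]
  congr 2; push_cast; ring

/-- The sum over all m ∈ ℤ is θ(−sτ) = 0. Hence one formula serves both signs of s: the geometric
expansions of the terms with m ≥ 0 give s ≥ 0, those with m < 0 give s < 0. -/
lemma invCoeff_eq_neg (s : ℤ) :
    invCoeff τ s = -∑' m : ℕ, thCoeff τ (-(-(m + 1))) * ex (-(m + 1) * (s * τ)) := by
  have h := tsum_of_nat_of_neg_add_one (f := fun m : ℤ => thCoeff τ (-m) * ex (m * (s * τ)))
    (by simpa using summable_thCoeff_neg_nat τ (s * τ))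
    (by simpa using summable_thCoeff_succ_nat τ (s * τ))
  have h0 := (Equiv.neg ℤ).tsum_eq fun m : ℤ => thCoeff τ m * ex (m * ((-s : ℤ) * τ))
  rw [← thSeries, thSeries_lattice] at h0
  have e : ∑' m : ℤ, thCoeff τ (-m) * ex (m * (s * τ)) = 0 := by
    rw [← h0]
    refine tsum_congr fun m => ?_
    simp only [Equiv.neg_apply]
    congr 2; push_cast; ring
  rw [e] at h
  rw [eq_neg_iff_add_eq_zero, invCoeff, h]
  push_cast
  rfl

lemma invCoeff_pred (s : ℤ) : invCoeff τ (s - 1) = -ex ((s - 1) * τ) * invCoeff τ s + 1 := by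
  have h := (summable_thCoeff_neg_nat τ ((s - 1 : ℤ) * τ)).tsum_eq_zero_add
  rw [invCoeff, h, invCoeff, ← tsum_mul_left, add_comm]
  congr 1
  · refine tsum_congr fun m => ?_
    have h1 := thCoeff_add_one τ (-(m + 1 : ℕ))
    rw [show (-(m + 1 : ℕ) : ℤ) + 1 = -m by push_cast; ring] at h1
    rw [h1]
    have e : ex ((s - 1) * τ) * ex (((-(m + 1 : ℕ) : ℤ) + 1) * τ) * ex (m * (s * τ)) =
        ex ((m + 1 : ℕ) * ((s - 1 : ℤ) * τ)) := by
      rw [← ex_add, ← ex_add]; congr 1; push_cast; ring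
    rw [← e]; ring
  · simp

lemma invCoeff_pred_pred (s : ℤ) :
    invCoeff τ (s - 2) = ex ((2 * s - 3) * τ) * invCoeff τ s - ex ((s - 2) * τ) + 1 := by
  have h1 := invCoeff_pred τ s
  have h2 := invCoeff_pred τ (s - 1)
  have e : ex ((2 * s - 3) * τ) = ex ((((s - 1 : ℤ) : ℂ) - 1) * τ) * ex ((s - 1) * τ) := by
    rw [← ex_add]; congr 1; push_cast; ring
  have e2 : ex (((s : ℂ) - 2) * τ) = ex ((((s - 1 : ℤ) : ℂ) - 1) * τ) := by
    congr 1; push_cast; ring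
  rw [show s - 2 = s - 1 - 1 by ring, h2, h1, e, e2]
  ring

lemma norm_invCoeff_nat_le (n : ℕ) : ‖invCoeff τ n‖ ≤ ∑' m : ℤ, ‖thCoeff τ m‖ := by
  have hs := (summable_thCoeff τ).norm
  have hs' : Summable fun m : ℕ => ‖thCoeff τ (-m)‖ :=
    hs.comp_injective (i := fun m : ℕ => -(m : ℤ)) fun a b h => by simpa using h
  have h1 : ‖invCoeff τ n‖ ≤ ∑' m : ℕ, ‖thCoeff τ (-m)‖ := by
    refine tsum_of_norm_bounded hs'.hasSum fun m => ?_
    rw [norm_mul]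
    refine mul_le_of_le_one_right (norm_nonneg _) ?_
    rw [show (m : ℂ) * ((n : ℤ) * (τ : ℂ)) = (m * n : ℕ) * (τ : ℂ) by push_cast; ring, ex_nat_mul,
      norm_pow]
    exact pow_le_one₀ (norm_nonneg _) (norm_ex_tau_lt_one τ).le
  refine h1.trans ?_
  exact tsum_comp_le_tsum_of_inj hs (fun _ => norm_nonneg _)
    (i := fun m : ℕ => -(m : ℤ)) fun a b h => by simpa using h

/-- The decay |q|ⁿ at −∞ is what allows convergence up to Im u < Im τ. -/
lemma norm_invCoeff_neg_le (n : ℕ) :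
    ‖invCoeff τ (-n)‖ ≤ (∑' m : ℤ, ‖thCoeff τ m‖) * ‖ex (τ : ℂ)‖ ^ n := by
  have hs := (summable_thCoeff τ).norm
  have hs' : Summable fun m : ℕ => ‖thCoeff τ (-(-(m + 1)))‖ :=
    hs.comp_injective (i := fun m : ℕ => -(-((m : ℤ) + 1))) fun a b h => by simpa using h
  have h1 : ‖invCoeff τ (-n)‖ ≤ (∑' m : ℕ, ‖thCoeff τ (-(-(m + 1)))‖) * ‖ex (τ : ℂ)‖ ^ n := by
    rw [invCoeff_eq_neg, norm_neg]
    refine tsum_of_norm_bounded (hs'.hasSum.mul_right _) fun m => ?_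
    rw [norm_mul]
    refine mul_le_mul_of_nonneg_left ?_ (norm_nonneg _)
    rw [show -((m : ℂ) + 1) * ((-n : ℤ) * (τ : ℂ)) = ((m + 1) * n : ℕ) * (τ : ℂ) by
      push_cast; ring, ex_nat_mul, norm_pow]
    exact pow_le_pow_of_le_one (norm_nonneg _) (norm_ex_tau_lt_one τ).le
      (Nat.le_mul_of_pos_left n m.succ_pos)
  refine h1.trans (mul_le_mul_of_nonneg_right ?_ (by positivity))
  exact tsum_comp_le_tsum_of_inj hs (fun _ => norm_nonneg _)
    (i := fun m : ℕ => -(-((m : ℤ) + 1))) fun a b h => by simpa using h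

lemma norm_invCoeff_le (s : ℤ) : ‖invCoeff τ s‖ ≤ ∑' m : ℤ, ‖thCoeff τ m‖ := by
  obtain ⟨n, rfl | rfl⟩ := s.eq_nat_or_neg
  · exact norm_invCoeff_nat_le τ n
  · refine (norm_invCoeff_neg_le τ n).trans (mul_le_of_le_one_right ?_ ?_)
    · exact tsum_nonneg fun _ => norm_nonneg _
    · exact pow_le_one₀ (norm_nonneg _) (norm_ex_tau_lt_one τ).le

variable {τ}

lemma summable_invCoeff {u : ℂ} (h₀ : 0 < u.im) (h₁ : u.im < τ.im) :
    Summable fun s : ℤ => invCoeff τ s * ex (s * u) := by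
  have hr₁ := norm_ex_lt_one h₀
  have hr₂ : ‖ex ((τ : ℂ) - u)‖ < 1 := norm_ex_lt_one (by simpa using h₁)
  have hB : 0 ≤ ∑' m : ℤ, ‖thCoeff τ m‖ := tsum_nonneg fun _ => norm_nonneg _
  refine summable_int_of_geometric (r := max ‖ex u‖ ‖ex ((τ : ℂ) - u)‖)
    (C := ∑' m : ℤ, ‖thCoeff τ m‖) ((norm_nonneg _).trans (le_max_left _ _)) (max_lt hr₁ hr₂) ?_ ?_
  · intro n
    rw [norm_mul, Int.cast_natCast, ex_nat_mul, norm_pow]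
    exact mul_le_mul (norm_invCoeff_le τ n)
      (pow_le_pow_left₀ (norm_nonneg _) (le_max_left _ _) n) (by positivity) hB
  · intro n
    have e : ‖ex (τ : ℂ)‖ ^ n * ‖ex ((-n : ℤ) * u)‖ = ‖ex ((τ : ℂ) - u)‖ ^ n := by
      rw [← norm_pow, ← norm_pow, ← ex_nat_mul, ← ex_nat_mul, ← norm_mul, ← ex_add]
      congr 2; push_cast; ring
    rw [norm_mul]
    calc _ ≤ (∑' m : ℤ, ‖thCoeff τ m‖) * ‖ex (τ : ℂ)‖ ^ n * ‖ex ((-n : ℤ) * u)‖ :=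
          mul_le_mul_of_nonneg_right (norm_invCoeff_neg_le τ n) (norm_nonneg _)
      _ = (∑' m : ℤ, ‖thCoeff τ m‖) * ‖ex ((τ : ℂ) - u)‖ ^ n := by rw [mul_assoc, e]
      _ ≤ _ := mul_le_mul_of_nonneg_left
          (pow_le_pow_left₀ (norm_nonneg _) (le_max_right _ _) n) hB

lemma im_half_tau : 0 < ((τ : ℂ) / 2).im ∧ ((τ : ℂ) / 2).im < τ.im := by
  have := τ.im_pos
  have e : ((τ : ℂ) / 2).im = τ.im / 2 := by simp
  rw [e]
  constructor <;> linarith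

variable (τ) in
/-- The coefficients of the product of `θ` with the Laurent series `∑ invCoeff s y^s`. -/
noncomputable def invConv (n : ℤ) : ℂ := ∑' s : ℤ, invCoeff τ s * thCoeff τ (n - 1 * s)

variable (τ) in
lemma summable_invConv (n : ℤ) (v : ℂ) :
    Summable fun s : ℤ => invCoeff τ s * (thCoeff τ (n - 1 * s) * ex (s * v)) := by
  have h := ((Equiv.subLeft n).summable_iff.2 (summable_thCoeff_mul τ (-v))).mul_right (ex (n * v))
  refine Summable.of_norm_bounded (h.norm.mul_left (∑' m : ℤ, ‖thCoeff τ m‖)) fun s => ?_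
  rw [norm_mul]
  refine mul_le_mul (norm_invCoeff_le τ s) (le_of_eq ?_) (norm_nonneg _)
    (tsum_nonneg fun _ => norm_nonneg _)
  simp only [Function.comp_apply, Equiv.subLeft_apply]
  rw [mul_assoc, ← ex_add, one_mul]
  congr 3; push_cast; ring

-- The recursion for `invCoeff` makes the n-th coefficient of the product equal to qⁿ times itself.
variable (τ) in
lemma invConv_eq_zero {n : ℤ} (hn : n ≠ 0) : invConv τ n = 0 := by
  have e : ∀ s : ℤ, invCoeff τ (s - 1) * thCoeff τ (n + 1 - s) =
      ex (n * τ) * (invCoeff τ s * thCoeff τ (n - 1 * s)) + thCoeff τ (n + 1 - s) := by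
    intro s
    have h1 := thCoeff_add_one τ (n - s)
    have h2 : ex ((s - 1) * τ) * ex ((((n - s : ℤ) : ℂ) + 1) * τ) = ex (n * τ) := by
      rw [← ex_add]; congr 1; push_cast; ring
    rw [invCoeff_pred, show n + 1 - s = n - s + 1 by ring, h1, one_mul]
    linear_combination (invCoeff τ s * thCoeff τ (n - s)) * h2
  have hs : Summable fun s : ℤ => invCoeff τ s * thCoeff τ (n - 1 * s) := by
    simpa using summable_invConv τ n 0
  have h := (Equiv.subRight (1 : ℤ)).tsum_eq fun s => invCoeff τ s * thCoeff τ (n - 1 * s)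
  have h' : ∑' s : ℤ, invCoeff τ (s - 1) * thCoeff τ (n + 1 - s) = invConv τ n := by
    rw [invConv, ← h]
    refine tsum_congr fun s => ?_
    simp only [Equiv.subRight_apply]
    congr 2; ring
  rw [tsum_congr e, (hs.mul_left _).tsum_add (summable_thCoeff_sub _), tsum_thCoeff_sub,
    tsum_mul_left, add_zero, ← invConv] at h'
  have h2 : (ex (n * τ) - 1) * invConv τ n = 0 := by linear_combination h'
  refine (mul_eq_zero.1 h2).resolve_left fun h0 => ?_
  have h1 : ‖ex (n * (τ : ℂ))‖ = 1 := by rw [sub_eq_zero.1 h0, norm_one]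
  rw [norm_ex, Real.exp_eq_one_iff] at h1
  have : (n : ℝ) ≠ 0 := by exact_mod_cast hn
  simp [Real.pi_ne_zero, this, τ.im_pos.ne'] at h1

lemma invSeries_mul_thSeries {u : ℂ} (h₀ : 0 < u.im) (h₁ : u.im < τ.im) :
    (∑' s : ℤ, invCoeff τ s * ex (s * u)) * thSeries τ u = invConv τ 0 := by
  have h := (laurent_mul (a := invCoeff τ) (b := thCoeff τ) 1 u
    (by simpa using summable_invCoeff h₀ h₁) (summable_thCoeff_mul τ u)).2
  simp only [Int.cast_one, one_mul] at h
  rw [thSeries, ← h, tsum_eq_single 0]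
  · simp [invConv]
  · intro n hn
    have := invConv_eq_zero τ hn
    simp only [invConv, one_mul] at this
    rw [this, zero_mul]

-- If the product were zero, the series would vanish on a line where θ does not, so all `invCoeff`
-- would be zero, against `invCoeff_pred`.
variable (τ) in
lemma invConv_zero_ne_zero : invConv τ 0 ≠ 0 := by
  intro h
  obtain ⟨h₀, h₁⟩ := im_half_tau (τ := τ)
  have hz : ∀ t : ℝ, ∑' s : ℤ, invCoeff τ s * ex (s * (τ / 2 + t)) = 0 := by
    intro t
    have h0' : 0 < ((τ : ℂ) / 2 + t).im := by simpa using h₀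
    have h1' : ((τ : ℂ) / 2 + t).im < τ.im := by simpa using h₁
    have := invSeries_mul_thSeries h0' h1'
    rw [h] at this
    exact (mul_eq_zero.1 this).resolve_right (offLattice_of_im h0' h1').thSeries_ne_zero
  have hb := laurent_unique _ (summable_invCoeff h₀ h₁) hz
  have := invCoeff_pred τ 0
  rw [hb, hb] at this
  simp at this

end InverseTheta

/-! ### Existence and uniqueness of the string functions. -/

section StringFunctions

variable {k : ℕ} (hk : 0 < k) (j : ℤ)

/-- The Laurent coefficients of `ϑ̂_{k,j} / ϑ̂_{2,1}`, up to normalization. -/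
noncomputable def quotCoeff (k : ℕ) (j N : ℤ) : ℂ :=
  ∑' s : ℤ, invCoeff τ s * hatCoeff τ k j (N - 2 * s + 1)

include hk

lemma summable_quotCoeff (N : ℤ) :
    Summable fun s : ℤ => invCoeff τ s * hatCoeff τ k j (N - 2 * s + 1) := by
  have h := summable_hatCoeff_sub τ hk j (N + 1) 0
  refine Summable.of_norm_bounded (h.norm.mul_left (∑' m : ℤ, ‖thCoeff τ m‖)) fun s => ?_
  rw [norm_mul, mul_zero, ex_zero, mul_one, show N - 2 * s + 1 = N + 1 - 2 * s by ring]
  exact mul_le_mul_of_nonneg_right (norm_invCoeff_le τ s) (norm_nonneg _)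

/-- A translation of x by τ would in general cross poles of the quotient. The crossing terms are
values of parity-restricted ϑ̂_{k,j} at lattice points, and these vanish by `tsum_hatCoeff_lattice`.
-/
lemma quotCoeff_add (N : ℤ) :
    quotCoeff τ k j (N + 2 * (k - 2)) = ex ((N + k - 2) * τ) * quotCoeff τ k j N := by
  have h := (Equiv.subRight (2 : ℤ)).tsum_eq fun s =>
    invCoeff τ s * hatCoeff τ k j (N + 2 * (k - 2) - 2 * s + 1)
  rw [← quotCoeff] at h
  rw [← h]
  have e : ∀ s : ℤ, invCoeff τ (s - 2) * hatCoeff τ k j (N + 2 * (k - 2) - 2 * (s - 2) + 1) =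
      ex ((N + k - 2) * τ) * (invCoeff τ s * hatCoeff τ k j (N - 2 * s + 1)) -
      ex ((N + k - 1) * τ) * (hatCoeff τ k j (N + 1 - 2 * s) * ex (s * ((-1 : ℤ) * τ))) +
      ex ((N + k + 1) * τ) * (hatCoeff τ k j (N + 1 - 2 * s) * ex (s * ((-2 : ℤ) * τ))) := by
    intro s
    rw [show N + 2 * ((k : ℤ) - 2) - 2 * (s - 2) + 1 = N + 1 - 2 * s + 2 * k * 1 by ring,
      hatCoeff_add_mul τ hk, invCoeff_pred_pred, show N - 2 * s + 1 = N + 1 - 2 * s by ring]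
    have e₁ : ex ((2 * s - 3) * τ) * ex ((((N + 1 - 2 * s) * 1 + k * 1 ^ 2 : ℤ) : ℂ) * τ) =
        ex ((N + k - 2) * τ) := by
      rw [← ex_add]; congr 1; push_cast; ring
    have e₂ : ex ((s - 2) * τ) * ex ((((N + 1 - 2 * s) * 1 + k * 1 ^ 2 : ℤ) : ℂ) * τ) =
        ex ((N + k - 1) * τ) * ex (s * ((-1 : ℤ) * τ)) := by
      rw [← ex_add, ← ex_add]; congr 1; push_cast; ring
    have e₃ : ex ((((N + 1 - 2 * s) * 1 + k * 1 ^ 2 : ℤ) : ℂ) * τ) =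
        ex ((N + k + 1) * τ) * ex (s * ((-2 : ℤ) * τ)) := by
      rw [← ex_add]; congr 1; push_cast; ring
    linear_combination hatCoeff τ k j (N + 1 - 2 * s) * (invCoeff τ s * e₁ - e₂ + e₃)
  simp only [Equiv.subRight_apply]
  have s₁ := (summable_quotCoeff τ hk j N).mul_left (ex ((N + k - 2) * τ))
  have s₂ := (summable_hatCoeff_sub τ hk j (N + 1) ((-1 : ℤ) * τ)).mul_left (ex ((N + k - 1) * τ))
  have s₃ := (summable_hatCoeff_sub τ hk j (N + 1) ((-2 : ℤ) * τ)).mul_left (ex ((N + k + 1) * τ))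
  rw [tsum_congr e, (s₁.sub s₂).tsum_add s₃, s₁.tsum_sub s₂, tsum_mul_left, tsum_mul_left,
    tsum_mul_left, tsum_hatCoeff_lattice τ hk j (N + 1) 1, tsum_hatCoeff_lattice τ hk j (N + 1) 2,
    ← quotCoeff]
  ring

variable {τ} in
lemma quotSeries {x : ℂ} (h₀ : 0 < (2 * x).im) (h₁ : (2 * x).im < τ.im) :
    (∑' N : ℤ, quotCoeff τ k j N * ex (N * x)) * thetaHat 2 1 τ x =
      ex (τ / 8) * invConv τ 0 * thetaHat k j τ x := by
  have hs : Summable fun N : ℤ => hatCoeff τ k j (N + 1) * ex (N * x) := by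
    refine (((Equiv.addRight (1 : ℤ)).summable_iff.2 (summable_hatCoeff τ hk j x)).mul_right
      (ex (-x))).congr fun N => ?_
    simp only [Function.comp_apply, Equiv.coe_addRight]
    rw [mul_assoc, ← ex_add]
    congr 2; push_cast; ring
  have e : (∑' N : ℤ, hatCoeff τ k j (N + 1) * ex (N * x)) * ex x = thetaHat k j τ x := by
    have h1 := (Equiv.addRight (1 : ℤ)).tsum_eq fun N : ℤ => hatCoeff τ k j N * ex (N * x)
    simp only [Equiv.coe_addRight] at h1
    rw [thetaHat_eq τ hk, ← h1, ← tsum_mul_right]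
    refine tsum_congr fun N => ?_
    rw [mul_assoc, ← ex_add]
    congr 2; push_cast; ring
  have h := (laurent_mul (a := invCoeff τ) (b := fun N => hatCoeff τ k j (N + 1)) 2 x
    (by simpa using summable_invCoeff h₀ h₁) hs).2
  have hq := invSeries_mul_thSeries h₀ h₁
  simp only [Int.cast_ofNat] at h
  rw [thetaHat_two_one, ← e, ← hq, ex_add]
  simp only [quotCoeff]
  rw [h]
  ring

/-- By `quotCoeff_add` the quotient coefficients divided by q^{N²/4M} are 2M-periodic. The identity
is checked inside the strip and then carried to all x, since both sides are Laurent series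
convergent everywhere. -/
lemma exists_string_aux {M : ℕ} (hM : 0 < M) (hkM : k = M + 2) :
    ∃ c : ℤ → ℂ, (∀ r : ℤ, c (r + 2 * M) = c r) ∧ ∀ x : ℂ,
      (∑' N : ℤ, c N * gaussian τ M N * ex (N * x)) * thetaHat 2 1 τ x = thetaHat k j τ x := by
  set C := (ex ((τ : ℂ) / 8) * invConv τ 0)⁻¹ with hC
  have hC0 : ex ((τ : ℂ) / 8) * invConv τ 0 ≠ 0 :=
    mul_ne_zero (ex_ne_zero _) (invConv_zero_ne_zero τ)
  set c : ℤ → ℂ := fun N => C * quotCoeff τ k j N / gaussian τ M N with hc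
  have hcg : ∀ N, c N * gaussian τ M N = C * quotCoeff τ k j N := fun N =>
    div_mul_cancel₀ _ (gaussian_ne_zero τ M N)
  have hper : ∀ r : ℤ, c (r + 2 * M) = c r := by
    intro r
    have h1 := quotCoeff_add τ hk j r
    have h2 := gaussian_add_mul τ hM r 1
    rw [show r + 2 * ((k : ℤ) - 2) = r + 2 * M by rw [hkM]; push_cast; ring] at h1
    rw [mul_one] at h2
    have e : ex (((r * 1 + M * 1 ^ 2 : ℤ) : ℂ) * τ) = ex ((r + k - 2) * τ) := by
      rw [hkM]; congr 1; push_cast; ring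
    simp only [hc]
    rw [h1, h2, e]
    have := gaussian_ne_zero τ M r
    have := ex_ne_zero (((r : ℂ) + k - 2) * τ)
    field_simp
  refine ⟨c, hper, ?_⟩
  have hsc := summable_periodic_gaussian τ hM hper
  have hprod := fun x => laurent_mul (a := fun N => c N * gaussian τ M N) (b := hatCoeff τ 2 1) 1 x
    (by simpa using hsc x) (summable_hatCoeff τ two_pos 1 x)
  simp only [Int.cast_one, one_mul, ← thetaHat_eq τ two_pos] at hprod
  set d : ℤ → ℂ := fun n =>
    (∑' s, c s * gaussian τ M s * hatCoeff τ 2 1 (n - s)) - hatCoeff τ k j n with hd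
  have hds : ∀ x, Summable fun n => d n * ex (n * x) := fun x =>
    ((hprod x).1.sub (summable_hatCoeff τ hk j x)).congr fun n => by simp only [hd]; ring
  have hdt : ∀ x, ∑' n : ℤ, d n * ex (n * x) =
      (∑' N : ℤ, c N * gaussian τ M N * ex (N * x)) * thetaHat 2 1 τ x - thetaHat k j τ x := by
    intro x
    rw [← (hprod x).2, thetaHat_eq τ hk, ← (hprod x).1.tsum_sub (summable_hatCoeff τ hk j x)]
    refine tsum_congr fun n => ?_
    simp only [hd]; ring
  have hd0 : ∀ n, d n = 0 := by
    -- The line Im x = Im τ/4 puts 2x in the middle of the strip.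
    refine laurent_unique (τ / 4) (hds _) fun t => ?_
    obtain ⟨h₀, h₁⟩ := im_half_tau (τ := τ)
    have e : (2 * ((τ : ℂ) / 4 + t)).im = ((τ : ℂ) / 2).im := by
      rw [show 2 * ((τ : ℂ) / 4 + t) = τ / 2 + ((2 * t : ℝ) : ℂ) by push_cast; ring,
        Complex.add_im, Complex.ofReal_im, add_zero]
    have h := quotSeries hk j (h₀.trans_eq e.symm) (e.trans_lt h₁)
    rw [hdt, sub_eq_zero]
    simp only [hcg, mul_assoc C]
    rw [tsum_mul_left, mul_assoc, h, hC, ← mul_assoc, inv_mul_cancel₀ hC0, one_mul]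
  intro x
  have := hdt x
  simp only [hd0, zero_mul, tsum_zero] at this
  exact (sub_eq_zero.1 this.symm)

end StringFunctions

lemma isStringFunction_iff {M l : ℕ} (hM : 0 < M) (c : ℤ → ℂ) :
    IsStringFunction M l τ c ↔ (∀ r : ℤ, c (r + 2 * M) = c r) ∧
      ∀ x : ℂ, thetaHat 2 1 τ x ≠ 0 →
        thetaHat (M + 2) (l + 1) τ x =
          (∑' N : ℤ, c N * gaussian τ M N * ex (N * x)) * thetaHat 2 1 τ x := by
  refine and_congr_right fun hc => ?_
  simp only [su2Char, sum_periodic_mul_thetaLevel τ hM hc]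
  constructor
  · intro h x hx
    have := h (2 * x)
    rw [mul_div_cancel_left₀ x two_ne_zero] at this
    exact (div_eq_iff hx).1 (this hx)
  · intro h z hz
    exact (div_eq_iff hz).2 (h _ hz)

lemma existsUnique_stringFunction {M : ℕ} (hM : 0 < M) (l : ℕ) :
    ∃! c : ℤ → ℂ, IsStringFunction M l τ c := by
  obtain ⟨c, hc, h⟩ := exists_string_aux τ (k := M + 2) (by omega) (l + 1) hM rfl
  refine ⟨c, (isStringFunction_iff τ hM c).2 ⟨hc, fun x _ => (h x).symm⟩, fun c' hc' => ?_⟩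
  obtain ⟨hc', h'⟩ := (isStringFunction_iff τ hM c').1 hc'
  have s := summable_periodic_gaussian τ hM hc
  have s' := summable_periodic_gaussian τ hM hc'
  have hd : ∀ n, (c' n - c n) * gaussian τ M n = 0 := by
    have hs : ∀ x, Summable fun n : ℤ => (c' n - c n) * gaussian τ M n * ex (n * x) := fun x =>
      ((s' x).sub (s x)).congr fun n => by ring
    refine laurent_unique (τ / 4) (hs _) fun t => ?_
    obtain ⟨h₀, h₁⟩ := im_half_tau (τ := τ)
    set x : ℂ := τ / 4 + t with hx
    have e : (2 * x).im = ((τ : ℂ) / 2).im := by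
      rw [hx, show 2 * ((τ : ℂ) / 4 + t) = τ / 2 + ((2 * t : ℝ) : ℂ) by push_cast; ring,
        Complex.add_im, Complex.ofReal_im, add_zero]
    have hne := thetaHat_two_one_ne_zero τ
      (offLattice_of_im (h₀.trans_eq e.symm) (e.trans_lt h₁))
    have e1 : ∑' n : ℤ, (c' n - c n) * gaussian τ M n * ex (n * x) =
        ∑' n : ℤ, c' n * gaussian τ M n * ex (n * x) -
          ∑' n : ℤ, c n * gaussian τ M n * ex (n * x) := by
      rw [← (s' x).tsum_sub (s x)]
      exact tsum_congr fun n => by ring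
    rw [e1]
    refine mul_right_cancel₀ hne ?_
    rw [sub_mul, h, ← h' x hne, sub_self, zero_mul]
  funext n
  exact sub_eq_zero.1 ((mul_eq_zero.1 (hd n)).resolve_right (gaussian_ne_zero τ M n))

lemma stringFunction_spec {M : ℕ} (hM : 0 < M) (l : ℕ) :
    (∀ r : ℤ, stringFunction M l τ (r + 2 * M) = stringFunction M l τ r) ∧
    ∀ x : ℂ, (∑' N : ℤ, stringFunction M l τ N * gaussian τ M N * ex (N * x)) *
      thetaHat 2 1 τ x = thetaHat (M + 2) (l + 1) τ x := by
  obtain ⟨c, hc, h⟩ := exists_string_aux τ (k := M + 2) (by omega) (l + 1) hM rfl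
  have hc' := (isStringFunction_iff τ hM c).2 ⟨hc, fun x _ => (h x).symm⟩
  have hu : c = stringFunction M l τ := (existsUnique_stringFunction τ hM l).unique hc'
    (Classical.epsilon_spec ⟨c, hc'⟩ : IsStringFunction M l τ (stringFunction M l τ))
  rw [← hu]
  exact ⟨hc, h⟩

end HelicitySupertrace

namespace HelicitySupertrace

variable (τ : ℍ)

/-! ### The generating function of the coset characters. -/

section CosetCharacters

/-- The terms of the coset character as a series over `ℤ`, for a family `c` of string functions. -/
noncomputable def cosetTerm (k M : ℕ) (c : ℤ → ℂ) (s r : ℤ) (z : ℂ) (n : ℤ) : ℂ :=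
  c (r - s + 4 * n) * gaussian τ (2 * k * M) (2 * r + k * (4 * n - s)) *
    ex ((2 * r + k * (4 * n - s) : ℤ) * (z / (2 * k)))

variable {k M : ℕ} (hM : 0 < M) (hkM : k = M + 2) {c : ℤ → ℂ} (hc : ∀ r : ℤ, c (r + 2 * M) = c r)
include hM hkM hc

lemma summable_cosetTerm (s r : ℤ) (z : ℂ) : Summable (cosetTerm τ k M c s r z) := by
  have hK : 0 < 2 * k * M := by rw [hkM]; positivity
  have hb := norm_le_of_periodic (m := 2 * M) (by omega) fun r => by push_cast; exact hc r
  have hg := (summable_gaussian τ hK (z / (2 * k))).comp_injective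
    (i := fun n : ℤ => 2 * r + k * (4 * n - s)) fun a b h => by
      have : k ≠ 0 := by omega
      simpa [this] using h
  refine Summable.of_norm_bounded (hg.norm.mul_left (∑ r ∈ Finset.range (2 * M), ‖c r‖))
    fun n => ?_
  rw [cosetTerm, mul_assoc, norm_mul]
  exact mul_le_mul_of_nonneg_right (hb _) (norm_nonneg _)

lemma tsum_cosetTerm (s r : ℤ) (z : ℂ) :
    ∑ n ∈ Finset.range M, c (r - s + 4 * n) *
      thetaLevel (2 * k * M) (2 * r + k * (4 * n - s)) τ (z / (2 * k)) =
    ∑' n, cosetTerm τ k M c s r z n := by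
  rw [← tsum_residues hM (summable_cosetTerm τ hM hkM hc s r z)]
  refine Finset.sum_congr rfl fun n _ => ?_
  rw [thetaLevel, ← tsum_mul_left]
  refine tsum_congr fun t => ?_
  have hp : Function.Periodic c (2 * M : ℤ) := hc
  have h1 : c (r - s + 4 * (M * t + n)) = c (r - s + 4 * n) := by
    have := hp.int_mul (2 * t) (r - s + 4 * n)
    rw [← this]; congr 1; push_cast; ring
  have h2 : 2 * ((2 * k * M : ℕ) : ℤ) * t + (2 * r + k * (4 * n - s)) =
      2 * r + k * (4 * (M * t + n) - s) := by push_cast; ring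
  rw [thetaLevel_term, cosetTerm, h1, mul_assoc (c _), h2]

/-- With N = r − s + 4n, the exponents satisfy r²/4k + (2r + k(4n − s))²/8kM = (s − 4n)²/8 + N²/4M
when k = M + 2, and the linear terms split likewise; the double sum over r and n therefore factors.
-/
lemma cosetTerm_generating (s : ℤ) (x z : ℂ) :
    Summable (fun r : ℤ => gaussian τ k r * ex (r * (x - z / k)) *
      ∑' n, cosetTerm τ k M c s r z n) ∧
    ∑' r : ℤ, gaussian τ k r * ex (r * (x - z / k)) * ∑' n, cosetTerm τ k M c s r z n =
      (∑' N : ℤ, c N * gaussian τ M N * ex (N * x)) * thetaLevel 2 s τ (x - z / 2) := by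
  have hf : Summable fun n : ℤ => gaussian τ 2 (s - 4 * n) * ex ((s - 4 * n : ℤ) * (x - z / 2)) :=
    (summable_gaussian τ two_pos (x - z / 2)).comp_injective (i := fun n : ℤ => s - 4 * n)
      fun a b h => by simpa using h
  have hg : Summable fun N : ℤ => c (N - s) * gaussian τ M (N - s) * ex ((N - s : ℤ) * x) :=
    (Equiv.subRight s).summable_iff.2 (summable_periodic_gaussian τ hM hc x)
  have e₁ : ∑' n : ℤ, gaussian τ 2 (s - 4 * n) * ex ((s - 4 * n : ℤ) * (x - z / 2)) =
      thetaLevel 2 s τ (x - z / 2) := by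
    rw [thetaLevel, ← (Equiv.neg ℤ).tsum_eq]
    refine tsum_congr fun n => ?_
    rw [Equiv.neg_apply, gaussian]
    congr 2 <;> push_cast <;> ring
  have e₂ : ∑' N : ℤ, c (N - s) * gaussian τ M (N - s) * ex ((N - s : ℤ) * x) =
      ∑' N : ℤ, c N * gaussian τ M N * ex (N * x) :=
    (Equiv.subRight s).tsum_eq fun N : ℤ => c N * gaussian τ M N * ex (N * x)
  have e₃ : ∀ r n : ℤ, gaussian τ k r * ex (r * (x - z / k)) * cosetTerm τ k M c s r z n =
      gaussian τ 2 (s - 4 * n) * ex ((s - 4 * n : ℤ) * (x - z / 2)) *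
      (c (r - (-4) * n - s) * gaussian τ M (r - (-4) * n - s) *
        ex ((r - (-4) * n - s : ℤ) * x)) := by
    intro r n
    have hk0 : (k : ℂ) ≠ 0 := by rw [hkM]; exact_mod_cast (by omega : M + 2 ≠ 0)
    have hM0 : (M : ℂ) ≠ 0 := by exact_mod_cast hM.ne'
    have hk1 : (k : ℂ) = M + 2 := by rw [hkM]; push_cast; rfl
    have g₁ : gaussian τ k r * gaussian τ (2 * k * M) (2 * r + k * (4 * n - s)) =
        gaussian τ 2 (s - 4 * n) * gaussian τ M (r - (-4) * n - s) := by
      simp only [gaussian, ← ex_add]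
      congr 1
      push_cast
      rw [← add_mul, ← add_mul]
      congr 1
      have hM2 : (M : ℂ) + 2 ≠ 0 := hk1 ▸ hk0
      rw [hk1]
      field_simp
      ring
    have g₂ : ex (r * (x - z / k)) * ex ((2 * r + k * (4 * n - s) : ℤ) * (z / (2 * k))) =
        ex ((s - 4 * n : ℤ) * (x - z / 2)) * ex ((r - (-4) * n - s : ℤ) * x) := by
      rw [← ex_add, ← ex_add]
      congr 1
      push_cast
      field_simp
      ring
    rw [cosetTerm, show r - s + 4 * n = r - -4 * n - s by ring]
    linear_combination (c (r - -4 * n - s)) *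
      (ex (r * (x - z / k)) * ex ((2 * r + k * (4 * n - s) : ℤ) * (z / (2 * k))) * g₁ +
        gaussian τ 2 (s - 4 * n) * gaussian τ M (r - (-4) * n - s) * g₂)
  have hs := summable_convolution (-4) hf hg
  have ht := tsum_convolution (-4) hf hg
  rw [e₁, e₂] at ht
  have e₄ : ∀ r : ℤ, gaussian τ k r * ex (r * (x - z / k)) * ∑' n, cosetTerm τ k M c s r z n =
      ∑' n : ℤ, gaussian τ 2 (s - 4 * n) * ex ((s - 4 * n : ℤ) * (x - z / 2)) *
      (c (r - (-4) * n - s) * gaussian τ M (r - (-4) * n - s) *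
        ex ((r - (-4) * n - s : ℤ) * x)) := fun r => by
    rw [← tsum_mul_left, tsum_congr (e₃ r)]
  refine ⟨hs.congr fun r => (e₄ r).symm, ?_⟩
  rw [tsum_congr e₄, ht, mul_comm]

end CosetCharacters

lemma minimalChar_two (l : ℕ) (s r : ℤ) (z : ℂ) : minimalChar 2 l s r τ z = residueInd 2 s r := by
  simp [minimalChar, residueInd]

lemma minimalChar_eq_tsum {k : ℕ} (hk : 2 < k) (l : ℕ) (s r : ℤ) (z : ℂ) :
    minimalChar k l s r τ z =
      ∑' n, cosetTerm τ k (k - 2) (stringFunction (k - 2) l τ) s r z n := by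
  rw [minimalChar, if_neg hk.ne']
  exact tsum_cosetTerm τ (by omega) (by omega) (stringFunction_spec τ (by omega) l).1 s r z

lemma cosetChar_one_one (k l : ℕ) (r : ℤ) (z : ℂ) :
    cosetChar k l 1 1 r τ z =
      Complex.I * (minimalChar k l 1 r τ z - minimalChar k l 3 r τ z) := by
  rw [cosetChar, ← ex_quarter]
  push_cast
  norm_num
  ring_nf

lemma cosetChar_two (l : ℕ) (r : ℤ) (z : ℂ) :
    cosetChar 2 l 1 1 r τ z = Complex.I * hatSign 2 1 r := by
  rw [cosetChar_one_one, minimalChar_two, minimalChar_two, hatSign,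
    residueInd_congr (k := 2) (r := 3) (r' := -1) (by norm_num)]

/-- The combination of s = 1 and s = 3 turns ϑ_{2,1} − ϑ_{2,3} into ϑ̂_{2,1}, and the remaining
string series times ϑ̂_{2,1}(x) is ϑ̂_{k,l+1}(x) by definition. At k = 2 the characters are already
the signs of ϑ̂_{2,1}. -/
lemma cosetChar_generating {k : ℕ} (hk : 2 ≤ k) {l : ℕ} (hl : l ≤ k - 2) (x w : ℂ) :
    Summable (fun r : ℤ => gaussian τ k r * ex (r * (x + w / k)) * cosetChar k l 1 1 r τ (-w)) ∧
    (∑' r : ℤ, gaussian τ k r * ex (r * (x + w / k)) * cosetChar k l 1 1 r τ (-w)) *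
      thetaHat 2 1 τ x =
        Complex.I * thetaHat k (l + 1) τ x * thetaHat 2 1 τ (x + w / 2) := by
  rcases hk.eq_or_lt with rfl | hk
  · obtain rfl : l = 0 := by omega
    have e : ∀ r : ℤ, gaussian τ 2 r * ex (r * (x + w / (2 : ℕ))) * cosetChar 2 0 1 1 r τ (-w) =
        Complex.I * (hatCoeff τ 2 1 r * ex (r * (x + w / 2))) := by
      intro r
      rw [cosetChar_two, hatCoeff]
      push_cast
      ring
    simp only [e]
    refine ⟨(summable_hatCoeff τ two_pos 1 _).mul_left _, ?_⟩
    rw [tsum_mul_left, ← thetaHat_eq τ two_pos]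
    push_cast
    ring_nf
  · obtain ⟨hc, hst⟩ := stringFunction_spec τ (M := k - 2) (by omega) l
    have hM : 0 < k - 2 := by omega
    have hkM : k = k - 2 + 2 := by omega
    obtain ⟨s₁, t₁⟩ := cosetTerm_generating τ hM hkM hc 1 x (-w)
    obtain ⟨s₃, t₃⟩ := cosetTerm_generating τ hM hkM hc 3 x (-w)
    have e : ∀ r : ℤ, gaussian τ k r * ex (r * (x + w / k)) * cosetChar k l 1 1 r τ (-w) =
        Complex.I * (gaussian τ k r * ex (r * (x - -w / k)) *
          (∑' n, cosetTerm τ k (k - 2) (stringFunction (k - 2) l τ) 1 r (-w) n) -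
        gaussian τ k r * ex (r * (x - -w / k)) *
          (∑' n, cosetTerm τ k (k - 2) (stringFunction (k - 2) l τ) 3 r (-w) n)) := by
      intro r
      rw [cosetChar_one_one, minimalChar_eq_tsum τ hk, minimalChar_eq_tsum τ hk, neg_div,
        sub_neg_eq_add]
      ring
    simp only [e]
    refine ⟨(s₁.sub s₃).mul_left _, ?_⟩
    rw [tsum_mul_left, s₁.tsum_sub s₃, t₁, t₃, neg_div, sub_neg_eq_add]
    have h3 : thetaLevel 2 3 τ (x + w / 2) = thetaLevel 2 (-1) τ (x + w / 2) := by
      simp only [thetaLevel_eq τ two_pos,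
        residueInd_congr (k := 2) (r := 3) (r' := -1) (by norm_num)]
    have hst' := hst x
    rw [← hkM] at hst'
    rw [h3, ← hst', thetaHat.eq_1 2 1 τ (x + w / 2)]
    ring

/-- The coset characters as single sums over the weights `1 / (1 - y qᵐ)`. -/
lemma appell_mul_cosetChar {k : ℕ} (hk : 2 ≤ k) {l : ℕ} (hl : l ≤ k - 2) {w : ℂ}
    (hw : OffLattice τ w) (r : ℤ) :
    appell τ w * (gaussian τ k r * ex (r * w / k) * cosetChar k l 1 1 r τ (-w)) =
      Complex.I * ex (w / 2) *
        ∑' m : ℤ, 1 / (1 - ex w * ex (m * τ)) * hatCoeff τ k (l + 1) (r - 2 * m) := by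
  obtain ⟨h₀, h₁⟩ := im_half_tau (τ := τ)
  have hk0 : 0 < k := by omega
  set a : ℤ → ℂ := fun m => 1 / (1 - ex w * ex (m * τ)) with ha
  set b : ℤ → ℂ := fun r => appell τ w * (gaussian τ k r * ex (r * w / k) *
    cosetChar k l 1 1 r τ (-w)) with hb
  have hbx : ∀ (x : ℂ) (r : ℤ), b r * ex (r * x) = appell τ w *
      (gaussian τ k r * ex (r * (x + w / k)) * cosetChar k l 1 1 r τ (-w)) := by
    intro x r
    have : ex (r * (x + w / k)) = ex (r * w / k) * ex (r * x) := by
      rw [← ex_add]; congr 1; ring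
    simp only [hb]
    rw [this]; ring
  have hbs : ∀ x : ℂ, Summable fun r : ℤ => b r * ex (r * x) := fun x =>
    ((cosetChar_generating τ hk hl x w).1.mul_left (appell τ w)).congr fun r => (hbx x r).symm
  have key : ∀ t : ℝ, Summable (fun r : ℤ => (b r - Complex.I * ex (w / 2) *
      ∑' m, a m * hatCoeff τ k (l + 1) (r - 2 * m)) * ex (r * (τ / 4 + t))) ∧
      ∑' r : ℤ, (b r - Complex.I * ex (w / 2) *
        ∑' m, a m * hatCoeff τ k (l + 1) (r - 2 * m)) * ex (r * (τ / 4 + t)) = 0 := by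
    intro t
    set x : ℂ := τ / 4 + t with hx
    have e : (2 * x).im = ((τ : ℂ) / 2).im := by
      rw [hx, show 2 * ((τ : ℂ) / 4 + t) = τ / 2 + ((2 * t : ℝ) : ℂ) by push_cast; ring,
        Complex.add_im, Complex.ofReal_im, add_zero]
    have h₀' : 0 < (2 * x).im := h₀.trans_eq e.symm
    have h₁' : (2 * x).im < τ.im := e.trans_lt h₁
    have hox := offLattice_of_im h₀' h₁'
    have hl' : Summable fun m : ℤ => a m * ex (m * ((2 : ℤ) * x)) := by
      refine (summable_lerch hw h₀' h₁').congr fun m => ?_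
      simp only [ha]
      push_cast; ring
    have hlt : ∑' m : ℤ, a m * ex (m * ((2 : ℤ) * x)) = lerch τ w (2 * x) := by
      refine tsum_congr fun m => ?_
      simp only [ha]
      push_cast; ring
    obtain ⟨s₂, t₂⟩ := laurent_mul 2 x hl' (summable_hatCoeff τ hk0 (l + 1) x)
    have s₃ := s₂.mul_left (Complex.I * ex (w / 2))
    have e2 : ∀ r : ℤ, (b r - Complex.I * ex (w / 2) *
        ∑' m, a m * hatCoeff τ k (l + 1) (r - 2 * m)) * ex (r * x) = b r * ex (r * x) -
        Complex.I * ex (w / 2) *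
          ((∑' m, a m * hatCoeff τ k (l + 1) (r - 2 * m)) * ex (r * x)) := fun r => by ring
    simp only [e2]
    refine ⟨(hbs x).sub s₃, ?_⟩
    rw [(hbs x).tsum_sub s₃, tsum_mul_left, t₂, hlt, ← thetaHat_eq τ hk0, tsum_congr (hbx x),
      tsum_mul_left]
    have hg := (cosetChar_generating τ hk hl x w).2
    have hkr := thSeries_mul_lerch hw h₀' h₁'
    -- After multiplication by the nonvanishing ϑ̂_{2,1}(x), the difference is a multiple of
    -- Kronecker's identity at u = 2x.
    refine (mul_eq_zero.1 ?_).resolve_right (thetaHat_two_one_ne_zero τ hox)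
    rw [sub_mul, mul_assoc, hg, thetaHat_two_one, thetaHat_two_one,
      show 2 * (x + w / 2) = 2 * x + w by ring, show (τ : ℂ) / 8 + (x + w / 2) =
      τ / 8 + x + w / 2 by ring, ex_add _ (w / 2)]
    linear_combination (-(Complex.I * thetaHat k (l + 1) τ x * ex (τ / 8 + x) * ex (w / 2))) * hkr
  have hfin := laurent_unique (τ / 4) (by simpa using (key 0).1) (fun t => (key t).2) r
  exact sub_eq_zero.1 hfin

end HelicitySupertrace

namespace HelicitySupertrace

variable {τ : ℍ}

/-! ### The series μ(τ;w,w,0) as a double sum. -/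

section MuSeries

/-- Completing the square, n²/k + j'n/k = ((2n + j')² − j'²)/4k, so the terms contain exactly the
weighted characters of `appell_mul_cosetChar` at r = 2n + j'. -/
lemma muTerm_eq {k : ℕ} (hk : 0 < k) (j j' : ℕ) (w : ℂ) (n : ℤ) :
    muTerm k j j' τ w w 0 n = ex (-(j' / k * w)) / gaussian τ k j' *
      (gaussian τ k (2 * n + j') * ex ((2 * n + j' : ℤ) * w / k) *
        cosetChar k (j - 1) 1 1 (2 * n + j') τ (-w) / (1 - ex w * ex (n * τ))) := by
  have hk0 : (k : ℂ) ≠ 0 := by exact_mod_cast hk.ne'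
  have e₁ : gaussian τ k (2 * n + j') =
      ex ((n ^ 2 / k + j' * n / k : ℂ) * τ) * gaussian τ k j' := by
    rw [gaussian, gaussian, ← ex_add]
    congr 1
    push_cast
    field_simp
    ring
  have e₂ : ex (n * (w + (1 - 2 / k) * 0 - (1 - 2 / k) * w)) =
      ex (-(j' / k * w)) * ex ((2 * n + j' : ℤ) * w / k) := by
    rw [← ex_add]
    congr 1
    push_cast
    field_simp
    ring
  have hg := gaussian_ne_zero τ k j'
  rw [muTerm, e₁, e₂, zero_sub]
  field_simp

lemma summable_muTerm {k : ℕ} (hk : 2 ≤ k) {j : ℕ} (hj : j ∈ Finset.Icc 1 (k - 1)) (j' : ℕ) {w : ℂ}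
    (hw : OffLattice τ w) : Summable (muTerm k j j' τ w w 0) := by
  rw [Finset.mem_Icc] at hj
  have h := (cosetChar_generating τ hk (show j - 1 ≤ k - 2 by omega) 0 w).1
  have h1 := hw.summable_mul_inv (h.comp_injective (i := fun n : ℤ => 2 * n + j')
    fun a b h => by simpa using h)
  refine (h1.mul_left (ex (-(j' / k * w)) / gaussian τ k j')).congr fun n => ?_
  rw [muTerm_eq (by omega), Function.comp_apply, zero_add, mul_div_assoc _ w]

/-- Each character is replaced by its single sum; the resulting 1/appell and the prefactor 1/θ₁₁ are
absorbed by η³, because appell · θ is constant. -/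
lemma eta_cube_mul_mu {k : ℕ} (hk : 2 ≤ k) {j : ℕ} (hj : j ∈ Finset.Icc 1 (k - 1)) (j' : ℕ) {w : ℂ}
    (hw : OffLattice τ w) :
    ModularForm.eta (τ : ℂ) ^ 3 * mu k j j' τ w w 0 = -(gaussian τ k j')⁻¹ *
      ∑' n : ℤ, 1 / (1 - ex w * ex (n * τ)) *
        ∑' m : ℤ, 1 / (1 - ex w * ex (m * τ)) * hatCoeff τ k j (2 * n + j' - 2 * m) := by
  rw [Finset.mem_Icc] at hj
  have hj1 : (((j - 1 : ℕ) : ℤ) + 1) = j := by omega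
  have hθ := hw.thSeries_ne_zero
  have hg := gaussian_ne_zero τ k j'
  have hI := Complex.I_ne_zero
  have e : ∀ n : ℤ, appell τ w * (gaussian τ k (2 * n + j') * ex ((2 * n + j' : ℤ) * w / k) *
      cosetChar k (j - 1) 1 1 (2 * n + j') τ (-w) / (1 - ex w * ex (n * τ))) =
      Complex.I * ex (w / 2) * (1 / (1 - ex w * ex (n * τ)) *
        ∑' m : ℤ, 1 / (1 - ex w * ex (m * τ)) * hatCoeff τ k j (2 * n + j' - 2 * m)) := by
    intro n
    have h := appell_mul_cosetChar τ hk (show j - 1 ≤ k - 2 by omega) hw (2 * n + j')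
    rw [hj1] at h
    linear_combination (1 / (1 - ex w * ex (n * τ))) * h
  have h2 : Complex.I * ex (w / 2) ≠ 0 := mul_ne_zero hI (ex_ne_zero _)
  have h3 := appell_mul_thSeries hw
  rw [← mul_right_inj' h2, mul_left_comm (Complex.I * ex (w / 2)) (-(gaussian τ k j')⁻¹),
    ← tsum_mul_left, ← tsum_congr e, tsum_mul_left, mu, tsum_congr (muTerm_eq (by omega) j j' w),
    tsum_mul_left, thetaChar_one_one, eta_cube, ← h3, ex_add, ex_neg]
  have := ex_ne_zero (w / 2)
  have := ex_ne_zero ((τ : ℂ) / 8)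
  have := ex_ne_zero ((j' : ℂ) / k * w)
  field_simp

end MuSeries

/-! ### Regularized evaluation of the double sum. -/

section DoubleSum

/-- The weights `1 / (1 - y qⁿ)`. -/
noncomputable def weight (τ : ℍ) (w : ℂ) (n : ℤ) : ℂ := 1 / (1 - ex w * ex (n * τ))

/-- The indicator of the nonnegative integers. -/
def nonnegInd (n : ℤ) : ℂ := if 0 ≤ n then 1 else 0

/-- The series `∑ y qⁿ / (1 - y qⁿ)²`, the Weierstrass function up to normalization. -/
noncomputable def wpSeries (τ : ℍ) (w : ℂ) : ℂ :=
  ∑' n : ℤ, ex w * ex (n * τ) / (1 - ex w * ex (n * τ)) ^ 2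

lemma hasSum_nonnegInd (t : ℤ) : HasSum (fun n => nonnegInd (n + t) - nonnegInd n) (t : ℂ) := by
  -- A unit shift changes the indicator at one point only; the general case telescopes.
  have step : ∀ t : ℤ, HasSum (fun n => nonnegInd (n + (t + 1)) - nonnegInd (n + t)) (1 : ℂ) := by
    intro t
    convert hasSum_ite_eq (-t - 1) (1 : ℂ) using 2 with n
    simp only [nonnegInd]
    by_cases h : n = -t - 1
    · rw [if_pos (by omega), if_neg (by omega), if_pos h, sub_zero]
    · rw [if_neg h]
      by_cases h2 : 0 ≤ n + t
      · rw [if_pos (by omega), if_pos h2, sub_self]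
      · rw [if_neg (by omega), if_neg h2, sub_self]
  induction t using Int.induction_on with
  | zero => simp
  | succ n ih =>
    convert (step n).add ih using 1
    · funext m; ring
    · push_cast; ring
  | pred n ih =>
    have h := ih.sub (step (-n - 1))
    have e : (fun m => nonnegInd (m + (-n - 1)) - nonnegInd m) = fun m : ℤ =>
        nonnegInd (m + -n) - nonnegInd m -
          (nonnegInd (m + (-n - 1 + 1)) - nonnegInd (m + (-n - 1))) := by
      funext m; rw [sub_add_cancel]; ring
    have e' : ((-n - 1 : ℤ) : ℂ) = ((-n : ℤ) : ℂ) - 1 := by push_cast; ring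
    rw [e, e']
    exact h

variable {w : ℂ} (hw : OffLattice τ w)
include hw

lemma summable_weight_sub : Summable fun n => weight τ w n - nonnegInd n := by
  obtain ⟨K, hK0, hK⟩ := hw.exists_bound
  have hK' : ∀ n, ‖weight τ w n‖ ≤ K := hK
  have hρ := norm_ex_tau_lt_one τ
  -- The weights tend geometrically to 1 at +∞ and to 0 at −∞. The last summand K + 1 of the
  -- constant serves only n = 0, which also occurs in the negative branch.
  refine summable_int_of_geometric (norm_nonneg (ex (τ : ℂ))) hρ
    (K * ‖ex w‖ + ‖ex (-w)‖ * (K + 1) + K + 1) ?_ ?_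
  · intro n
    have h0 := hw.sub_ne_zero n
    have e : weight τ w n - nonnegInd n = weight τ w n * ex w * ex τ ^ n := by
      rw [nonnegInd, if_pos (by omega), weight, ← ex_nat_mul]
      push_cast at h0 ⊢
      field_simp
      ring
    rw [e, norm_mul, norm_mul, norm_pow]
    refine mul_le_mul_of_nonneg_right ?_ (by positivity)
    have := mul_le_mul_of_nonneg_right (hK' n) (norm_nonneg (ex w))
    have : 0 ≤ ‖ex (-w)‖ * (K + 1) := by positivity
    linarith
  · intro n
    have h1 : 0 ≤ K * ‖ex w‖ := by positivity
    have h2 : 0 ≤ ‖ex (-w)‖ * (K + 1) := by positivity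
    rcases n.eq_zero_or_pos with rfl | hn
    · have := norm_sub_le (weight τ w 0) (nonnegInd 0)
      have h3 : ‖nonnegInd 0‖ = 1 := by simp [nonnegInd]
      have := hK' 0
      simp only [Nat.cast_zero, neg_zero, pow_zero, mul_one]
      linarith
    · have e : weight τ w (-n) - nonnegInd (-n) =
          ex (-w) * (weight τ w (-n) - 1) * ex τ ^ n := by
        have := hw.neg_term (-n)
        rw [nonnegInd, if_neg (by omega), sub_zero, ← ex_nat_mul]
        refine this.trans ?_
        rw [weight]
        push_cast
        rw [neg_neg]
        ring
      rw [e, norm_mul, norm_mul, norm_pow]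
      refine mul_le_mul_of_nonneg_right ?_ (by positivity)
      have h3 := norm_sub_le (weight τ w (-n)) 1
      have h4 := hK' (-n)
      rw [norm_one] at h3
      have := mul_le_mul_of_nonneg_left (h3.trans (add_le_add_left h4 1)) (norm_nonneg (ex (-w)))
      linarith

lemma wp_term_eq (n : ℤ) : ex w * ex (n * τ) / (1 - ex w * ex (n * τ)) ^ 2 =
    weight τ w n * weight τ w n - weight τ w n := by
  have := hw.sub_ne_zero n
  rw [weight]
  field_simp
  ring

lemma summable_wpSeries :
    Summable fun n : ℤ => ex w * ex (n * τ) / (1 - ex w * ex (n * τ)) ^ 2 := by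
  obtain ⟨K, hK0, hK⟩ := hw.exists_bound
  have hK' : ∀ n, ‖weight τ w n‖ ≤ K := hK
  refine Summable.of_norm_bounded ((summable_weight_sub hw).norm.mul_left (K + 1)) fun n => ?_
  have h1 := norm_sub_le (weight τ w n) 1
  rw [norm_one] at h1
  have h2 := hK' n
  rw [wp_term_eq hw, nonnegInd]
  split_ifs with h
  · rw [show weight τ w n * weight τ w n - weight τ w n = weight τ w n * (weight τ w n - 1) by ring,
      norm_mul]
    exact mul_le_mul_of_nonneg_right (by linarith) (norm_nonneg _)
  · rw [show weight τ w n * weight τ w n - weight τ w n = (weight τ w n - 1) * weight τ w n by ring,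
      norm_mul, sub_zero]
    exact mul_le_mul_of_nonneg_right (by linarith) (norm_nonneg _)

/-- The regularized sum `∑ₙ 1 / ((1 - y qⁿ)(1 - y qⁿ⁺ᵗ))`. -/
lemma tsum_weight_mul_weight (t : ℤ) :
    ∑' n, (weight τ w n * weight τ w (n + t) - nonnegInd n) =
      (∑' n, (weight τ w n - nonnegInd n)) - t * ex (t * τ) / (1 - ex (t * τ)) +
        if t = 0 then wpSeries τ w else 0 := by
  have hs := summable_weight_sub hw
  split_ifs with ht
  · rw [ht, Int.cast_zero, zero_mul, zero_div, sub_zero, wpSeries,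
      ← hs.tsum_add (summable_wpSeries hw)]
    refine tsum_congr fun n => ?_
    rw [wp_term_eq hw, add_zero]; ring
  · have hq : 1 - ex (t * (τ : ℂ)) ≠ 0 := by
      intro h0
      have h1 : ‖ex (t * (τ : ℂ))‖ = 1 := by rw [← sub_eq_zero.1 h0, norm_one]
      rw [norm_ex, Real.exp_eq_one_iff] at h1
      have : (t : ℝ) ≠ 0 := by exact_mod_cast ht
      simp [Real.pi_ne_zero, this, τ.im_pos.ne'] at h1
    have hs' : Summable fun n => weight τ w (n + t) - nonnegInd (n + t) :=
      hs.comp_injective (i := fun n : ℤ => n + t) (add_left_injective t)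
    have ht' : ∑' n, (weight τ w (n + t) - nonnegInd (n + t)) =
        ∑' n, (weight τ w n - nonnegInd n) :=
      (Equiv.addRight t).tsum_eq fun n => weight τ w n - nonnegInd n
    have hχ := hasSum_nonnegInd t
    -- Partial fractions: 1/((1 − x)(1 − xq^t)) = (1 − q^t)⁻¹ (1/(1 − x) − q^t/(1 − xq^t)).
    -- Recentering the shifted indicator produces the factor t.
    have e : ∀ n, weight τ w n * weight τ w (n + t) - nonnegInd n =
        (1 - ex (t * τ))⁻¹ * ((weight τ w n - nonnegInd n) -
          ex (t * τ) * (weight τ w (n + t) - nonnegInd (n + t)) -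
          ex (t * τ) * (nonnegInd (n + t) - nonnegInd n)) := by
      intro n
      have h1 := hw.sub_ne_zero n
      have h2 := hw.sub_ne_zero (n + t)
      have e1 : ex w * ex ((n + t : ℤ) * τ) = ex w * ex (n * τ) * ex (t * τ) := by
        rw [mul_assoc, ← ex_add (n * τ)]; congr 2; push_cast; ring
      rw [e1] at h2
      rw [weight, weight, e1]
      generalize ex w * ex (n * τ) = x at h1 h2 ⊢
      generalize ex (t * (τ : ℂ)) = q at hq h2 ⊢
      field_simp
      ring
    have s₁ := hs.sub (hs'.mul_left (ex (t * τ)))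
    have s₂ := hχ.summable.mul_left (ex (t * τ))
    rw [tsum_congr e, tsum_mul_left, s₁.tsum_sub s₂, hs.tsum_sub (hs'.mul_left _), tsum_mul_left,
      tsum_mul_left, ht', hχ.tsum_eq]
    field_simp
    ring

/-- After replacing weights by indicators, the remaining part lives on 0 ≤ n < −t, about |t| values
of n. It is dominated by |q|^{|n|} |q|^t |H t|, since n + t < 0 there, and H decays fast enough to
absorb |q|^t. -/
lemma summable_weight_double {H : ℤ → ℂ} (hH : ∀ v : ℂ, Summable fun t : ℤ => H t * ex (t * v)) :
    Summable fun p : ℤ × ℤ =>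
      (weight τ w p.1 * weight τ w (p.1 + p.2) - nonnegInd p.1) * H p.2 := by
  obtain ⟨K, hK0, hK⟩ := hw.exists_bound
  have hK' : ∀ n, ‖weight τ w n‖ ≤ K := hK
  have hB := (summable_weight_sub hw).norm
  have hH0 : Summable fun t => ‖H t‖ := by simpa using (hH 0).norm
  have s₁ := (hB.mul_of_nonneg hH0 (fun _ => norm_nonneg _) fun _ => norm_nonneg _).mul_left K
  have s₂ : Summable fun p : ℤ × ℤ => ‖weight τ w (p.1 + p.2) - nonnegInd (p.1 + p.2)‖ * ‖H p.2‖ := by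
    have := hB.mul_of_nonneg hH0 (fun _ => norm_nonneg _) fun _ => norm_nonneg _
    let e : ℤ × ℤ ≃ ℤ × ℤ :=
      ⟨fun p => (p.1 + p.2, p.2), fun p => (p.1 - p.2, p.2), fun p => by simp, fun p => by simp⟩
    exact e.summable_iff.2 this
  have hgeo : Summable fun n : ℤ => ‖ex (τ : ℂ)‖ ^ n.natAbs := by
    have hg := summable_geometric_of_lt_one (norm_nonneg _) (norm_ex_tau_lt_one τ)
    exact Summable.of_nat_of_neg (by simpa using hg) (by simpa using hg)
  have s₃ := hgeo.mul_of_nonneg (hH τ).norm (fun _ => by positivity) fun _ => norm_nonneg _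
  refine Summable.of_norm_bounded ((s₁.add s₂).add s₃) fun ⟨n, t⟩ => ?_
  simp only
  have e : (weight τ w n * weight τ w (n + t) - nonnegInd n) * H t =
      (weight τ w n - nonnegInd n) * weight τ w (n + t) * H t +
      nonnegInd n * (weight τ w (n + t) - nonnegInd (n + t)) * H t +
      nonnegInd n * (nonnegInd (n + t) - 1) * H t := by ring
  have hχ : ‖nonnegInd n‖ ≤ 1 := by rw [nonnegInd]; split_ifs <;> simp
  rw [e]
  refine (norm_add_le _ _).trans (add_le_add ((norm_add_le _ _).trans (add_le_add ?_ ?_)) ?_)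
  · rw [norm_mul, norm_mul]
    have := mul_le_mul_of_nonneg_left (hK' (n + t)) (norm_nonneg (weight τ w n - nonnegInd n))
    have := mul_le_mul_of_nonneg_right this (norm_nonneg (H t))
    linarith
  · rw [norm_mul, norm_mul]
    exact mul_le_mul_of_nonneg_right (mul_le_of_le_one_left (norm_nonneg _) hχ) (norm_nonneg _)
  · by_cases hn : 0 ≤ n ∧ n + t < 0
    · have h1 : ‖nonnegInd n * (nonnegInd (n + t) - 1)‖ = 1 := by
        rw [nonnegInd, nonnegInd, if_pos hn.1, if_neg (by omega)]; simp
      have h2 : (1 : ℝ) ≤ ‖ex (τ : ℂ)‖ ^ n.natAbs * ‖ex (t * (τ : ℂ))‖ := by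
        rw [ex_int_mul, norm_zpow, ← zpow_natCast, ← zpow_add₀ (norm_ex_tau_pos τ).ne']
        exact one_le_zpow_of_nonpos₀ (norm_ex_tau_pos τ) (norm_ex_tau_lt_one τ).le (by omega)
      rw [norm_mul, h1, norm_mul]
      have := mul_le_mul_of_nonneg_right h2 (norm_nonneg (H t))
      linarith
    · have h1 : nonnegInd n * (nonnegInd (n + t) - 1) = 0 := by
        rw [nonnegInd, nonnegInd]
        split_ifs <;> first | omega | simp
      rw [h1, zero_mul, norm_zero]
      positivity

/-- As ∑ H = 0, subtracting the indicator in n is free, and after exchanging the sums the constant L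
from `tsum_weight_mul_weight` also drops out. -/
lemma weight_double_sum {H : ℤ → ℂ} (hH : ∀ v : ℂ, Summable fun t : ℤ => H t * ex (t * v))
    (hH0 : ∑' t, H t = 0) :
    Summable (fun t : ℤ => H t * (t * ex (t * τ) / (1 - ex (t * τ)))) ∧
    ∑' n, weight τ w n * ∑' t, weight τ w (n + t) * H t =
      H 0 * wpSeries τ w - ∑' t : ℤ, H t * (t * ex (t * τ) / (1 - ex (t * τ))) := by
  obtain ⟨K, hK0, hK⟩ := hw.exists_bound
  have hK' : ∀ n, ‖weight τ w n‖ ≤ K := hK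
  have hs := summable_weight_double hw hH
  have hHs : Summable H := by simpa using hH 0
  set L := ∑' n, (weight τ w n - nonnegInd n) with hL
  have h1 : ∀ n, weight τ w n * ∑' t, weight τ w (n + t) * H t =
      ∑' t, (weight τ w n * weight τ w (n + t) - nonnegInd n) * H t := by
    intro n
    have hsn : Summable fun t => weight τ w (n + t) * H t := by
      refine Summable.of_norm_bounded (hHs.norm.mul_left K) fun t => ?_
      rw [norm_mul]
      exact mul_le_mul_of_nonneg_right (hK' _) (norm_nonneg _)
    have e : ∀ t, (weight τ w n * weight τ w (n + t) - nonnegInd n) * H t =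
        weight τ w n * (weight τ w (n + t) * H t) - nonnegInd n * H t := fun t => by ring
    rw [tsum_congr e, (hsn.mul_left _).tsum_sub (hHs.mul_left _), tsum_mul_left, tsum_mul_left,
      hH0, mul_zero, sub_zero]
  have h2 : ∀ t, ∑' n, (weight τ w n * weight τ w (n + t) - nonnegInd n) * H t =
      H t * L - H t * (t * ex (t * τ) / (1 - ex (t * τ))) +
        if t = 0 then H 0 * wpSeries τ w else 0 := by
    intro t
    rw [tsum_mul_right, tsum_weight_mul_weight hw]
    split_ifs with ht
    · rw [ht]; ring
    · ring
  have s₁ := hs.prod_symm.prod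
  simp only [Prod.fst_swap, Prod.snd_swap, h2] at s₁
  have s₂ : Summable fun t : ℤ => if t = 0 then H 0 * wpSeries τ w else 0 :=
    (hasSum_ite_eq 0 _).summable
  have s₃ : Summable fun t : ℤ => H t * (t * ex (t * τ) / (1 - ex (t * τ))) := by
    refine (((hHs.mul_right L).add s₂).sub s₁).congr fun t => ?_
    ring
  refine ⟨s₃, ?_⟩
  have hc := hs.tsum_comm
    (f := fun n t => (weight τ w n * weight τ w (n + t) - nonnegInd n) * H t)
  rw [tsum_congr h1, ← hc, tsum_congr h2, ((hHs.mul_right L).sub s₃).tsum_add s₂,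
    (hHs.mul_right L).tsum_sub s₃, tsum_mul_right, hH0, tsum_ite_eq]
  ring

end DoubleSum

/-- The value of `μ^{k,j,j'}(τ;w,w,0)` in terms of the Weierstrass function. -/
lemma eta_cube_mul_mu_eq {k : ℕ} (hk : 2 ≤ k) {j : ℕ} (hj : j ∈ Finset.Icc 1 (k - 1)) (j' : ℕ)
    {w : ℂ} (hw : OffLattice τ w) :
    ModularForm.eta (τ : ℂ) ^ 3 * mu k j j' τ w w 0 = -hatSign k j j' * wpSeries τ w +
      (gaussian τ k j')⁻¹ * ∑' t : ℤ, hatCoeff τ k j (j' - 2 * t) *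
        (t * ex (t * τ) / (1 - ex (t * τ))) := by
  have hk0 : 0 < k := by omega
  have h := (weight_double_sum hw (H := fun t => hatCoeff τ k j (j' - 2 * t))
    (summable_hatCoeff_sub τ hk0 j j') (tsum_hatCoeff_parity τ hk0 j j')).2
  have e : ∀ n : ℤ, ∑' m : ℤ, 1 / (1 - ex w * ex (m * τ)) * hatCoeff τ k j (2 * n + j' - 2 * m) =
      ∑' t : ℤ, weight τ w (n + t) * hatCoeff τ k j (j' - 2 * t) := by
    intro n
    -- With m = n + t the coefficient index becomes j' − 2t, independent of n.
    rw [← (Equiv.addLeft n).tsum_eq]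
    refine tsum_congr fun t => ?_
    rw [Equiv.coe_addLeft, weight]
    congr 2; ring
  have hg := gaussian_ne_zero τ k j'
  rw [eta_cube_mul_mu hk hj j' hw]
  simp only [e]
  simp only [weight] at h ⊢
  have hgi := inv_mul_cancel₀ hg
  rw [h, mul_zero, sub_zero]
  nth_rw 1 [hatCoeff]
  linear_combination (-hatSign k j j' * wpSeries τ w) * hgi

end HelicitySupertrace

namespace HelicitySupertrace

/-! ### Summation of the Weierstrass series over the two-torsion points. -/

section TwoTorsion

/-- The rational function `x / (1 - x)²`. -/
noncomputable def lam (x : ℂ) : ℂ := x / (1 - x) ^ 2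

lemma lam_inv (x : ℂ) : lam x⁻¹ = lam x := by
  rcases eq_or_ne x 0 with rfl | hx
  · simp
  rcases eq_or_ne x 1 with rfl | hx1
  · simp
  have h1 : 1 - x ≠ 0 := sub_ne_zero.2 hx1.symm
  have h2 : x - 1 ≠ 0 := sub_ne_zero.2 hx1
  rw [lam, lam]
  field_simp
  ring

/-- The duplication rule that merges the three torsion points. -/
lemma lam_add_lam_neg {x : ℂ} (hx : ‖x‖ < 1) : lam x + lam (-x) = 4 * lam (x ^ 2) := by
  have h1 : 1 - x ≠ 0 := fun h => by
    rw [← sub_eq_zero.1 h, norm_one] at hx; exact lt_irrefl _ hx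
  have h2 : 1 + x ≠ 0 := fun h => by
    rw [eq_neg_of_add_eq_zero_right h, norm_neg, norm_one] at hx; exact lt_irrefl _ hx
  have h3 : 1 - x ^ 2 ≠ 0 := by
    rw [show 1 - x ^ 2 = (1 - x) * (1 + x) by ring]; exact mul_ne_zero h1 h2
  rw [lam, lam, lam, sub_neg_eq_add, show (1 - x ^ 2) ^ 2 = (1 - x) ^ 2 * (1 + x) ^ 2 by ring]
  field_simp
  ring

variable (τ : ℍ)

lemma norm_ex_pow_lt_one (n : ℕ) : ‖ex (τ : ℂ) ^ (n + 1)‖ < 1 := by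
  rw [norm_pow]
  exact pow_lt_one₀ (norm_nonneg _) (norm_ex_tau_lt_one τ) n.succ_ne_zero

lemma summable_lam : Summable fun n : ℕ => lam (ex τ ^ (n + 1)) := by
  have hρ := norm_ex_tau_lt_one τ
  have hg := ((summable_geometric_of_lt_one (norm_nonneg _) hρ).mul_left
    ((1 - ‖ex (τ : ℂ)‖) ^ 2)⁻¹)
  refine Summable.of_norm_bounded hg fun n => ?_
  have h1 : 1 - ‖ex (τ : ℂ)‖ ≤ ‖1 - ex (τ : ℂ) ^ (n + 1)‖ := by
    have h2 := norm_sub_norm_le 1 (ex (τ : ℂ) ^ (n + 1))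
    have h3 := pow_le_of_le_one (norm_nonneg (ex (τ : ℂ))) hρ.le n.succ_ne_zero
    rw [Nat.succ_eq_add_one] at h3
    rw [norm_one, norm_pow] at h2
    linarith
  have h0 : 0 < 1 - ‖ex (τ : ℂ)‖ := by linarith
  rw [lam, norm_div, norm_pow, norm_pow, div_eq_inv_mul]
  refine mul_le_mul ?_ (pow_le_pow_of_le_one (norm_nonneg _) hρ.le n.le_succ) (by positivity)
    (by positivity)
  exact inv_anti₀ (by positivity) (pow_le_pow_left₀ h0.le h1 2)

lemma E2_eq_lam : EisensteinSeries.E2 τ = 1 - 24 * ∑' n : ℕ, lam (ex τ ^ (n + 1)) := by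
  rw [EisensteinSeries.E2_eq_tsum_cexp]
  have hq := norm_ex_tau_lt_one τ
  have h := tsum_prod_pow_eq_tsum_sigma 1 hq
  rw [← tsum_pnat_eq_tsum_succ (f := fun n : ℕ => lam (ex τ ^ n))]
  congr 2
  have e : Complex.exp (2 * Real.pi * Complex.I * τ) = ex τ := rfl
  refine Eq.trans (Eq.trans ?_ h.symm) ?_
  · rfl
  · refine tsum_congr fun d => ?_
    have hd : ‖ex (τ : ℂ) ^ (d : ℕ)‖ < 1 := by
      rw [norm_pow]; exact pow_lt_one₀ (norm_nonneg _) hq d.ne_zero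
    have h1 := tsum_coe_mul_geometric_of_norm_lt_one hd
    rw [lam, ← h1, tsum_pnat_eq_tsum_of_eq_zero (f := fun c : ℕ => (c : ℂ) ^ 1 * ex (τ : ℂ) ^ ((d : ℕ) * c)) (by simp)]
    exact tsum_congr fun c => by rw [pow_one, pow_mul]

lemma offLattice_half : OffLattice τ (1 / 2) := by
  intro m h
  have h1 := congrArg norm h
  rw [norm_mul, ex_half, norm_neg, norm_one, one_mul, norm_ex, Real.exp_eq_one_iff] at h1
  have h2 : m = 0 := by simpa [Real.pi_ne_zero, τ.im_pos.ne'] using h1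
  rw [h2, ex_half] at h
  norm_num at h

lemma offLattice_tau_half : OffLattice τ ((τ : ℂ) / 2) :=
  offLattice_of_im im_half_tau.1 im_half_tau.2

lemma offLattice_tau_add_one_half : OffLattice τ (((τ : ℂ) + 1) / 2) := by
  have e : (((τ : ℂ) + 1) / 2).im = ((τ : ℂ) / 2).im := by simp
  exact offLattice_of_im (e ▸ im_half_tau.1) (e ▸ im_half_tau.2)

lemma offLattice_of_mem_twoTorsion {w : ℂ} (hw : w ∈ twoTorsion τ) : OffLattice τ w := by
  simp only [twoTorsion, Finset.mem_insert, Finset.mem_singleton] at hw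
  rcases hw with rfl | rfl | rfl
  exacts [offLattice_half τ, offLattice_tau_half τ, offLattice_tau_add_one_half τ]

lemma sum_twoTorsion (f : ℂ → ℂ) : ∑ w ∈ twoTorsion τ, f w =
    f (1 / 2) + f ((τ : ℂ) / 2) + f (((τ : ℂ) + 1) / 2) := by
  have hτ := τ.im_pos.ne'
  have h1 : (1 / 2 : ℂ) ≠ (τ : ℂ) / 2 := fun h => by
    have := congrArg Complex.im h
    simp at this
    exact hτ (by linarith)
  have h2 : (1 / 2 : ℂ) ≠ ((τ : ℂ) + 1) / 2 := fun h => by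
    have := congrArg Complex.im h
    simp at this
    exact hτ (by linarith)
  have h3 : (τ : ℂ) / 2 ≠ ((τ : ℂ) + 1) / 2 := fun h => by
    have : (τ : ℂ) = τ + 1 := by linear_combination 2 * h
    simp at this
  rw [twoTorsion, Finset.sum_insert (by simp only [Finset.mem_insert, Finset.mem_singleton]; tauto),
    Finset.sum_insert (by rwa [Finset.mem_singleton]), Finset.sum_singleton, add_assoc]

lemma card_twoTorsion : (twoTorsion τ).card = 3 := by
  have h := sum_twoTorsion τ fun _ => 1
  rw [Finset.sum_const, nsmul_eq_mul, mul_one] at h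
  have : ((twoTorsion τ).card : ℂ) = (3 : ℕ) := by rw [h]; norm_num
  exact_mod_cast this

lemma wpSeries_half :
    wpSeries τ (1 / 2) = -1 / 4 + 2 * ∑' n : ℕ, lam (-ex τ ^ (n + 1)) := by
  have hs := summable_wpSeries (offLattice_half τ)
  have e : ∀ n : ℤ, ex (1 / 2) * ex (n * τ) / (1 - ex (1 / 2) * ex (n * τ)) ^ 2 =
      lam (-ex τ ^ n) := by
    intro n; rw [lam, ex_half, ex_int_mul, neg_one_mul]
  simp only [e] at hs
  rw [wpSeries, tsum_congr e]
  have hp : Summable fun n : ℕ => lam (-ex (τ : ℂ) ^ (n + 1)) := by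
    refine (hs.comp_injective (i := fun n : ℕ => (n : ℤ) + 1) fun a b h => by simpa using h).congr
      fun n => ?_
    simp only [Function.comp_apply]; norm_cast
  have hn : ∀ n : ℕ, lam (-ex (τ : ℂ) ^ (-((n : ℤ) + 1))) = lam (-ex (τ : ℂ) ^ (n + 1)) := by
    intro n
    rw [← lam_inv, ← neg_inv, zpow_neg, inv_inv]; norm_cast
  have h0 : Summable fun n : ℕ => lam (-ex (τ : ℂ) ^ (n : ℤ)) :=
    hs.comp_injective Nat.cast_injective
  rw [tsum_of_nat_of_neg_add_one (f := fun n : ℤ => lam (-ex (τ : ℂ) ^ n)) h0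
    (by simpa only [hn] using hp), tsum_congr hn,
    h0.tsum_eq_zero_add]
  push_cast
  have e1 : lam (-ex (τ : ℂ) ^ (0 : ℤ)) = -1 / 4 := by rw [zpow_zero, lam]; norm_num
  have e2 : ∀ n : ℕ, lam (-ex (τ : ℂ) ^ ((n : ℤ) + 1)) = lam (-ex (τ : ℂ) ^ (n + 1)) := by
    intro n; norm_cast
  rw [e1, tsum_congr e2]
  ring

/-- The contributions of the two-torsion points off the real line. -/
lemma wpSeries_of_half_tau {w p : ℂ} (hw : OffLattice τ w)
    (hp : ∀ n : ℤ, ex (w + n * τ) = p * ex τ ^ n) (hpp : p * p = ex τ) :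
    Summable (fun n : ℕ => lam (p * ex τ ^ n)) ∧
      wpSeries τ w = 2 * ∑' n : ℕ, lam (p * ex τ ^ n) := by
  have hs := summable_wpSeries hw
  have e : ∀ n : ℤ, ex w * ex (n * τ) / (1 - ex w * ex (n * τ)) ^ 2 = lam (p * ex τ ^ n) := by
    intro n; rw [lam, ← hp, ex_add]
  simp only [e] at hs
  have h0 : Summable fun n : ℕ => lam (p * ex (τ : ℂ) ^ (n : ℤ)) :=
    hs.comp_injective Nat.cast_injective
  have hq : ex (τ : ℂ) ≠ 0 := ex_ne_zero _
  have hp0 : p ≠ 0 := by rintro rfl; exact hq (by rw [← hpp, mul_zero])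
  have hn : ∀ n : ℕ, lam (p * ex (τ : ℂ) ^ (-((n : ℤ) + 1))) = lam (p * ex (τ : ℂ) ^ (n : ℤ)) := by
    intro n
    rw [← lam_inv]
    congr 1
    rw [mul_inv, ← zpow_neg, neg_neg, zpow_add_one₀ hq, ← hpp]
    field_simp
  refine ⟨by simpa using h0, ?_⟩
  rw [wpSeries, tsum_congr e, tsum_of_nat_of_neg_add_one (f := fun n : ℤ => lam (p * ex (τ : ℂ) ^ n)) h0
    (by simpa only [hn] using h0),
    tsum_congr hn]
  simp only [zpow_natCast]
  ring

lemma sum_wpSeries_twoTorsion :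
    ∑ w ∈ twoTorsion τ, wpSeries τ w = -(1 / 4) * EisensteinSeries.E2 τ := by
  set p := ex ((τ : ℂ) / 2) with hp
  have hpp : p * p = ex τ := by rw [hp, ← ex_add]; congr 1; ring
  obtain ⟨s₁, t₁⟩ := wpSeries_of_half_tau τ (p := p) (offLattice_tau_half τ)
    (fun n => by rw [ex_add, ex_int_mul]) hpp
  obtain ⟨s₂, t₂⟩ := wpSeries_of_half_tau τ (p := -p) (offLattice_tau_add_one_half τ)
    (fun n => by
      rw [ex_add, ex_int_mul, show ((τ : ℂ) + 1) / 2 = τ / 2 + 1 / 2 by ring,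
        ex_half_int_add_one]) (by rw [neg_mul_neg, hpp])
  have hL := summable_lam τ
  have hpn : ‖p‖ < 1 := norm_ex_lt_one im_half_tau.1
  -- The points τ/2 and (τ + 1)/2 together yield the odd powers of q; by `e₂` the point 1/2 yields
  -- the even powers minus a full series. The total is −1/4 + (8 − 2) ∑ lam(qⁿ).
  have e₁ : ∀ n : ℕ, lam (p * ex τ ^ n) + lam (-p * ex τ ^ n) = 4 * lam (ex τ ^ (2 * n + 1)) := by
    intro n
    have hx : ‖p * ex (τ : ℂ) ^ n‖ < 1 := by
      rw [norm_mul, norm_pow]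
      have := pow_le_one₀ (n := n) (norm_nonneg _) (norm_ex_tau_lt_one τ).le
      have := mul_le_of_le_one_right (norm_nonneg p) this
      linarith
    rw [neg_mul, lam_add_lam_neg hx]
    congr 2
    rw [mul_pow, pow_two, hpp]; ring
  have e₂ : ∀ n : ℕ, lam (-ex (τ : ℂ) ^ (n + 1)) =
      4 * lam (ex τ ^ (2 * n + 1 + 1)) - lam (ex τ ^ (n + 1)) := by
    intro n
    have h := lam_add_lam_neg (norm_ex_pow_lt_one τ n)
    rw [← pow_mul, show (n + 1) * 2 = 2 * n + 1 + 1 by ring] at h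
    linear_combination h
  have so : Summable fun n : ℕ => lam (ex (τ : ℂ) ^ (2 * n + 1)) :=
    hL.comp_injective (i := fun n : ℕ => 2 * n) fun a b h => by simpa using h
  have se : Summable fun n : ℕ => lam (ex (τ : ℂ) ^ (2 * n + 1 + 1)) :=
    hL.comp_injective (i := fun n : ℕ => 2 * n + 1) fun a b h => by simpa using h
  have hLoe := tsum_even_add_odd (f := fun n : ℕ => lam (ex (τ : ℂ) ^ (n + 1))) so se
  have h₁₂ : ∑' n : ℕ, lam (p * ex τ ^ n) + ∑' n : ℕ, lam (-p * ex τ ^ n) =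
      4 * ∑' n : ℕ, lam (ex (τ : ℂ) ^ (2 * n + 1)) := by
    rw [← s₁.tsum_add s₂, tsum_congr e₁, tsum_mul_left]
  have h₃ : ∑' n : ℕ, lam (-ex (τ : ℂ) ^ (n + 1)) =
      4 * ∑' n : ℕ, lam (ex (τ : ℂ) ^ (2 * n + 1 + 1)) - ∑' n : ℕ, lam (ex (τ : ℂ) ^ (n + 1)) := by
    rw [tsum_congr e₂, (se.mul_left 4).tsum_sub hL, tsum_mul_left]
  rw [sum_twoTorsion, wpSeries_half, t₁, t₂, E2_eq_lam]
  linear_combination 2 * h₁₂ + 2 * h₃ + 8 * hLoe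

end TwoTorsion

end HelicitySupertrace

namespace HelicitySupertrace

/-! ### Odd periodic functions and the matrices Ω̂. -/

section OddPeriodic

lemma hatSign_of_mem {k j m : ℕ} (hj : j ∈ Finset.Icc 1 (k - 1)) (hm : m ≤ k) :
    hatSign k j m = if j = m then 1 else 0 := by
  obtain ⟨h1, h2⟩ := Finset.mem_Icc.1 hj
  have e1 : (2 * k : ℤ) ∣ (m : ℤ) - j ↔ j = m := by
    refine ⟨fun ⟨c, hc⟩ => ?_, fun h => by simp [h]⟩
    have hk : (0 : ℤ) < k := by omega
    have h3 : c < 1 := by by_contra! h; nlinarith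
    have h4 : -1 < c := by
      by_contra! h
      have := mul_le_mul_of_nonneg_left h hk.le
      have : (j : ℤ) < k := by omega
      nlinarith
    obtain rfl : c = 0 := by omega
    omega
  have e2 : ¬ (2 * k : ℤ) ∣ (m : ℤ) - -(j : ℤ) := by
    rintro ⟨c, hc⟩
    have hk : (0 : ℤ) < k := by omega
    have h3 : c < 1 := by
      by_contra! h
      have := mul_le_mul_of_nonneg_left h hk.le
      have : (j : ℤ) < k := by omega
      nlinarith
    have h4 : 0 < c := by by_contra! h; nlinarith
    omega
  rw [hatSign, residueInd, residueInd, if_neg e2, sub_zero]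
  simp only [e1]

/-- Odd functions of period `2k` are spanned by the `hatSign k j` with `1 ≤ j < k`. -/
lemma sum_mul_hatSign {k : ℕ} (hk : 0 < k) {φ : ℤ → ℂ} (hodd : ∀ N, φ (-N) = -φ N)
    (hper : ∀ N i, φ (N + 2 * k * i) = φ N) (N : ℤ) :
    ∑ j ∈ Finset.Icc 1 (k - 1), φ j * hatSign k j N = φ N := by
  have hlow : ∀ m : ℕ, m ≤ k → ∑ j ∈ Finset.Icc 1 (k - 1), φ j * hatSign k j m = φ m := by
    intro m hm
    rw [Finset.sum_congr rfl fun j hj => by rw [hatSign_of_mem hj hm]]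
    simp only [mul_ite, mul_one, mul_zero, Finset.sum_ite_eq', Finset.mem_Icc]
    split_ifs with h
    · rfl
    -- Oddness forces φ(0) = 0, and together with periodicity φ(k) = 0, so the omitted values j = 0
    -- and j = k carry nothing.
    · rcases (show m = 0 ∨ m = k by omega) with rfl | rfl
      · have := hodd 0
        rw [neg_zero] at this
        rw [Nat.cast_zero]
        linear_combination -this / 2
      · have h1 := hodd m
        have h2 := hper (-m) 1
        rw [show -(m : ℤ) + 2 * m * 1 = m by ring] at h2
        linear_combination -(h1 + h2) / 2
  have hk2 : (0 : ℤ) < 2 * k := by omega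
  have h0 := Int.emod_nonneg N hk2.ne'
  have h1 := Int.emod_lt_of_pos N hk2
  have hN : N = N % (2 * k) + 2 * k * (N / (2 * k)) := (Int.emod_add_mul_ediv N (2 * k)).symm
  set m := N % (2 * k)
  rw [hN]
  simp only [hatSign_add_mul, hper]
  by_cases hm : m ≤ k
  · obtain ⟨a, ha⟩ := Int.eq_ofNat_of_zero_le h0
    rw [ha]
    exact hlow a (by omega)
  · obtain ⟨a, ha⟩ := Int.eq_ofNat_of_zero_le (show 0 ≤ 2 * k - m by omega)
    have hm' : m = -(a : ℤ) + 2 * k * 1 := by omega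
    rw [hm']
    simp only [hatSign_add_mul, hper, hatSign_neg, hodd, mul_neg, Finset.sum_neg_distrib]
    rw [hlow a (by omega)]

/-- `Ω̂^{(k,d)}_{r,r'} = Ω^{(k,d)}_{r,r'} - Ω^{(k,d)}_{r,-r'}`. -/
def OmegaHat (k d : ℕ) (r r' : ℤ) : ℂ := Omega k d r r' - Omega k d r (-r')

lemma OmegaHatADE_eq (Y : ADE) (r r' : ℤ) :
    OmegaHatADE Y r r' = ∑ d ∈ Y.divisors, OmegaHat Y.coxeter d r r' := by
  simp only [OmegaHatADE, OmegaADE, OmegaHat, Finset.sum_sub_distrib]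

lemma Omega_neg (k d : ℕ) (r r' : ℤ) : Omega k d (-r) r' = Omega k d r (-r') := by
  unfold Omega
  rw [show -r + r' = -(r + -r') by ring, show -r - r' = -(r - -r') by ring]
  exact if_congr (and_congr (dvd_neg) (dvd_neg)) rfl rfl

lemma OmegaHat_neg (k d : ℕ) (r r' : ℤ) : OmegaHat k d (-r) r' = -OmegaHat k d r r' := by
  rw [OmegaHat, OmegaHat, Omega_neg, Omega_neg, neg_neg, neg_sub]

lemma Omega_add_mul {k d : ℕ} (hd : d ∣ k) (r r' i : ℤ) :
    Omega k d (r + 2 * k * i) r' = Omega k d r r' := by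
  obtain ⟨e, rfl⟩ := hd
  rcases Nat.eq_zero_or_pos d with rfl | hd0
  · simp
  unfold Omega
  rw [Nat.mul_div_cancel_left e hd0]
  push_cast
  rw [show r + 2 * (d * e) * i + r' = r + r' + 2 * d * (e * i) by ring,
    show r + 2 * (d * e) * i - r' = r - r' + 2 * e * (d * i) by ring]
  exact if_congr (and_congr (dvd_add_left (dvd_mul_right _ _)) (dvd_add_left (dvd_mul_right _ _)))
    rfl rfl

lemma OmegaHat_add_mul {k d : ℕ} (hd : d ∣ k) (r r' i : ℤ) :
    OmegaHat k d (r + 2 * k * i) r' = OmegaHat k d r r' := by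
  rw [OmegaHat, OmegaHat, Omega_add_mul hd, Omega_add_mul hd]

lemma sum_OmegaHat_mul_hatSign {k d : ℕ} (hk : 0 < k) (hd : d ∣ k) (r' N : ℤ) :
    ∑ j ∈ Finset.Icc 1 (k - 1), OmegaHat k d j r' * hatSign k j N = OmegaHat k d N r' :=
  sum_mul_hatSign hk (φ := fun r => OmegaHat k d r r') (fun r => OmegaHat_neg k d r r')
    (fun r i => OmegaHat_add_mul hd r r' i) N

lemma card_filter_dvd {d e : ℕ} (hd : 0 < d) (he : 0 < e) :
    ((Finset.Icc 1 (d * e - 1)).filter fun j => d ∣ j).card = e - 1 := by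
  have h := Nat.Ioc_filter_dvd_card_eq_div (d * e - 1) d
  have h1 : Finset.Ioc 0 (d * e - 1) = Finset.Icc 1 (d * e - 1) := by
    ext x; simp only [Finset.mem_Ioc, Finset.mem_Icc]; omega
  rw [h1] at h
  rw [h]
  obtain ⟨f, rfl⟩ : ∃ f, e = f + 1 := ⟨e - 1, by omega⟩
  rw [Nat.add_sub_cancel, Nat.div_eq_iff hd]
  have := mul_add_one d f
  have := mul_comm d f
  omega

/-- On the diagonal Ω detects d ∣ j, and at (j, −j) it detects e ∣ j, giving (e − 1) − (d − 1). -/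
lemma trace_OmegaHat {d e : ℕ} (hd : 0 < d) (he : 0 < e) :
    ∑ j ∈ Finset.Icc 1 (d * e - 1), OmegaHat (d * e) d (j : ℕ) (j : ℕ) = (e : ℂ) - d := by
  have h1 : ∀ j : ℕ, Omega (d * e) d j j = if d ∣ j then 1 else 0 := by
    intro j
    unfold Omega
    rw [← two_mul, sub_self]
    simp [mul_dvd_mul_iff_left, Int.natCast_dvd_natCast]
  have h2 : ∀ j : ℕ, Omega (d * e) d j (-(j : ℤ)) = if e ∣ j then 1 else 0 := by
    intro j
    unfold Omega
    rw [sub_neg_eq_add, ← two_mul, add_neg_cancel, Nat.mul_div_cancel_left e hd]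
    simp [mul_dvd_mul_iff_left, Int.natCast_dvd_natCast]
  simp only [OmegaHat, h1, h2, Finset.sum_sub_distrib, Finset.sum_boole]
  rw [card_filter_dvd hd he, mul_comm d e, card_filter_dvd he hd, Nat.cast_sub he, Nat.cast_sub hd]
  ring

end OddPeriodic

/-! ### Lerch sums as sums over cones. -/

section Cones

variable (τ : ℍ)

lemma divTerm_neg (p : ℤ × ℤ) : divTerm τ (-p) = -divTerm τ p := by
  simp [divTerm]

lemma summable_divTerm_quadrant :
    Summable ({p : ℤ × ℤ | 0 < p.1 ∧ 0 < p.2}.indicator (divTerm τ)) := by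
  have hi : Function.Injective fun p : ℕ+ × ℕ+ => (((p.1 : ℕ) : ℤ), ((p.2 : ℕ) : ℤ)) := by
    rintro ⟨a, b⟩ ⟨c, d⟩ h
    simp only [Prod.mk.injEq, Nat.cast_inj, PNat.coe_inj] at h
    rw [h.1, h.2]
  rw [← hi.summable_iff]
  · refine (summable_prod_mul_pow 1 (norm_ex_tau_lt_one τ)).congr fun p => ?_
    have h : (((p.1 : ℕ) : ℤ), ((p.2 : ℕ) : ℤ)) ∈ {p : ℤ × ℤ | 0 < p.1 ∧ 0 < p.2} := by
      simp
    rw [Function.comp_apply, Set.indicator_of_mem h, divTerm, pow_one, ← ex_nat_mul]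
    push_cast
    rfl
  · rintro ⟨a, b⟩ h
    refine Set.indicator_of_notMem (fun h' => h ?_) _
    exact ⟨(⟨a.toNat, by have := h'.1; simp only at this; omega⟩,
      ⟨b.toNat, by have := h'.2; simp only at this; omega⟩), by
        have h1 := h'.1
        have h2 := h'.2
        simp only at h1 h2
        simp only [PNat.mk_coe, Prod.mk.injEq]
        omega⟩

lemma summable_divTerm_indicator {s : Set (ℤ × ℤ)} (hs : ∀ p ∈ s, 0 < p.1 ∧ 0 < p.2) :
    Summable (s.indicator (divTerm τ)) := by
  have := (summable_divTerm_quadrant τ).indicator s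
  rwa [Set.indicator_indicator, Set.inter_eq_left.2 (show s ⊆ {p | 0 < p.1 ∧ 0 < p.2} from hs)] at this

/-- The pairs with `d r > e s > 0`. -/
def openCone (d e : ℕ) : Set (ℤ × ℤ) := {p | (e : ℤ) * p.2 < d * p.1 ∧ 0 < p.2}

/-- The pairs with `d r ≥ e s > 0`. -/
def closedCone (d e : ℕ) : Set (ℤ × ℤ) := {p | (e : ℤ) * p.2 ≤ d * p.1 ∧ 0 < p.2}

/-- The pairs with `d r = e s > 0`. -/
def coneRay (d e : ℕ) : Set (ℤ × ℤ) := {p | (e : ℤ) * p.2 = d * p.1 ∧ 0 < p.2}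

variable {d e : ℕ}

lemma closedCone_pos (hd : 0 < d) (he : 0 < e) : ∀ p ∈ closedCone d e, 0 < p.1 ∧ 0 < p.2 := by
  rintro p ⟨h1, h2⟩
  refine ⟨?_, h2⟩
  have h3 : 0 < (e : ℤ) * p.2 := by positivity
  exact pos_of_mul_pos_right (h3.trans_le h1) (by positivity)

lemma openCone_subset : openCone d e ⊆ closedCone d e := fun _ h => ⟨h.1.le, h.2⟩

lemma coneRay_subset : coneRay d e ⊆ closedCone d e := fun _ h => ⟨h.1.le, h.2⟩

/-- With k = de a common factor d cancels from the inequalities, so the cones depend only on the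
pair (d, e). -/
lemma cone_sq_left (hd : 0 < d) (he : 0 < e) : cone (d ^ 2) (d * e) = openCone d e := by
  ext p
  have hd' : (0 : ℤ) < d := by exact_mod_cast hd
  have he' : (0 : ℤ) < e := by exact_mod_cast he
  simp only [cone, openCone, Set.mem_ofPred_eq, Nat.cast_mul, Nat.cast_pow]
  rw [mul_pos_iff_of_pos_left (by positivity), mul_assoc, sq, mul_assoc (d : ℤ),
    mul_lt_mul_iff_right₀ hd']

lemma cone_sq_right (hd : 0 < d) : cone (d * e) (d ^ 2) = openCone e d := by
  ext p
  have hd' : (0 : ℤ) < d := by exact_mod_cast hd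
  simp only [cone, openCone, Set.mem_ofPred_eq, Nat.cast_mul, Nat.cast_pow]
  rw [mul_pos_iff_of_pos_left (by positivity), mul_assoc, sq, mul_assoc (d : ℤ),
    mul_lt_mul_iff_right₀ hd']

/-- The sum of `divTerm` over a set of pairs. -/
noncomputable def coneSum (s : Set (ℤ × ℤ)) : ℂ := ∑' p, s.indicator (divTerm τ) p

lemma coneSum_closedCone (hd : 0 < d) (he : 0 < e) :
    coneSum τ (closedCone d e) = coneSum τ (openCone d e) + coneSum τ (coneRay d e) := by
  have h := closedCone_pos hd he
  rw [coneSum, coneSum, coneSum, ← (summable_divTerm_indicator τ fun p hp =>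
    h p (openCone_subset hp)).tsum_add (summable_divTerm_indicator τ fun p hp =>
    h p (coneRay_subset hp))]
  refine tsum_congr fun p => ?_
  have hu : closedCone d e = openCone d e ∪ coneRay d e := by
    ext p
    simp only [closedCone, openCone, coneRay, Set.mem_union, Set.mem_ofPred_eq]
    omega
  have hdis : Disjoint (openCone d e) (coneRay d e) :=
    Set.disjoint_left.2 fun p h1 h2 => h1.1.ne h2.1
  rw [hu, Set.indicator_union_of_disjoint hdis]

/-- Exchanging r and s maps one ray to the other and preserves q^{rs}; on the ray e s = d r converts
the prefactors. -/
lemma coneSum_coneRay (hd : 0 < d) (he : 0 < e) :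
    e * coneSum τ (coneRay d e) = d * coneSum τ (coneRay e d) := by
  rw [coneSum, coneSum, ← tsum_mul_left, ← tsum_mul_left]
  have h := (Equiv.prodComm ℤ ℤ).tsum_eq fun p => (d : ℂ) * (coneRay e d).indicator (divTerm τ) p
  rw [← h]
  refine tsum_congr fun p => ?_
  have hiff : (Equiv.prodComm ℤ ℤ) p ∈ coneRay e d ↔ p ∈ coneRay d e := by
    simp only [coneRay, Set.mem_ofPred_eq, Equiv.prodComm_apply, Prod.fst_swap, Prod.snd_swap]
    have hd' : (0 : ℤ) < d := by exact_mod_cast hd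
    have he' : (0 : ℤ) < e := by exact_mod_cast he
    refine ⟨fun ⟨h1, h2⟩ => ⟨h1.symm, ?_⟩, fun ⟨h1, h2⟩ => ⟨h1.symm, ?_⟩⟩
    · exact pos_of_mul_pos_right (h1 ▸ mul_pos hd' h2) he'.le
    · exact pos_of_mul_pos_right (h1 ▸ mul_pos he' h2) hd'.le
  by_cases hp : p ∈ coneRay d e
  · rw [Set.indicator_of_mem hp, Set.indicator_of_mem (hiff.2 hp), divTerm, divTerm]
    have h1 : (e : ℂ) * p.2 = d * p.1 := by exact_mod_cast hp.1
    simp only [Equiv.prodComm_apply, Prod.fst_swap, Prod.snd_swap]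
    rw [← mul_assoc, ← mul_assoc, h1, mul_comm (p.1 : ℂ) p.2]
  · rw [Set.indicator_of_notMem hp, Set.indicator_of_notMem (fun h => hp (hiff.1 h)), mul_zero,
      mul_zero]

lemma F2_eq (hd : 0 < d) (he : 0 < e) :
    F2 (d * e) d τ = d * coneSum τ (openCone e d) - e * coneSum τ (openCone d e) := by
  have hd' : (d : ℂ) ≠ 0 := by exact_mod_cast hd.ne'
  rw [F2, cone_sq_right hd, cone_sq_left hd he, coneSum, coneSum, tsum_subtype, tsum_subtype,
    Nat.cast_mul, mul_div_cancel_left₀ _ hd']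

lemma summable_divTerm_openCone (hd : 0 < d) (he : 0 < e) :
    Summable fun p : openCone d e => divTerm τ p :=
  summable_subtype_iff_indicator.2 (summable_divTerm_indicator τ fun p hp =>
    closedCone_pos hd he p (openCone_subset hp))

/-- The signs with which the translates of a cone contribute to a Lerch sum. -/
def coneSign (b n : ℤ) : ℂ := if 0 < b then (if n < 0 then 1 else 0) else if n < 0 then 0 else -1

lemma hasSum_coneSign {t : ℤ} (ht : t ≠ 0) :
    HasSum (fun n : ℤ => coneSign t n * ex (-(t * n) * τ)) (ex (t * τ) / (1 - ex (t * τ))) := by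
  have key : ∀ m : ℤ, 0 < m → ‖ex (m * τ)‖ < 1 := by
    intro m hm
    obtain ⟨a, rfl⟩ := Int.eq_ofNat_of_zero_le hm.le
    rw [Int.cast_natCast, ex_nat_mul, norm_pow]
    exact pow_lt_one₀ (norm_nonneg _) (norm_ex_tau_lt_one τ) (by omega)
  rcases lt_or_gt_of_ne ht with h | h
  · have h1 := key (-t) (by omega)
    have h2 := (hasSum_geometric_of_norm_lt_one h1).neg
    have h3 : -(1 - ex (((-t : ℤ) : ℂ) * τ))⁻¹ + 0 = ex (t * τ) / (1 - ex (t * τ)) := by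
      have hx := ex_ne_zero (t * (τ : ℂ))
      have e1 : ex (((-t : ℤ) : ℂ) * τ) = (ex (t * τ))⁻¹ := by
        rw [← ex_neg]; congr 1; push_cast; ring
      rw [e1] at h1 ⊢
      generalize ex (t * (τ : ℂ)) = x at *
      have h4 : 1 - x ≠ 0 := fun h5 => by
        rw [← sub_eq_zero.1 h5, inv_one, norm_one] at h1; exact lt_irrefl _ h1
      have h5 : 1 - x⁻¹ = -(1 - x) / x := by field_simp; ring
      rw [h5, inv_div, div_neg, neg_neg, add_zero]
    rw [← h3]
    refine HasSum.of_nat_of_neg_add_one ?_ ?_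
    · refine h2.congr_fun fun n => ?_
      rw [coneSign, if_neg (by omega), if_neg (by omega), ← ex_nat_mul]
      rw [neg_one_mul]
      congr 2; push_cast; ring
    · refine hasSum_zero.congr_fun fun n => ?_
      rw [coneSign, if_neg (by omega), if_pos (by omega), zero_mul]
  · have h1 := key t h
    have h2 := (hasSum_geometric_of_norm_lt_one h1).mul_left (ex (t * τ))
    rw [← div_eq_mul_inv] at h2
    rw [← zero_add (ex (t * (τ : ℂ)) / _)]
    refine HasSum.of_nat_of_neg_add_one ?_ ?_
    · refine hasSum_zero.congr_fun fun n => ?_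
      rw [coneSign, if_pos h, if_neg (by omega), zero_mul]
    · refine h2.congr_fun fun n => ?_
      rw [coneSign, if_pos h, if_pos (by omega), ← ex_nat_mul, ← ex_add]
      rw [one_mul]
      congr 1; push_cast; ring

/-- A term of the Lerch sum attached to the two cones. -/
noncomputable def coneTerm (d e : ℕ) (p : ℤ × ℤ) : ℂ :=
  coneSign p.2 (e * p.2 - d * p.1) * divTerm τ p

/-- For s < 0 the sign −1 is offset by the oddness of `divTerm`. The boundary falls to the second
cone because `coneSign` tests n < 0 strictly. -/
lemma coneTerm_eq (p : ℤ × ℤ) : coneTerm τ d e p =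
    (openCone d e).indicator (divTerm τ) p + (closedCone d e).indicator (divTerm τ) (-p) := by
  rcases lt_trichotomy p.2 0 with h | h | h
  · have h1 : p ∉ openCone d e := fun h' => by have := h'.2; omega
    rw [Set.indicator_of_notMem h1, zero_add, coneTerm, coneSign, if_neg (by omega)]
    by_cases h2 : -p ∈ closedCone d e
    · have := h2.1
      simp only [Prod.fst_neg, Prod.snd_neg, mul_neg] at this
      rw [Set.indicator_of_mem h2, if_neg (by omega), divTerm_neg, neg_one_mul]
    · have : ¬ ((e : ℤ) * -p.2 ≤ d * -p.1) := fun h3 => h2 ⟨h3, by simpa using h⟩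
      simp only [mul_neg] at this
      rw [Set.indicator_of_notMem h2, if_pos (by omega), zero_mul]
  · have h1 : p ∉ openCone d e := fun h' => by have := h'.2; omega
    have h2 : -p ∉ closedCone d e := fun h' => by have := h'.2; simp at this; omega
    rw [Set.indicator_of_notMem h1, Set.indicator_of_notMem h2, coneTerm, divTerm, h]
    simp
  · have h1 : -p ∉ closedCone d e := fun h' => by have := h'.2; simp at this; omega
    rw [Set.indicator_of_notMem h1, add_zero, coneTerm, coneSign, if_pos h]
    by_cases h2 : p ∈ openCone d e
    · rw [Set.indicator_of_mem h2, if_pos (by have := h2.1; omega), one_mul]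
    · have : ¬ ((e : ℤ) * p.2 < d * p.1) := fun h3 => h2 ⟨h3, h⟩
      rw [Set.indicator_of_notMem h2, if_neg (by omega), zero_mul]

lemma hasSum_coneTerm (hd : 0 < d) (he : 0 < e) : HasSum (coneTerm τ d e)
    (coneSum τ (openCone d e) + coneSum τ (closedCone d e)) := by
  have h := closedCone_pos hd he
  have h1 := (summable_divTerm_indicator τ fun p hp => h p (openCone_subset hp)).hasSum
  have h2 := (Equiv.neg (ℤ × ℤ)).hasSum_iff.2 (summable_divTerm_indicator τ h).hasSum
  exact (h1.add h2).congr_fun fun p => coneTerm_eq τ p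

/-- A term of the Lerch sum attached to `Ω̂^{(de,d)}`. -/
noncomputable def lerchTerm (d e : ℕ) (j t : ℤ) : ℂ :=
  if (d : ℤ) ∣ t - j ∧ (e : ℤ) ∣ t then
    ex (t * (t - j) / (d * e) * τ) * (t * ex (t * τ) / (1 - ex (t * τ))) else 0

lemma sum_lerchTerm_fiber (hd : 0 < d) (he : 0 < e) (b : ℤ) :
    ∑ j ∈ Finset.range (d * e), lerchTerm τ d e j (e * b) = e * ∑' r, coneTerm τ d e (r, b) := by
  rcases eq_or_ne b 0 with rfl | hb
  · simp [lerchTerm, coneTerm, divTerm]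
  have hd' : (d : ℂ) ≠ 0 := by exact_mod_cast hd.ne'
  have he' : (e : ℂ) ≠ 0 := by exact_mod_cast he.ne'
  have hb' : (b : ℂ) ≠ 0 := by exact_mod_cast hb
  have ht : (e : ℤ) * b ≠ 0 := mul_ne_zero (by exact_mod_cast he.ne') hb
  -- The residue j and the geometric index n combine into N = de·n + j ∈ ℤ, and then e b − N = d r
  -- recovers the exponent q^{rb}. The sign depends only on n, because 0 ≤ j < de.
  let F : ℤ → ℂ := fun N => if (d : ℤ) ∣ e * b - N then
    coneSign b N * (b * ex (b * (e * b - N) / d * τ)) else 0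
  have hi : Function.Injective fun r : ℤ => (e : ℤ) * b - d * r := by
    intro r s h
    have : (d : ℤ) * r = d * s := by simp only at h; omega
    exact mul_left_cancel₀ (by exact_mod_cast hd.ne') this
  have h0 : ∀ N ∉ Set.range (fun r : ℤ => (e : ℤ) * b - d * r), F N = 0 := fun N hN =>
    if_neg fun ⟨r, hr⟩ => hN ⟨r, by simp only; omega⟩
  have hF : ∀ r : ℤ, F (e * b - d * r) = coneTerm τ d e (r, b) := by
    intro r
    simp only [F, sub_sub_cancel, dvd_mul_right, if_true, coneTerm, divTerm]
    congr 3
    push_cast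
    field_simp
    ring
  have hs : Summable F := by
    rw [← hi.summable_iff h0]
    refine ((hasSum_coneTerm τ hd he).summable.prod_symm.prod_factor b).congr fun r => ?_
    exact (hF r).symm
  have h1 : ∑' r, coneTerm τ d e (r, b) = ∑' N, F N := by
    rw [← hi.tsum_eq (f := F) (fun N hN => by_contra fun h => hN (h0 N h))]
    exact tsum_congr fun r => (hF r).symm
  rw [h1, ← tsum_residues (Nat.mul_pos hd he) hs, Finset.mul_sum]
  refine Finset.sum_congr rfl fun j hj => ?_
  have hj := Finset.mem_range.1 hj
  have hsign : ∀ n : ℤ, coneSign b ((d * e : ℕ) * n + j) = coneSign (e * b) n := by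
    intro n
    have hk : (0 : ℤ) < (d * e : ℕ) := by exact_mod_cast Nat.mul_pos hd he
    have hj' : (j : ℤ) < (d * e : ℕ) := by exact_mod_cast hj
    generalize ((d * e : ℕ) : ℤ) = k at *
    have h2 : (0 < (e : ℤ) * b) ↔ 0 < b := mul_pos_iff_of_pos_left (by exact_mod_cast he)
    have h3 : k * n + j < 0 ↔ n < 0 := by
      constructor
      · intro h
        by_contra! h4
        have := mul_nonneg hk.le h4
        omega
      · intro h
        have := mul_le_mul_of_nonneg_left (show n ≤ -1 by omega) hk.le
        omega
    simp only [coneSign, h2, h3]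
  have hdvd : ∀ n : ℤ, (d : ℤ) ∣ e * b - ((d * e : ℕ) * n + j) ↔ (d : ℤ) ∣ e * b - j := by
    intro n
    rw [show (e : ℤ) * b - ((d * e : ℕ) * n + j) = e * b - j - d * (e * n) by push_cast; ring]
    exact dvd_sub_left (dvd_mul_right _ _)
  by_cases h : (d : ℤ) ∣ e * b - j
  · rw [lerchTerm, if_pos ⟨h, dvd_mul_right _ _⟩, mul_div_assoc _ (ex _), ← (hasSum_coneSign τ ht).tsum_eq,
      ← tsum_mul_left, ← tsum_mul_left, ← tsum_mul_left]
    refine tsum_congr fun n => ?_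
    simp only [F]
    rw [if_pos ((hdvd n).2 h), hsign]
    have h2 : ex (b * (e * b - ((((d * e : ℕ) : ℤ) * n + j : ℤ) : ℂ)) / d * τ) =
        ex ((e * b : ℤ) * ((e * b : ℤ) - (j : ℤ)) / (d * e) * τ) *
          ex (-((e * b : ℤ) * n) * τ) := by
      rw [← ex_add]
      congr 1
      push_cast
      field_simp
      ring
    rw [h2]
    push_cast
    ring
  · rw [lerchTerm, if_neg fun h' => h h'.1]
    simp only [F, hdvd, if_neg h, tsum_zero, mul_zero]

lemma summable_lerchTerm (hd : 0 < d) (he : 0 < e) (j : ℤ) :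
    Summable fun t => lerchTerm τ d e j t := by
  let H : ℤ → ℂ := fun t => if (d : ℤ) ∣ t - j ∧ (e : ℤ) ∣ t then
    ex (t * (t - j) / (d * e) * τ) else 0
  have hH : ∀ v : ℂ, Summable fun t : ℤ => H t * ex (t * v) := by
    intro v
    have ha : 0 < ((τ : ℂ) / (d * e)).im := by
      have : (0 : ℝ) < d * e := by positivity
      rw [show (d * e : ℂ) = ((d * e : ℝ) : ℂ) by push_cast; rfl, Complex.div_ofReal_im]
      exact div_pos τ.im_pos this
    refine Summable.of_norm_bounded
      (summable_ex_quadratic ha (v - j * (τ / (d * e))) 0).norm fun t => ?_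
    simp only [H]
    split_ifs
    · rw [← ex_add]
      refine le_of_eq (congrArg (fun x => ‖ex x‖) ?_)
      ring
    · rw [zero_mul, norm_zero]
      exact norm_nonneg _
  -- `weight_double_sum` needs a vanishing total, so H is corrected at t = 0, where the factor t
  -- removes the correction again; the point 1/2 is an arbitrary choice.
  have hH' : ∀ v : ℂ, Summable fun t : ℤ => (H t - if t = 0 then ∑' t, H t else 0) * ex (t * v) := by
    intro v
    have := (hasSum_ite_eq (0 : ℤ) (∑' t, H t)).summable
    refine ((hH v).sub this).congr fun t => ?_
    split_ifs with h <;> simp [h]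
  have hs : Summable H := by simpa using hH 0
  have h0 : ∑' t, (H t - if t = 0 then ∑' t, H t else 0) = 0 := by
    rw [hs.tsum_sub (hasSum_ite_eq (0 : ℤ) (∑' t, H t)).summable, tsum_ite_eq, sub_self]
  have hw : OffLattice τ (1 / 2) := offLattice_of_mem_twoTorsion τ (by simp [twoTorsion])
  refine (weight_double_sum hw hH' h0).1.congr fun t => ?_
  rcases eq_or_ne t 0 with rfl | ht
  · simp [lerchTerm]
  · simp only [lerchTerm, H, if_neg ht, sub_zero]
    split_ifs <;> simp

lemma sum_lerchTerm (hd : 0 < d) (he : 0 < e) :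
    ∑ j ∈ Finset.range (d * e), ∑' t, lerchTerm τ d e j t =
      e * (coneSum τ (openCone d e) + coneSum τ (closedCone d e)) := by
  have he' : (e : ℤ) ≠ 0 := by exact_mod_cast he.ne'
  rw [← Summable.tsum_finsetSum (f := fun j : ℕ => lerchTerm τ d e j) fun j _ =>
    summable_lerchTerm τ hd he j]
  have hi : Function.Injective fun b : ℤ => (e : ℤ) * b := mul_right_injective₀ he'
  rw [← hi.tsum_eq (f := fun t => ∑ j ∈ Finset.range (d * e), lerchTerm τ d e j t)]
  · have h := hasSum_coneTerm τ hd he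
    have hs := h.summable.prod_symm
    rw [tsum_congr fun b => sum_lerchTerm_fiber τ hd he b, tsum_mul_left, ← h.tsum_eq,
      ← (Equiv.prodComm ℤ ℤ).tsum_eq (coneTerm τ d e)]
    exact congrArg _ hs.tsum_prod.symm
  · intro t ht
    by_contra h
    refine ht (Finset.sum_eq_zero fun j _ => ?_)
    rw [lerchTerm, if_neg]
    rintro ⟨-, b, rfl⟩
    exact h ⟨b, rfl⟩

/-- The open cones give −2 F₂, and the rays contribute e · ray(d, e) − d · ray(e, d) = 0. -/
lemma sum_lerchTerm_sub (hd : 0 < d) (he : 0 < e) :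
    ∑ j ∈ Finset.Icc 1 (d * e - 1), ∑' t, (lerchTerm τ d e (j : ℕ) t - lerchTerm τ e d (j : ℕ) t) =
      -2 * F2 (d * e) d τ := by
  have h1 : ∀ j : ℕ, ∑' t, (lerchTerm τ d e j t - lerchTerm τ e d j t) =
      ∑' t, lerchTerm τ d e j t - ∑' t, lerchTerm τ e d j t := fun j =>
    (summable_lerchTerm τ hd he j).tsum_sub (summable_lerchTerm τ he hd j)
  -- At j = 0 the two terms coincide, so the sum extends to a full set of residues.
  have h2 : ∀ t, lerchTerm τ d e 0 t - lerchTerm τ e d 0 t = 0 := by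
    intro t
    simp only [lerchTerm, sub_zero, and_comm, mul_comm (d : ℂ) e]
    exact sub_self _
  have h3 : Finset.range (d * e) = insert 0 (Finset.Icc 1 (d * e - 1)) := by
    have := Nat.mul_pos hd he
    ext x; simp only [Finset.mem_range, Finset.mem_insert, Finset.mem_Icc]; omega
  have h4 : ∑ j ∈ Finset.range (d * e), ∑' t, (lerchTerm τ d e j t - lerchTerm τ e d j t) =
      ∑ j ∈ Finset.Icc 1 (d * e - 1), ∑' t, (lerchTerm τ d e j t - lerchTerm τ e d j t) := by
    rw [h3, Finset.sum_insert (by simp)]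
    simp only [Nat.cast_zero, h2, tsum_zero, zero_add]
  have h5 := sum_lerchTerm τ he hd
  rw [mul_comm e d] at h5
  rw [← h4, Finset.sum_congr rfl fun j _ => h1 j, Finset.sum_sub_distrib, sum_lerchTerm τ hd he, h5,
    coneSum_closedCone τ hd he, coneSum_closedCone τ he hd, F2_eq τ hd he]
  linear_combination coneSum_coneRay τ hd he

end Cones

/-! ### Contraction with Ω̂ and the rank. -/

section Assembly

variable (τ : ℍ) {d e : ℕ}

/-- The ratio of Gaussians is q^{t(t−j)/de}. The two parts of Ω̂ at (j − 2t, j) impose d ∣ t − j, e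
∣ t and the same conditions with d and e exchanged. -/
lemma OmegaHat_mul_gaussian (hd : 0 < d) (he : 0 < e) (j t : ℤ) :
    (gaussian τ (d * e) j)⁻¹ * (OmegaHat (d * e) d (j - 2 * t) j * gaussian τ (d * e) (j - 2 * t) *
      (t * ex (t * τ) / (1 - ex (t * τ)))) = lerchTerm τ d e j t - lerchTerm τ e d j t := by
  have hd' : (d : ℂ) ≠ 0 := by exact_mod_cast hd.ne'
  have he' : (e : ℂ) ≠ 0 := by exact_mod_cast he.ne'
  have h1 : Omega (d * e) d (j - 2 * t) j = if (d : ℤ) ∣ t - j ∧ (e : ℤ) ∣ t then 1 else 0 := by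
    unfold Omega
    rw [Nat.mul_div_cancel_left e hd, show j - 2 * t + j = 2 * -(t - j) by ring,
      show j - 2 * t - j = 2 * -t by ring]
    simp only [mul_dvd_mul_iff_left (two_ne_zero (α := ℤ)), dvd_neg]
  have h2 : Omega (d * e) d (j - 2 * t) (-j) = if (e : ℤ) ∣ t - j ∧ (d : ℤ) ∣ t then 1 else 0 := by
    unfold Omega
    rw [Nat.mul_div_cancel_left e hd, show j - 2 * t + -j = 2 * -t by ring,
      show j - 2 * t - -j = 2 * -(t - j) by ring]
    simp only [mul_dvd_mul_iff_left (two_ne_zero (α := ℤ)), dvd_neg, and_comm]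
  have h3 : gaussian τ (d * e) (j - 2 * t) =
      gaussian τ (d * e) j * ex (t * (t - j) / (d * e) * τ) := by
    rw [gaussian, gaussian, ← ex_add]
    congr 1
    push_cast
    field_simp
    ring
  have hg := gaussian_ne_zero τ (d * e) j
  rw [OmegaHat, h1, h2, h3, lerchTerm, lerchTerm, mul_comm (e : ℂ) d]
  generalize (t * ex (t * τ) / (1 - ex (t * τ)) : ℂ) = g
  generalize ex (t * (t - j) / (d * e) * (τ : ℂ)) = x
  generalize gaussian τ (d * e) j = y at *
  split_ifs <;> field_simp <;> ring

lemma sum_OmegaHat_mul_mu (hd : 0 < d) (he : 0 < e) (hk : 2 ≤ d * e) :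
    4 * ModularForm.eta (τ : ℂ) ^ 3 * ∑ w ∈ twoTorsion τ,
      ∑ j ∈ Finset.Icc 1 (d * e - 1), ∑ j' ∈ Finset.Icc 1 (d * e - 1),
        OmegaHat (d * e) d (j : ℕ) (j' : ℕ) * mu (d * e) j j' τ w w 0 =
      ((e : ℂ) - d) * EisensteinSeries.E2 τ - 24 * F2 (d * e) d τ := by
  set k := d * e with hkd
  have hk0 : 0 < k := by omega
  have hdk : d ∣ k := ⟨e, rfl⟩
  let T : ℕ → ℕ → ℂ := fun j j' => ∑' t : ℤ, hatCoeff τ k j (j' - 2 * t) *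
    (t * ex (t * τ) / (1 - ex (t * τ)))
  -- The Lerch part is the same at all three torsion points, so 4 · 3 = 12; the factor −2 from
  -- `sum_lerchTerm_sub` later makes it −24.
  have hmu : ∀ j ∈ Finset.Icc 1 (k - 1), ∀ j' : ℕ,
      4 * ModularForm.eta (τ : ℂ) ^ 3 * ∑ w ∈ twoTorsion τ, mu k j j' τ w w 0 =
      hatSign k j j' * EisensteinSeries.E2 τ + 12 * ((gaussian τ k j')⁻¹ * T j j') := by
    intro j hj j'
    have h1 : ∀ w ∈ twoTorsion τ, ModularForm.eta (τ : ℂ) ^ 3 * mu k j j' τ w w 0 =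
        -hatSign k j j' * wpSeries τ w + (gaussian τ k j')⁻¹ * T j j' := fun w hw =>
      eta_cube_mul_mu_eq hk hj j' (offLattice_of_mem_twoTorsion τ hw)
    rw [mul_assoc, Finset.mul_sum, Finset.sum_congr rfl h1, Finset.sum_add_distrib,
      ← Finset.mul_sum, sum_wpSeries_twoTorsion, Finset.sum_const, card_twoTorsion]
    simp only [nsmul_eq_mul]
    push_cast
    ring
  have hT : ∀ j' : ℕ, ∑ j ∈ Finset.Icc 1 (k - 1), OmegaHat k d j j' * ((gaussian τ k j')⁻¹ * T j j') =
      ∑' t, (lerchTerm τ d e j' t - lerchTerm τ e d j' t) := by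
    intro j'
    have hw : OffLattice τ (1 / 2) := offLattice_of_mem_twoTorsion τ (by simp [twoTorsion])
    have hs : ∀ j : ℕ, Summable fun t : ℤ => hatCoeff τ k j (j' - 2 * t) *
        (t * ex (t * τ) / (1 - ex (t * τ))) := fun j =>
      (weight_double_sum hw (H := fun t => hatCoeff τ k j (j' - 2 * t))
        (summable_hatCoeff_sub τ hk0 j j') (tsum_hatCoeff_parity τ hk0 j j')).1
    simp only [T, ← tsum_mul_left]
    rw [← Summable.tsum_finsetSum fun j _ => ((hs j).mul_left _).mul_left _]
    refine tsum_congr fun t => ?_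
    rw [← OmegaHat_mul_gaussian τ hd he, ← hkd, ← sum_OmegaHat_mul_hatSign hk0 hdk, Finset.sum_mul,
      Finset.sum_mul, Finset.mul_sum]
    refine Finset.sum_congr rfl fun j _ => ?_
    rw [hatCoeff]
    ring
  have hcomm : 4 * ModularForm.eta (τ : ℂ) ^ 3 * ∑ w ∈ twoTorsion τ,
      ∑ j ∈ Finset.Icc 1 (k - 1), ∑ j' ∈ Finset.Icc 1 (k - 1),
        OmegaHat k d j j' * mu k j j' τ w w 0 =
      ∑ j' ∈ Finset.Icc 1 (k - 1), ∑ j ∈ Finset.Icc 1 (k - 1), OmegaHat k d j j' *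
        (4 * ModularForm.eta (τ : ℂ) ^ 3 * ∑ w ∈ twoTorsion τ, mu k j j' τ w w 0) := by
    simp only [Finset.mul_sum]
    conv_lhs => rw [Finset.sum_comm]
    conv_rhs => rw [Finset.sum_comm]
    refine Finset.sum_congr rfl fun j _ => ?_
    rw [Finset.sum_comm]
    exact Finset.sum_congr rfl fun j' _ => Finset.sum_congr rfl fun w _ => by ring
  have hj' : ∀ j' : ℕ, ∑ j ∈ Finset.Icc 1 (k - 1), OmegaHat k d j j' *
        (4 * ModularForm.eta (τ : ℂ) ^ 3 * ∑ w ∈ twoTorsion τ, mu k j j' τ w w 0) =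
      OmegaHat k d j' j' * EisensteinSeries.E2 τ +
        12 * ∑' t, (lerchTerm τ d e j' t - lerchTerm τ e d j' t) := by
    intro j'
    rw [← hT, ← sum_OmegaHat_mul_hatSign hk0 hdk, Finset.sum_mul, Finset.mul_sum,
      ← Finset.sum_add_distrib]
    refine Finset.sum_congr rfl fun j hj => ?_
    rw [hmu j hj]
    ring
  rw [hcomm, Finset.sum_congr rfl fun j' _ => hj' j', Finset.sum_add_distrib, ← Finset.sum_mul,
    ← Finset.mul_sum, trace_OmegaHat hd he, sum_lerchTerm_sub τ hd he]
  ring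

lemma two_le_coxeter (Y : ADE) : 2 ≤ Y.coxeter := by
  cases Y <;> simp only [ADE.coxeter] <;> omega

lemma dvd_coxeter {Y : ADE} (hd : d ∈ Y.divisors) : d ∣ Y.coxeter := by
  cases Y with
  | A n hn => simp only [ADE.divisors, Finset.mem_singleton] at hd; simp [hd]
  | D n hn =>
    simp only [ADE.divisors, Finset.mem_insert, Finset.mem_singleton] at hd
    rcases hd with rfl | rfl
    · exact one_dvd _
    · exact dvd_mul_left _ _
  | _ => revert d; decide

/-- The traces of the Ω̂^{(k,d)} add up to the rank; for E₈ this reads 29 − 1 − 7 − 13 = 8. -/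
lemma sum_divisors_eq_rank (Y : ADE) :
    ∑ d ∈ Y.divisors, (((Y.coxeter / d : ℕ) : ℂ) - d) = Y.rank := by
  cases Y with
  | A n hn => simp [ADE.divisors, ADE.coxeter, ADE.rank]
  | D n hn =>
    obtain ⟨m, rfl⟩ : ∃ m, n = m + 2 := ⟨n - 2, by omega⟩
    simp only [ADE.divisors, ADE.coxeter, ADE.rank]
    rw [Finset.sum_pair (by omega), Nat.mul_div_cancel _ (by omega), Nat.div_one]
    simp
    ring
  | _ => simp [ADE.divisors, ADE.coxeter, ADE.rank]; norm_num

end Assembly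

end HelicitySupertrace

/-! ### The theorem, by summation over the divisors attached to Y. -/

open HelicitySupertrace in
theorem mainTheorem8 (Y : HelicitySupertrace.ADE) (τ : UpperHalfPlane) :
    -- the string functions entering the definition of `μ^Y` exist and are unique
    (∀ l : ℕ, 2 < Y.coxeter → l ≤ Y.coxeter - 2 →
      ∃! c : ℤ → ℂ, IsStringFunction (Y.coxeter - 2) l τ c) ∧
    -- the series defining `μ^Y(τ;w,w,0)` and `F_2^Y(τ)` converge absolutely
    (∀ w ∈ twoTorsion τ, ∀ j ∈ Finset.Icc 1 (Y.coxeter - 1), ∀ j' ∈ Finset.Icc 1 (Y.coxeter - 1),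
      Summable (muTerm Y.coxeter j j' τ w w 0)) ∧
    (∀ d ∈ Y.divisors,
      Summable (fun p : cone Y.coxeter (d ^ 2) => divTerm τ p) ∧
      Summable (fun p : cone (d ^ 2) Y.coxeter => divTerm τ p)) ∧
    -- the two expressions agree
    4 * ModularForm.eta (τ : ℂ) ^ 3 * ∑ w ∈ twoTorsion τ, muADE Y τ w w 0 =
      (Y.rank : ℂ) * EisensteinSeries.E2 τ - 24 * F2ADE Y τ := by
  refine ⟨fun l h2 _ => existsUnique_stringFunction τ (by omega) l,
    fun w hw j hj j' _ => summable_muTerm (two_le_coxeter Y) hj j'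
      (offLattice_of_mem_twoTorsion τ hw), fun d hd => ?_, ?_⟩
  · obtain ⟨e, he⟩ := dvd_coxeter hd
    have hk := two_le_coxeter Y
    have hd0 : 0 < d := Nat.pos_of_ne_zero fun h => by simp [he, h] at hk
    have he0 : 0 < e := Nat.pos_of_ne_zero fun h => by simp [he, h] at hk
    rw [he, cone_sq_left hd0 he0, cone_sq_right hd0]
    exact ⟨summable_divTerm_openCone τ he0 hd0, summable_divTerm_openCone τ hd0 he0⟩
  · have h : ∀ d ∈ Y.divisors, 4 * ModularForm.eta (τ : ℂ) ^ 3 * ∑ w ∈ twoTorsion τ,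
        ∑ j ∈ Finset.Icc 1 (Y.coxeter - 1), ∑ j' ∈ Finset.Icc 1 (Y.coxeter - 1),
          OmegaHat Y.coxeter d j j' * mu Y.coxeter j j' τ w w 0 =
        (((Y.coxeter / d : ℕ) : ℂ) - d) * EisensteinSeries.E2 τ - 24 * F2 Y.coxeter d τ := by
      intro d hd
      obtain ⟨e, he⟩ := dvd_coxeter hd
      have hk := two_le_coxeter Y
      have hd0 : 0 < d := Nat.pos_of_ne_zero fun h => by simp [he, h] at hk
      have he0 : 0 < e := Nat.pos_of_ne_zero fun h => by simp [he, h] at hk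
      rw [he] at hk ⊢
      rw [Nat.mul_div_cancel_left e hd0]
      exact sum_OmegaHat_mul_mu τ hd0 he0 hk
    have hsum := Finset.sum_congr rfl h
    rw [Finset.sum_sub_distrib, ← Finset.sum_mul, sum_divisors_eq_rank, ← Finset.mul_sum] at hsum
    rw [F2ADE, Finset.mul_sum _ (F2 Y.coxeter · τ), ← hsum, Finset.sum_comm]
    refine congrArg _ (Finset.sum_congr rfl fun w _ => ?_)
    rw [muADE, Finset.sum_comm (s := Y.divisors)]
    refine Finset.sum_congr rfl fun j _ => ?_
    rw [Finset.sum_comm (s := Y.divisors)]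
    refine Finset.sum_congr rfl fun j' _ => ?_
    rw [OmegaHatADE_eq, Finset.sum_mul]
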